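/- **Setting.** Let $\mathcal O\subset\mathbb R^d$ be a bounded domain (non-empty, open, connected). For $x\in\mathbb R^d$ let $\nu(x)$ be the set of unit vectors $\nu\in\mathbb R^d$ for which there is $C>0$ with $(x'-x)\cdot\nu+C|x-x'|^2\ge 0$ for all $x'\in\bar{\mathcal O}$. Assume that $\mathcal O$ is *admissible* in the sense of Lions and Sznitman: 1. $\nu(x)\neq\emptyset$ for every $x\in\partial\mathcal O$, and there is $C_0\ge0$ with $(x'-x)\cdot\nu+C_0|x-x'|^2\ge0$ for all $x'\in\mathcal O$, $x\in\partial\mathcal O$, $\nu\in\nu(x)$; 2. there are $\phi\in C^2(\mathbb R^d;\mathbb R)$ and $\alpha>0$ with $\nabla\phi(x)\cdot\nu\ge\alpha$ for all $x\in\partial\mathcal O$, $\nu\in\nu(x)$; 3. there are $k\ge1$, $\lambda>0$, $\rho>0$, unit vectors $a_1,\dots,a_k$ and points $x_1,\dots,x_k\in\partial\mathcal O$ such that $\partial\mathcal O\subseteq\bigcup_iB(x_i,\rho)$, and $\nu\cdot a_i\ge\lambda$ for all $i$, all $x\in\partial\mathcal O\cap B(x_i,2\rho)$ and all $\nu\in\nu(x)$.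 Let $\sigma:\bar{\mathcal O}\to\mathrm{Hom}(\mathbb R^r;\mathbb R^d)$ and $b:\bar{\mathcal O}\to\mathbb R^d$ be Lipschitz continuous and let $x_0\in\bar{\mathcal O}$. Let $\mathbb W$ be the standard Wiener measure on $C([0,\infty);\mathbb R^r)$. For a path $W$ and $N\in\mathbb N=\{0,1,2,\dots\}$ let $W^N$ be its $N$-dyadic linear polygonalization: $W^N_{m2^{-N}}=W_{m2^{-N}}$, and $W^N$ is linear on $[m2^{-N},(m+1)2^{-N}]$, for all $m\in\mathbb N$. Let $(X^N,L^N)$ be the solution of the reflected equation driven by $W^N$; that is, $X^N:[0,\infty)\to\bar{\mathcal O}$ is continuous, $L^N:[0,\infty)\to\mathbb R^d$ is continuous and of locally bounded variation, and, for all $t\ge0$, $$X^N_t=x_0+\int_0^t\sigma(X^N_s)\,dW^N_s+\int_0^tb(X^N_s)\,ds+L^N_t,$$ $$|L^N|_t=\int_0^t\mathbf 1_{\partial\mathcal O}(X^N_s)\,d|L^N|_s,\qquad \frac{dL^N_s}{d|L^N|_s}\in\nu(X^N_s)\quad d|L^N|\text{-a.e.},$$ where $|L^N|_t$ is the total variation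 of $L^N$ on $[0,t]$. For $\psi:[0,\infty)\to\mathbb R^n$ put $$\|\psi\|_{\beta,[0,T]}=\sup_{0\le u_1<u_2\le T}\frac{|\psi(u_2)-\psi(u_1)|}{(u_2-u_1)^\beta}\in[0,\infty].$$ **Theorem.** For every $N$ and every $W\in C([0,\infty);\mathbb R^r)$ there is exactly one such pair $(X^N,L^N)$. For all $\beta\in(0,\frac12)$, $p\in(1,\infty)$ and $T>0$ there is a constant $K=K_{\beta,p}(T)<\infty$, independent of $N$, such that for all $N$ and all $R>0$ $$\mathbb W\bigl(\|W^N\|_{\beta,[0,T]}\vee\|X^N\|_{\beta,[0,T]}\vee\|L^N\|_{\beta,[0,T]}\ge R\bigr)\le K R^{-p}.$$ Moreover, $(X^N,L^N,W^N)$ is for each $N$ a Borel measurable function of $W$ with values in $C([0,\infty);\bar{\mathcal O})\times C([0,\infty);\mathbb R^d)\times C([0,\infty);\mathbb R^r)$ (with the topology of locally uniform convergence), and the family of its laws $\mathbb P^N$, $N\ge0$, under $\mathbb W$ is tight. -/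

import Mathlib

open MeasureTheory ProbabilityTheory Set
open scoped NNReal ENNReal

noncomputable section

namespace ReflectedSDE

/-- The Euclidean space `ℝⁿ`. -/
abbrev E (n : ℕ) : Type := EuclideanSpace ℝ (Fin n)

/-- The space of continuous paths `[0, ∞) → Y`, with the topology of locally uniform convergence
(the compact-open topology). -/
abbrev Path (Y : Type) [TopologicalSpace Y] : Type := C(ℝ≥0, Y)

/-- Path space carries its Borel `σ`-algebra. -/
instance pathMeasurableSpace (Y : Type) [TopologicalSpace Y] : MeasurableSpace C(ℝ≥0, Y) :=
  borel _

instance pathBorelSpace (Y : Type) [TopologicalSpace Y] : BorelSpace C(ℝ≥0, Y) := ⟨rfl⟩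

/-! ### Admissible domains -/

/-- The set `ν(x)` of inward pointing unit proximal normal vectors to `O` at `x`. -/
def inwardNormals {d : ℕ} (O : Set (E d)) (x : E d) : Set (E d) :=
  {n | ‖n‖ = 1 ∧ ∃ C : ℝ, 0 < C ∧
    ∀ x' ∈ closure O, 0 ≤ inner ℝ (x' - x) n + C * ‖x - x'‖ ^ 2}

/-- Admissibility of a set `O`, in the sense of Lions and Sznitman. -/
structure IsAdmissible {d : ℕ} (O : Set (E d)) : Prop where
  nonempty_normals : ∀ x ∈ frontier O, (inwardNormals O x).Nonempty
  uniform_exterior_ball : ∃ C₀ : ℝ, 0 ≤ C₀ ∧ ∀ x' ∈ O, ∀ x ∈ frontier O,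
    ∀ n ∈ inwardNormals O x, 0 ≤ inner ℝ (x' - x) n + C₀ * ‖x - x'‖ ^ 2
  exists_potential : ∃ φ : E d → ℝ, ContDiff ℝ 2 φ ∧ ∃ α : ℝ, 0 < α ∧
    ∀ x ∈ frontier O, ∀ n ∈ inwardNormals O x, α ≤ inner ℝ (gradient φ x) n
  exists_cover : ∃ k : ℕ, 1 ≤ k ∧ ∃ lam : ℝ, 0 < lam ∧ ∃ R : ℝ, 0 < R ∧
    ∃ a c : Fin k → E d, (∀ i, ‖a i‖ = 1) ∧ (∀ i, c i ∈ frontier O) ∧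
      frontier O ⊆ ⋃ i, Metric.ball (c i) R ∧
      ∀ i, ∀ x ∈ frontier O ∩ Metric.ball (c i) (2 * R),
        ∀ n ∈ inwardNormals O x, lam ≤ inner ℝ n (a i)

/-! ### Reflected ordinary differential equations -/

/-- `μ` is the total variation measure `d|ℓ|` of the path `ℓ`: it gives `[0, t]` the total
variation `|ℓ|_t` of `ℓ` on `[0, t]`. (When all these are finite, this determines `μ`.) -/
def IsTotalVariationMeasure {d : ℕ} (ℓ : Path (E d)) (μ : Measure ℝ≥0) : Prop :=
  ∀ t : ℝ≥0, μ (Icc 0 t) = eVariationOn ℓ (Icc 0 t)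

/-- `(x, ℓ)` solves, for the piecewise smooth input `w` and the starting point `x₀`, the reflected
equation `dx = σ(x) dw + b(x) dt + dℓ`: the path `x` stays in `closure O`, `ℓ` is continuous with
locally bounded variation,
`x_t = x₀ + ∫₀ᵗ σ(x_s) dw_s + ∫₀ᵗ b(x_s) ds + ℓ_t`, the measure `d|ℓ|` is carried by the times at
which `x` is on the boundary, and `dℓ/d|ℓ| ∈ ν(x)` holds `d|ℓ|`-almost everywhere.
As `w` is piecewise smooth, `dw_s` is `w'(s) ds`. -/
structure IsReflectedSolution {d r : ℕ} (O : Set (E d)) (σ : closure O → E r →L[ℝ] E d)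
    (b : closure O → E d) (x₀ : closure O) (w : Path (E r))
    (x : Path (closure O)) (ℓ : Path (E d)) : Prop where
  locallyBoundedVariation : LocallyBoundedVariationOn ℓ univ
  equation : ∀ t : ℝ≥0, (x t : E d) = x₀
    + (∫ s in (0 : ℝ)..t, σ (x s.toNNReal) (deriv (fun u : ℝ => w u.toNNReal) s))
    + (∫ s in (0 : ℝ)..t, b (x s.toNNReal)) + ℓ t
  reflection : ∃ μ : Measure ℝ≥0, IsTotalVariationMeasure ℓ μ ∧
    (∀ᵐ s ∂μ, (x s : E d) ∈ frontier O) ∧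
    ∃ n : ℝ≥0 → E d, Measurable n ∧ (∀ᵐ s ∂μ, n s ∈ inwardNormals O (x s)) ∧
      ∀ t : ℝ≥0, ℓ t = ∫ s in Icc 0 t, n s ∂μ

/-! ### Wiener measure and dyadic polygonal interpolation -/

/-- `𝕎` is the standard `r`-dimensional Wiener measure: under `𝕎` the coordinates of the canonical
path are independent standard real Brownian motions (starting at `0`). -/
structure IsWienerMeasure {r : ℕ} (𝕎 : Measure (Path (E r))) : Prop where
  isProbabilityMeasure : IsProbabilityMeasure 𝕎
  isBrownian : ∀ i : Fin r, IsBrownianReal (fun (t : ℝ≥0) (w : Path (E r)) => w t i) 𝕎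
  indep : iIndepFun (fun (i : Fin r) (w : Path (E r)) (t : ℝ≥0) => w t i) 𝕎

/-- The value at `u ≥ 0` of the piecewise linear function which equals `a m` at each `m : ℕ`. -/
def polygonal {n : ℕ} (a : ℕ → E n) (u : ℝ≥0) : E n :=
  a ⌊u⌋₊ + ((u : ℝ) - ⌊u⌋₊) • (a (⌊u⌋₊ + 1) - a ⌊u⌋₊)

theorem polygonal_eq {n : ℕ} (a : ℕ → E n) (m : ℕ) (u : ℝ≥0) (h₁ : (m : ℝ≥0) ≤ u)
    (h₂ : u ≤ (m + 1 : ℕ)) : polygonal a u = a m + ((u : ℝ) - m) • (a (m + 1) - a m) := by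
  rcases h₂.lt_or_eq with h | h
  · have hf : ⌊u⌋₊ = m := (Nat.floor_eq_iff (zero_le)).2 ⟨h₁, by simpa using h⟩
    simp [polygonal, hf]
  · subst h
    rw [polygonal, Nat.floor_natCast]
    simp

theorem continuous_polygonal {n : ℕ} (a : ℕ → E n) : Continuous (polygonal a) := by
  have hlf : LocallyFinite fun m : ℕ => Icc (m : ℝ≥0) ((m + 1 : ℕ) : ℝ≥0) := by
    intro u
    refine ⟨Iio (u + 1), Iio_mem_nhds (by simp), ?_⟩
    refine (Set.finite_le_nat ⌈u + 1⌉₊).subset ?_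
    rintro m ⟨v, hv, hv'⟩
    have h : (m : ℝ≥0) ≤ ⌈u + 1⌉₊ := hv.1.trans (hv'.le.trans (Nat.le_ceil _))
    exact_mod_cast h
  refine hlf.continuous ?_ (fun m => isClosed_Icc) fun m => ?_
  · refine eq_univ_of_forall fun u => mem_iUnion.2 ⟨⌊u⌋₊, Nat.floor_le (zero_le), ?_⟩
    exact_mod_cast (Nat.lt_floor_add_one u).le
  · have hc : Continuous fun u : ℝ≥0 => a m + ((u : ℝ) - m) • (a (m + 1) - a m) := by fun_prop
    exact hc.continuousOn.congr fun u hu => polygonal_eq a m u hu.1 hu.2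

/-- The `N`-dyadic linear polygonalization `w^N` of a path `w`: it agrees with `w` at the times
`m 2⁻ᴺ` and is linear on each interval `[m 2⁻ᴺ, (m + 1) 2⁻ᴺ]`. -/
def dyadicInterp {r : ℕ} (N : ℕ) (w : Path (E r)) : Path (E r) where
  toFun t := polygonal (fun m => w ((m : ℝ≥0) / 2 ^ N)) (2 ^ N * t)
  continuous_toFun := (continuous_polygonal _).comp (by fun_prop)

/-! ### Hölder norms and the laws on path space -/

/-- The `β`-Hölder norm of `ψ` on `[s, t]`,
`sup_{s ≤ u₁ < u₂ ≤ t} |ψ(u₂) - ψ(u₁)| / (u₂ - u₁)^β`, with values in `[0, ∞]`. -/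
def holderNorm {n : ℕ} (β : ℝ) (s t : ℝ≥0) (ψ : ℝ≥0 → E n) : ℝ≥0∞ :=
  ⨆ (u₁ : ℝ≥0) (u₂ : ℝ≥0) (_ : s ≤ u₁ ∧ u₁ < u₂ ∧ u₂ ≤ t),
    ENNReal.ofReal (‖ψ u₂ - ψ u₁‖ / ((u₂ : ℝ) - u₁) ^ β)

/-- The map sending a Wiener path `w` to the point `(X^N(w), L^N(w), w^N)` of the
`(X, L, W)`-pathspace. -/
def pathTriple {d r : ℕ} {O : Set (E d)} (X : ℕ → Path (E r) → Path (closure O))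
    (L : ℕ → Path (E r) → Path (E d)) (N : ℕ) (w : Path (E r)) :
    Path (closure O) × Path (E d) × Path (E r) :=
  (X N w, L N w, dyadicInterp N w)

/-- The law `ℙ^N` of `(X^N, L^N, W^N)` under `𝕎`. -/
def approxLaw {d r : ℕ} {O : Set (E d)} (𝕎 : Measure (Path (E r)))
    (X : ℕ → Path (E r) → Path (closure O)) (L : ℕ → Path (E r) → Path (E d)) (N : ℕ) :
    Measure (Path (closure O) × Path (E d) × Path (E r)) :=
  𝕎.map (pathTriple X L N)

end ReflectedSDE

end

namespace ReflectedSDE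

open Filter Topology

section Flow

variable {H : Type*} [NormedAddCommGroup H] [InnerProductSpace ℝ H] {S : Set H}

/-- Every point has a nearest point in `S`, at which the uniform proximal normal inequality with
constant `C₀` holds. -/
def IsProxRegular (S : Set H) (C₀ : ℝ) : Prop :=
  ∀ y : H, ∃ p ∈ S, (∀ x ∈ S, ‖p - y‖ ≤ ‖x - y‖) ∧
    ∀ z ∈ S, 0 ≤ inner ℝ (z - p) (p - y) + C₀ * ‖p - y‖ * ‖z - p‖ ^ 2

/-- The upper bound for the rate of growth of `‖X - z‖²` along a flow line at the point `x`. -/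
def growthRate (F : S → H) (c : ℝ) (z : H) (x : S) : ℝ :=
  2 * inner ℝ ((x : H) - z) (F x) + c * ‖(x : H) - z‖ ^ 2

/-- Solutions of `dX = F(X) dt + dL` in `S`, described by an evolution variational inequality. -/
structure IsFlowLine (F : S → H) (M c K : ℝ) (X : ℝ≥0 → S) : Prop where
  lipschitz : ∀ s t : ℝ≥0, s ≤ t → ‖(X t : H) - X s‖ ≤ 2 * M * ((t : ℝ) - s)
  evi : ∀ z ∈ S, ∀ s t : ℝ≥0, s ≤ t → ‖(X t : H) - z‖ ^ 2 - ‖(X s : H) - z‖ ^ 2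
    ≤ ((t : ℝ) - s) * (growthRate F c z (X s) + K * ((t : ℝ) - s))

theorem IsProxRegular.exists_step {C₀ : ℝ} (hC₀ : 0 ≤ C₀) (hS : IsProxRegular S C₀) {M h : ℝ}
    (hh : 0 ≤ h) {x f : H} (hx : x ∈ S) (hf : ‖f‖ ≤ M) :
    ∃ p ∈ S, ‖p - x‖ ≤ 2 * M * h ∧ ∀ z ∈ S, ‖p - z‖ ^ 2 - ‖x - z‖ ^ 2
      ≤ h * (2 * inner ℝ (p - z) f + 2 * C₀ * M * ‖p - z‖ ^ 2) := by
  obtain ⟨p, hp, hmin, hn⟩ := hS (x + h • f)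
  have hd : ‖p - (x + h • f)‖ ≤ h * M := by
    refine (hmin x hx).trans ?_
    rw [sub_add_cancel_left, norm_neg, norm_smul, Real.norm_of_nonneg hh]
    gcongr
  refine ⟨p, hp, ?_, fun z hz => ?_⟩
  · have h1 : p - x = (p - (x + h • f)) + h • f := by abel
    have h2 : ‖h • f‖ ≤ h * M := by rw [norm_smul, Real.norm_of_nonneg hh]; gcongr
    rw [h1]
    linarith [norm_add_le (p - (x + h • f)) (h • f)]
  · have h1 : ‖x - z‖ ^ 2 = ‖p - z‖ ^ 2 - 2 * inner ℝ (p - z) (p - x) + ‖p - x‖ ^ 2 := by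
      rw [← norm_sub_sq_real]; congr 2; abel
    have h2 : inner ℝ (p - z) (p - x)
        = h * inner ℝ (p - z) f - inner ℝ (z - p) (p - (x + h • f)) := by
      rw [← real_inner_smul_right, ← neg_sub p z, inner_neg_left, sub_neg_eq_add, ← inner_add_right]
      congr 1; abel
    have h3 : C₀ * ‖p - (x + h • f)‖ * ‖z - p‖ ^ 2 ≤ C₀ * (h * M) * ‖p - z‖ ^ 2 := by
      rw [norm_sub_rev z p]; gcongr
    nlinarith [hn z hz, sq_nonneg ‖p - x‖]

theorem growthRate_le {F : S → H} {M c D KF : ℝ} (hc : 0 ≤ c) (hKF : 0 ≤ KF)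
    (hM : ∀ x, ‖F x‖ ≤ M) (hF : ∀ x y, ‖F x - F y‖ ≤ KF * ‖(x : H) - y‖)
    (hD : ∀ x ∈ S, ∀ y ∈ S, ‖x - y‖ ≤ D) {r : ℝ} {x y y' : S} (hr : ‖(y : H) - x‖ ≤ r)
    (hr' : ‖(y' : H) - x‖ ≤ r) {z : H} (hz : z ∈ S) :
    2 * inner ℝ ((y : H) - z) (F y') + c * ‖(y : H) - z‖ ^ 2
      ≤ growthRate F c z x + (2 * M + 2 * D * KF + 2 * c * D) * r := by
  have hr0 : 0 ≤ r := (norm_nonneg _).trans hr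
  have hD0 : 0 ≤ D := (norm_nonneg _).trans (hD z hz z hz)
  have h1 : inner ℝ ((y : H) - z) (F y') - inner ℝ ((x : H) - z) (F x)
      = inner ℝ ((y : H) - x) (F y') + inner ℝ ((x : H) - z) (F y' - F x) := by
    rw [inner_sub_right, ← sub_add_sub_cancel (y : H) x z, inner_add_left]; ring
  have h2 : inner ℝ ((y : H) - x) (F y') ≤ r * M :=
    (real_inner_le_norm _ _).trans (mul_le_mul hr (hM _) (norm_nonneg _) hr0)
  have h3 : inner ℝ ((x : H) - z) (F y' - F x) ≤ D * (KF * r) :=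
    (real_inner_le_norm _ _).trans (mul_le_mul (hD _ x.2 _ hz)
      ((hF _ _).trans (by gcongr)) (norm_nonneg _) hD0)
  have h4 : ‖(y : H) - z‖ ^ 2 ≤ ‖(x : H) - z‖ ^ 2 + 2 * D * r := by
    have h5 : ‖(y : H) - z‖ ≤ r + ‖(x : H) - z‖ := by
      rw [← sub_add_sub_cancel (y : H) x z]; exact (norm_add_le _ _).trans (by gcongr)
    have h6 := hD _ x.2 _ hz
    have h7 := hD _ y.2 _ hz
    have h8 : (‖(y : H) - z‖ - ‖(x : H) - z‖) * (‖(y : H) - z‖ + ‖(x : H) - z‖) ≤ r * (2 * D) :=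
      mul_le_mul (by linarith) (by linarith) (by positivity) hr0
    nlinarith
  unfold growthRate
  nlinarith [mul_le_mul_of_nonneg_left h4 hc]

theorem IsProxRegular.exists_isFlowLine {C₀ : ℝ} (hC₀ : 0 ≤ C₀) (hS : IsProxRegular S C₀)
    (hSc : IsCompact S) {F : S → H} {M D KF : ℝ} (hM0 : 0 ≤ M) (hKF : 0 ≤ KF)
    (hM : ∀ x, ‖F x‖ ≤ M) (hF : ∀ x y, ‖F x - F y‖ ≤ KF * ‖(x : H) - y‖)
    (hD : ∀ x ∈ S, ∀ y ∈ S, ‖x - y‖ ≤ D) (x₀ : S) :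
    ∃ X : ℝ≥0 → S, X 0 = x₀ ∧ IsFlowLine F M (2 * C₀ * M)
      ((2 * M + 2 * D * KF + 2 * (2 * C₀ * M) * D) * (2 * M)) X := by
  set c := 2 * C₀ * M with hc
  set K := (2 * M + 2 * D * KF + 2 * c * D) * (2 * M) with hK
  have hc0 : 0 ≤ c := by positivity
  have hD0 : 0 ≤ D := (norm_nonneg _).trans (hD _ x₀.2 _ x₀.2)
  have hK0 : 0 ≤ K := by positivity
  -- the catching-up algorithm
  have hstep : ∀ h : ℝ, 0 ≤ h → ∀ x : S, ∃ p : S, ‖(p : H) - x‖ ≤ 2 * M * h ∧ ∀ z ∈ S,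
      ‖(p : H) - z‖ ^ 2 - ‖(x : H) - z‖ ^ 2
        ≤ h * (2 * inner ℝ ((p : H) - z) (F x) + c * ‖(p : H) - z‖ ^ 2) := by
    intro h hh x
    obtain ⟨p, hp, h1, h2⟩ := hS.exists_step hC₀ hh x.2 (hM x)
    exact ⟨⟨p, hp⟩, h1, h2⟩
  have hseq : ∀ h : ℝ, 0 ≤ h → ∃ u : ℕ → S, u 0 = x₀ ∧
      (∀ k m : ℕ, ‖(u (k + m) : H) - u k‖ ≤ 2 * M * (h * m)) ∧
      ∀ z ∈ S, ∀ k m : ℕ, ‖(u (k + m) : H) - z‖ ^ 2 - ‖(u k : H) - z‖ ^ 2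
        ≤ (h * m) * (growthRate F c z (u k) + K * (h * m)) := by
    intro h hh
    choose p hp1 hp2 using hstep h hh
    obtain ⟨u, hu0, hu⟩ : ∃ u : ℕ → S, u 0 = x₀ ∧ ∀ n, u (n + 1) = p (u n) :=
      ⟨fun n => n.rec x₀ fun _ x => p x, rfl, fun _ => rfl⟩
    have hlip : ∀ k m : ℕ, ‖(u (k + m) : H) - u k‖ ≤ 2 * M * (h * m) := by
      intro k m
      induction m with
      | zero => simp
      | succ m ih =>
        have h1 := hp1 (u (k + m))
        rw [← hu] at h1
        rw [← add_assoc, ← sub_add_sub_cancel (u (k + m + 1) : H) (u (k + m) : H) (u k : H)]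
        refine (norm_add_le _ _).trans ?_
        push_cast
        linarith
    refine ⟨u, hu0, hlip, fun z hz k m => ?_⟩
    induction m with
    | zero => simp
    | succ m ih =>
      have h1 := hp2 (u (k + m)) z hz
      rw [← hu] at h1
      have h2 := growthRate_le (x := u k) (y := u (k + m + 1)) (y' := u (k + m)) hc0 hKF hM hF hD
        (hlip k (m + 1))
        ((hlip k m).trans (by gcongr; simp)) hz
      have h3 : h * (2 * inner ℝ ((u (k + m + 1) : H) - z) (F (u (k + m)))
          + c * ‖(u (k + m + 1) : H) - z‖ ^ 2)
          ≤ h * (growthRate F c z (u k) + K * (h * (m + 1 : ℕ))) := by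
        refine mul_le_mul_of_nonneg_left (h2.trans (le_of_eq ?_)) hh
        rw [hK]; ring
      have h4 : h * m * (K * (h * m)) ≤ h * m * (K * (h * (m + 1 : ℕ))) := by
        gcongr; simp
      rw [← add_assoc]
      push_cast at *
      nlinarith
  have hpos : ∀ n : ℕ, (0 : ℝ) ≤ 1 / ((n : ℝ) + 1) := fun n => by positivity
  choose u hu0 hu1 hu2 using fun n : ℕ => hseq _ (hpos n)
  let 𝒰 : Ultrafilter ℕ := Ultrafilter.of atTop
  have h𝒰 : (𝒰 : Filter ℕ) ≤ atTop := Ultrafilter.of_le _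
  let idx : ℕ → ℝ≥0 → ℕ := fun n t => ⌊(t : ℝ) * ((n : ℝ) + 1)⌋₊
  have hidx : ∀ t : ℝ≥0, Tendsto (fun n : ℕ => 1 / ((n : ℝ) + 1) * (idx n t : ℝ)) 𝒰 (𝓝 (t : ℝ)) := by
    intro t
    have h1 : Tendsto (fun n : ℕ => (n : ℝ) + 1) atTop atTop :=
      tendsto_atTop_add_const_right _ _ tendsto_natCast_atTop_atTop
    have h2 := (tendsto_nat_floor_mul_div_atTop (R := ℝ) (a := (t : ℝ)) t.2).comp h1
    refine (h2.mono_left h𝒰).congr fun n => ?_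
    simp only [idx, Function.comp]
    ring
  have hmono : ∀ n, Monotone (idx n) := fun n s t hst => Nat.floor_mono (by gcongr)
  have : CompactSpace S := isCompact_iff_compactSpace.1 hSc
  have hlim : ∀ t : ℝ≥0, ∃ x : S, Tendsto (fun n => u n (idx n t)) 𝒰 (𝓝 x) := fun t => by
    obtain ⟨x, -, hx⟩ := isCompact_univ.ultrafilter_le_nhds (𝒰.map fun n => u n (idx n t))
      (by simp)
    exact ⟨x, hx⟩
  choose X hX using hlim
  have hXc : ∀ t, Tendsto (fun n => (u n (idx n t) : H)) 𝒰 (𝓝 (X t : H)) := fun t =>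
    (continuous_subtype_val.tendsto _).comp (hX t)
  have hF' : Continuous F := by
    refine (LipschitzWith.of_dist_le_mul (K := ⟨KF, hKF⟩) fun x y => ?_).continuous
    rw [dist_eq_norm, Subtype.dist_eq, dist_eq_norm]
    exact hF x y
  refine ⟨X, ?_, fun s t hst => ?_, fun z hz s t hst => ?_⟩
  · refine tendsto_nhds_unique (hX 0) ?_
    simp [idx, hu0]
  · refine le_of_tendsto_of_tendsto ((hXc t).sub (hXc s)).norm
      (((hidx t).sub (hidx s)).const_mul (2 * M)) (Eventually.of_forall fun n => ?_)
    obtain ⟨m, hm⟩ := Nat.exists_eq_add_of_le (hmono n hst)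
    have := hu1 n (idx n s) m
    simp only [hm]
    refine this.trans (le_of_eq ?_)
    push_cast; ring
  · have hg : Tendsto (fun n => growthRate F c z (u n (idx n s))) 𝒰
        (𝓝 (growthRate F c z (X s))) := by
      have : Continuous (growthRate F c z) := by unfold growthRate; fun_prop
      exact (this.tendsto _).comp (hX s)
    have hd := (hidx t).sub (hidx s)
    refine le_of_tendsto_of_tendsto ((((hXc t).sub_const z).norm.pow 2).sub
      (((hXc s).sub_const z).norm.pow 2)) (hd.mul (hg.add (hd.const_mul K)))
      (Eventually.of_forall fun n => ?_)
    obtain ⟨m, hm⟩ := Nat.exists_eq_add_of_le (hmono n hst)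
    have := hu2 n z hz (idx n s) m
    simp only [hm]
    refine this.trans (le_of_eq ?_)
    push_cast; ring

/-- A discrete Gronwall inequality with a quadratic error term. -/
theorem gronwall_of_increment_le {G : ℝ≥0 → ℝ} {c ε K : ℝ} (hc : 0 ≤ c) (hε : 0 ≤ ε) (hK : 0 ≤ K)
    (hG0 : ∀ t, 0 ≤ G t)
    (hG : ∀ s t : ℝ≥0, s ≤ t → G t - G s ≤ ((t : ℝ) - s) * (c * G s + ε + K * ((t : ℝ) - s)))
    (t : ℝ≥0) : G t ≤ (G 0 + ε * t) * Real.exp (c * t) := by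
  have key : ∀ n : ℕ, 0 < n → G t ≤ (G 0 + ε * t + K * t * (t / n)) * Real.exp (c * t) := by
    intro n hn
    have hn' : (0 : ℝ) < n := by exact_mod_cast hn
    set δ : ℝ := t / n with hδ
    have hδ0 : 0 ≤ δ := by positivity
    have h1 : ∀ k : ℕ, G (k * (t / n)) ≤ (G 0 + (k * δ) * (ε + K * δ)) * Real.exp (c * (k * δ)) := by
      intro k
      induction k with
      | zero => simp
      | succ k ih =>
        have h2 := hG (k * (t / n)) ((k + 1 : ℕ) * (t / n)) (by gcongr; simp)
        have h3 : (((k + 1 : ℕ) * (t / n) : ℝ≥0) : ℝ) - ((k * (t / n) : ℝ≥0) : ℝ) = δ := by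
          push_cast; ring
        rw [h3] at h2
        have h4 : 1 + c * δ ≤ Real.exp (c * δ) := by linarith [Real.add_one_le_exp (c * δ)]
        have h5 : Real.exp (c * ((k + 1 : ℕ) * δ)) = Real.exp (c * (k * δ)) * Real.exp (c * δ) := by
          rw [← Real.exp_add]; congr 1; push_cast; ring
        have h6 : (1 : ℝ) ≤ Real.exp (c * ((k + 1 : ℕ) * δ)) := Real.one_le_exp (by positivity)
        calc G ((k + 1 : ℕ) * (t / n)) ≤ G (k * (t / n)) * (1 + c * δ) + δ * (ε + K * δ) := by
              linarith
          _ ≤ G (k * (t / n)) * Real.exp (c * δ) + δ * (ε + K * δ) := by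
              gcongr; exact hG0 _
          _ ≤ ((G 0 + (k * δ) * (ε + K * δ)) * Real.exp (c * (k * δ))) * Real.exp (c * δ)
              + δ * (ε + K * δ) * Real.exp (c * ((k + 1 : ℕ) * δ)) := by
              refine add_le_add (by gcongr) ?_
              exact le_mul_of_one_le_right (by positivity) h6
          _ = _ := by rw [h5]; push_cast; ring
    have h2 := h1 n
    have h3 : (n : ℝ≥0) * (t / n) = t := by
      rw [mul_div_cancel₀]; exact_mod_cast hn.ne'
    have h4 : (n : ℝ) * δ = t := by rw [hδ, mul_div_cancel₀ _ hn'.ne']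
    rw [h3, h4] at h2
    refine h2.trans (le_of_eq ?_)
    ring
  have hlim : Tendsto (fun n : ℕ => (G 0 + ε * t + K * t * (t / n)) * Real.exp (c * t)) atTop
      (𝓝 ((G 0 + ε * t + K * t * 0) * Real.exp (c * t))) :=
    ((tendsto_const_div_atTop_nhds_zero_nat (t : ℝ)).const_mul _ |>.const_add _).mul_const _
  rw [mul_zero, add_zero] at hlim
  exact ge_of_tendsto hlim (eventually_atTop.2 ⟨1, fun n hn => key n hn⟩)

/-- Stability of flow lines with respect to the starting point and the drift. -/
theorem IsFlowLine.norm_sub_sq_le {F F' : S → H} {M M' c c' K K' KF D η : ℝ} {X X' : ℝ≥0 → S}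
    (hX : IsFlowLine F M c K X) (hX' : IsFlowLine F' M' c' K' X') (hM : 0 ≤ M) (hM' : 0 ≤ M')
    (hc : 0 ≤ c) (hc' : 0 ≤ c') (hK : 0 ≤ K) (hK' : 0 ≤ K') (hKF : 0 ≤ KF) (hη : 0 ≤ η)
    (hF : ∀ x y, ‖F x - F y‖ ≤ KF * ‖(x : H) - y‖) (hFF' : ∀ x, ‖F x - F' x‖ ≤ η)
    (hD : ∀ x ∈ S, ∀ y ∈ S, ‖x - y‖ ≤ D) (t : ℝ≥0) :
    ‖(X t : H) - X' t‖ ^ 2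
      ≤ (‖(X 0 : H) - X' 0‖ ^ 2 + 2 * D * η * t) * Real.exp ((2 * KF + c + c') * t) := by
  have hD0 : 0 ≤ D := (norm_nonneg _).trans (hD _ (X 0).2 _ (X 0).2)
  refine gronwall_of_increment_le (G := fun t => ‖(X t : H) - X' t‖ ^ 2) (by positivity)
    (by positivity) (K := K + K' + 8 * M * M') (by positivity) (fun t => by positivity) ?_ t
  intro s t hst
  have hd : (0 : ℝ) ≤ (t : ℝ) - s := sub_nonneg.2 (by exact_mod_cast hst)
  have h1 := hX.evi (X' s) (X' s).2 s t hst
  have h2 := hX'.evi (X s) (X s).2 s t hst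
  have h3 : ‖(X t : H) - X' t‖ ^ 2 = ‖(X t : H) - X' s‖ ^ 2 + ‖(X' t : H) - X s‖ ^ 2
      - ‖(X s : H) - X' s‖ ^ 2 - 2 * inner ℝ ((X t : H) - X s) ((X' t : H) - X' s) := by
    simp only [← real_inner_self_eq_norm_sq, inner_sub_left, inner_sub_right]
    rw [real_inner_comm (X s : H) (X' t), real_inner_comm (X s : H) (X' s),
      real_inner_comm (X t : H) (X' s), real_inner_comm (X t : H) (X' t)]
    ring
  have h4 : -inner ℝ ((X t : H) - X s) ((X' t : H) - X' s)
      ≤ (2 * M * ((t : ℝ) - s)) * (2 * M' * ((t : ℝ) - s)) := by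
    refine (neg_le_abs _).trans ((abs_real_inner_le_norm _ _).trans ?_)
    exact mul_le_mul (hX.lipschitz s t hst) (hX'.lipschitz s t hst) (norm_nonneg _) (by positivity)
  have h5 : growthRate F c (X' s) (X s) + growthRate F' c' (X s) (X' s)
      ≤ (2 * KF + c + c') * ‖(X s : H) - X' s‖ ^ 2 + 2 * D * η := by
    have h6 : inner ℝ ((X s : H) - X' s) (F (X s)) + inner ℝ ((X' s : H) - X s) (F' (X' s))
        = inner ℝ ((X s : H) - X' s) (F (X s) - F (X' s))
          + inner ℝ ((X s : H) - X' s) (F (X' s) - F' (X' s)) := by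
      rw [← neg_sub (X s : H) (X' s), inner_neg_left, inner_sub_right, inner_sub_right]; ring
    have h7 : inner ℝ ((X s : H) - X' s) (F (X s) - F (X' s)) ≤ KF * ‖(X s : H) - X' s‖ ^ 2 := by
      refine (real_inner_le_norm _ _).trans ?_
      rw [sq, ← mul_assoc, mul_comm KF, mul_assoc]
      gcongr
      exact hF _ _
    have h8 : inner ℝ ((X s : H) - X' s) (F (X' s) - F' (X' s)) ≤ D * η :=
      (real_inner_le_norm _ _).trans (mul_le_mul (hD _ (X s).2 _ (X' s).2) (hFF' _)
        (norm_nonneg _) hD0)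
    unfold growthRate
    rw [norm_sub_rev (X' s : H) (X s)]
    nlinarith
  rw [norm_sub_rev (X' s : H) (X s)] at h2
  rw [h3]
  have h9 := mul_le_mul_of_nonneg_left h5 hd
  nlinarith

end Flow

end ReflectedSDE

namespace ReflectedSDE

open Filter Topology

variable {d r : ℕ} {O : Set (E d)}

theorem IsAdmissible.exists_isProxRegular (hO : IsOpen O) (hne : O.Nonempty) (h : IsAdmissible O) :
    ∃ C₀ : ℝ, 0 ≤ C₀ ∧ IsProxRegular (closure O) C₀ ∧ ∀ x ∈ frontier O, ∀ n ∈ inwardNormals O x,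
      ∀ z ∈ closure O, 0 ≤ inner ℝ (z - x) n + C₀ * ‖z - x‖ ^ 2 := by
  obtain ⟨C₀, hC₀, hext⟩ := h.uniform_exterior_ball
  have hclosed : ∀ x ∈ frontier O, ∀ n ∈ inwardNormals O x,
      ∀ z ∈ closure O, 0 ≤ inner ℝ (z - x) n + C₀ * ‖z - x‖ ^ 2 := by
    intro x hx n hn z hz
    have hcl : IsClosed {z : E d | 0 ≤ inner ℝ (z - x) n + C₀ * ‖z - x‖ ^ 2} :=
      isClosed_le continuous_const (by fun_prop)
    refine closure_minimal (fun z hz => ?_) hcl hz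
    have := hext z hz x hx n hn
    rwa [norm_sub_rev] at this
  refine ⟨C₀, hC₀, fun y => ?_, hclosed⟩
  obtain ⟨p, hp, hpd⟩ := isClosed_closure.exists_infDist_eq_dist hne.closure y
  have hmin : ∀ x ∈ closure O, ‖p - y‖ ≤ ‖x - y‖ := fun x hx => by
    rw [← dist_eq_norm, ← dist_eq_norm, dist_comm p, dist_comm x, ← hpd]
    exact Metric.infDist_le_dist_of_mem hx
  refine ⟨p, hp, hmin, fun z hz => ?_⟩
  rcases eq_or_ne p y with rfl | hpy
  · simp
  have hpos : 0 < ‖p - y‖ := norm_pos_iff.2 (sub_ne_zero.2 hpy)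
  have hfr : p ∈ frontier O := by
    rw [hO.frontier_eq]
    refine ⟨hp, fun hpO => ?_⟩
    have ht : Tendsto (fun s : ℝ => p + s • (y - p)) (𝓝[>] 0) (𝓝 p) := by
      have : Continuous fun s : ℝ => p + s • (y - p) := by fun_prop
      simpa using (this.tendsto 0).mono_left nhdsWithin_le_nhds
    obtain ⟨s, hs, hs1, hs2⟩ := ((ht.eventually (hO.mem_nhds hpO)).and
      (Ioo_mem_nhdsGT (zero_lt_one' ℝ))).exists
    have h1 := hmin _ (subset_closure hs)
    have h2 : p + s • (y - p) - y = (1 - s) • (p - y) := by module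
    rw [h2, norm_smul, Real.norm_of_nonneg (by linarith)] at h1
    nlinarith
  have hn : ‖p - y‖⁻¹ • (p - y) ∈ inwardNormals O p := by
    refine ⟨by rw [norm_smul, norm_inv, norm_norm, inv_mul_cancel₀ hpos.ne'],
      ‖p - y‖⁻¹ / 2, by positivity, fun x' hx' => ?_⟩
    have h1 := pow_le_pow_left₀ (norm_nonneg _) (hmin x' hx') 2
    have h2 : ‖x' - y‖ ^ 2 = ‖x' - p‖ ^ 2 + 2 * inner ℝ (x' - p) (p - y) + ‖p - y‖ ^ 2 := by
      rw [← norm_add_sq_real, sub_add_sub_cancel]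
    rw [real_inner_smul_right, norm_sub_rev p x']
    have h3 : ‖p - y‖⁻¹ * inner ℝ (x' - p) (p - y) + ‖p - y‖⁻¹ / 2 * ‖x' - p‖ ^ 2
        = ‖p - y‖⁻¹ / 2 * (2 * inner ℝ (x' - p) (p - y) + ‖x' - p‖ ^ 2) := by ring
    rw [h3]
    exact mul_nonneg (by positivity) (by linarith)
  have h1 := mul_nonneg hpos.le (hclosed p hfr _ hn z hz)
  rw [real_inner_smul_right] at h1
  calc (0 : ℝ) ≤ _ := h1
    _ = _ := by field_simp

/-- The constant `A` dominates all constants of the reflected equation with coefficients `σ`, `b`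
on the domain `O`. -/
structure IsControlled (O : Set (E d)) (σ : closure O → E r →L[ℝ] E d) (b : closure O → E d)
    (A : ℝ) : Prop where
  isOpen : IsOpen O
  isCompact : IsCompact (closure O)
  one_le : 1 ≤ A
  proxRegular : IsProxRegular (closure O) A
  normal : ∀ x ∈ frontier O, ∀ n ∈ inwardNormals O x,
    ∀ z ∈ closure O, 0 ≤ inner ℝ (z - x) n + A * ‖z - x‖ ^ 2
  diam : ∀ x ∈ closure O, ∀ y ∈ closure O, ‖x - y‖ ≤ A
  norm_σ : ∀ x, ‖σ x‖ ≤ A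
  norm_b : ∀ x, ‖b x‖ ≤ A
  lipschitz_σ : ∀ x y, ‖σ x - σ y‖ ≤ A * ‖(x : E d) - y‖
  lipschitz_b : ∀ x y, ‖b x - b y‖ ≤ A * ‖(x : E d) - y‖

theorem exists_isControlled (hO : IsOpen O) (hne : O.Nonempty) (hb : Bornology.IsBounded O)
    (h : IsAdmissible O) {σ : closure O → E r →L[ℝ] E d} (hσ : ∃ K : ℝ≥0, LipschitzWith K σ)
    {b : closure O → E d} (hb' : ∃ K : ℝ≥0, LipschitzWith K b) : ∃ A, IsControlled O σ b A := by
  have hc : IsCompact (closure O) := hb.isCompact_closure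
  have : CompactSpace (closure O) := isCompact_iff_compactSpace.1 hc
  obtain ⟨C₀, hC₀, hprox, hnormal⟩ := h.exists_isProxRegular hO hne
  obtain ⟨K₁, hK₁⟩ := hσ
  obtain ⟨K₂, hK₂⟩ := hb'
  obtain ⟨D, hD⟩ := Metric.isBounded_iff.1 hc.isBounded
  obtain ⟨B₁, hB₁⟩ := isCompact_univ.exists_bound_of_continuousOn hK₁.continuous.continuousOn
  obtain ⟨B₂, hB₂⟩ := isCompact_univ.exists_bound_of_continuousOn hK₂.continuous.continuousOn
  set A : ℝ := 1 + C₀ + K₁ + K₂ + |D| + |B₁| + |B₂| with hA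
  have e1 := K₁.2
  have e2 := K₂.2
  have e3 := abs_nonneg D
  have e4 := abs_nonneg B₁
  have e5 := abs_nonneg B₂
  have e6 := le_abs_self D
  have e7 := le_abs_self B₁
  have e8 := le_abs_self B₂
  simp only [NNReal.val_eq_coe] at e1 e2
  have hCA : C₀ ≤ A := by linarith
  refine ⟨A, hO, hc, by linarith, fun y => ?_, fun x hx n hn z hz => ?_, fun x hx y hy => ?_,
    fun x => ?_, fun x => ?_, fun x y => ?_, fun x y => ?_⟩
  · obtain ⟨p, hp, h1, h2⟩ := hprox y
    exact ⟨p, hp, h1, fun z hz => (h2 z hz).trans (by gcongr)⟩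
  · exact (hnormal x hx n hn z hz).trans (by gcongr)
  · rw [← dist_eq_norm]; exact (hD hx hy).trans (by linarith)
  · exact (hB₁ x (mem_univ _)).trans (by linarith)
  · exact (hB₂ x (mem_univ _)).trans (by linarith)
  · have := hK₁.dist_le_mul x y
    rw [dist_eq_norm, Subtype.dist_eq, dist_eq_norm] at this
    exact this.trans (by gcongr; linarith)
  · have := hK₂.dist_le_mul x y
    rw [dist_eq_norm, Subtype.dist_eq, dist_eq_norm] at this
    exact this.trans (by gcongr; linarith)

section Flow

variable {σ : closure O → E r →L[ℝ] E d} {b : closure O → E d} {A : ℝ}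

/-- The drift `σ(x) v + b(x)` for an input with constant velocity `v`. -/
def drift (σ : closure O → E r →L[ℝ] E d) (b : closure O → E d) (v : E r) (x : closure O) : E d :=
  σ x v + b x

theorem IsControlled.nonneg (h : IsControlled O σ b A) : 0 ≤ A := zero_le_one.trans h.one_le

theorem IsControlled.norm_drift_le (h : IsControlled O σ b A) (v : E r) (x : closure O) :
    ‖drift σ b v x‖ ≤ A * (‖v‖ + 1) := by
  have h1 : ‖σ x v‖ ≤ A * ‖v‖ := (σ x).le_of_opNorm_le (h.norm_σ x) v
  have h2 := norm_add_le (σ x v) (b x)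
  have h3 := h.norm_b x
  unfold drift
  linarith

theorem IsControlled.norm_drift_sub_le (h : IsControlled O σ b A) (v : E r) (x y : closure O) :
    ‖drift σ b v x - drift σ b v y‖ ≤ A * (‖v‖ + 1) * ‖(x : E d) - y‖ := by
  have h1 : ‖(σ x - σ y) v‖ ≤ A * ‖(x : E d) - y‖ * ‖v‖ :=
    (σ x - σ y).le_of_opNorm_le (h.lipschitz_σ x y) v
  have h2 : drift σ b v x - drift σ b v y = (σ x - σ y) v + (b x - b y) := by
    simp only [drift, sub_apply]; abel
  have h3 := norm_add_le ((σ x - σ y) v) (b x - b y)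
  have h4 := h.lipschitz_b x y
  rw [h2]
  linarith

theorem IsControlled.norm_drift_sub_drift_le (h : IsControlled O σ b A) (v v' : E r)
    (x : closure O) : ‖drift σ b v x - drift σ b v' x‖ ≤ A * ‖v - v'‖ := by
  have : drift σ b v x - drift σ b v' x = σ x (v - v') := by simp [drift]
  rw [this]
  exact (σ x).le_of_opNorm_le (h.norm_σ x) _

theorem IsControlled.continuous_σ (h : IsControlled O σ b A) : Continuous σ := by
  refine (LipschitzWith.of_dist_le_mul (K := ⟨A, h.nonneg⟩) fun x y => ?_).continuous
  rw [dist_eq_norm, Subtype.dist_eq, dist_eq_norm]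
  exact h.lipschitz_σ x y

theorem IsControlled.continuous_b (h : IsControlled O σ b A) : Continuous b := by
  refine (LipschitzWith.of_dist_le_mul (K := ⟨A, h.nonneg⟩) fun x y => ?_).continuous
  rw [dist_eq_norm, Subtype.dist_eq, dist_eq_norm]
  exact h.lipschitz_b x y

theorem IsControlled.continuous_drift (h : IsControlled O σ b A) :
    Continuous fun p : E r × closure O => drift σ b p.1 p.2 := by
  have h1 := h.continuous_σ
  have h2 := h.continuous_b
  unfold drift
  exact ((h1.comp continuous_snd).clm_apply continuous_fst).add (h2.comp continuous_snd)

theorem IsControlled.exists_flow (h : IsControlled O σ b A) (v : E r) (x : closure O) :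
    ∃ X : ℝ≥0 → closure O, X 0 = x ∧ IsFlowLine (drift σ b v) (A * (‖v‖ + 1))
      (2 * A * (A * (‖v‖ + 1))) ((2 * (A * (‖v‖ + 1)) + 2 * A * (A * (‖v‖ + 1))
        + 2 * (2 * A * (A * (‖v‖ + 1))) * A) * (2 * (A * (‖v‖ + 1)))) X := by
  have hA := h.nonneg
  exact h.proxRegular.exists_isFlowLine hA h.isCompact (by positivity) (by positivity)
    (h.norm_drift_le v) (h.norm_drift_sub_le v) h.diam x

/-- The flow of the reflected equation for an input with constant velocity. -/
noncomputable def flow (h : IsControlled O σ b A) (v : E r) (x : closure O) : ℝ≥0 → closure O :=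
  (h.exists_flow v x).choose

theorem flow_zero (h : IsControlled O σ b A) (v : E r) (x : closure O) : flow h v x 0 = x :=
  (h.exists_flow v x).choose_spec.1

theorem isFlowLine_flow (h : IsControlled O σ b A) (v : E r) (x : closure O) :
    IsFlowLine (drift σ b v) (A * (‖v‖ + 1))
      (2 * A * (A * (‖v‖ + 1))) ((2 * (A * (‖v‖ + 1)) + 2 * A * (A * (‖v‖ + 1))
        + 2 * (2 * A * (A * (‖v‖ + 1))) * A) * (2 * (A * (‖v‖ + 1)))) (flow h v x) :=
  (h.exists_flow v x).choose_spec.2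

theorem norm_flow_sub_flow_le (h : IsControlled O σ b A) (v : E r) (x : closure O) (s t : ℝ≥0) :
    ‖(flow h v x t : E d) - flow h v x s‖ ≤ 2 * (A * (‖v‖ + 1)) * |(t : ℝ) - s| := by
  rcases le_total s t with hst | hst
  · rw [abs_of_nonneg (sub_nonneg.2 (by exact_mod_cast hst))]
    exact (isFlowLine_flow h v x).lipschitz s t hst
  · rw [norm_sub_rev, abs_sub_comm, abs_of_nonneg (sub_nonneg.2 (by exact_mod_cast hst))]
    exact (isFlowLine_flow h v x).lipschitz t s hst

theorem continuous_flow (h : IsControlled O σ b A) :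
    Continuous fun p : E r × closure O × ℝ≥0 => flow h p.1 p.2.1 p.2.2 := by
  have hA := h.nonneg
  rw [continuous_iff_continuousAt]
  rintro ⟨v₀, x₀, t₀⟩
  let f : E r × closure O × ℝ≥0 → ℝ := fun p =>
    √((‖(p.2.1 : E d) - x₀‖ ^ 2 + 2 * A * (A * ‖p.1 - v₀‖) * p.2.2)
      * Real.exp ((2 * (A * (‖p.1‖ + 1)) + 2 * A * (A * (‖p.1‖ + 1)) + 2 * A * (A * (‖v₀‖ + 1)))
        * p.2.2)) + 2 * (A * (‖v₀‖ + 1)) * |(p.2.2 : ℝ) - t₀|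
  have hf : Continuous f := by
    have h1 : Continuous fun p : E r × closure O × ℝ≥0 => (p.2.2 : ℝ) :=
      NNReal.continuous_coe.comp (continuous_snd.comp continuous_snd)
    have h2 : Continuous fun p : E r × closure O × ℝ≥0 => (p.2.1 : E d) :=
      continuous_subtype_val.comp (continuous_fst.comp continuous_snd)
    fun_prop
  have hf0 : f (v₀, x₀, t₀) = 0 := by simp [f]
  rw [ContinuousAt, tendsto_iff_dist_tendsto_zero]
  refine squeeze_zero (fun _ => dist_nonneg) (g := f) ?_ (hf0 ▸ hf.tendsto (v₀, x₀, t₀))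
  rintro ⟨v, x, t⟩
  have h1 := (isFlowLine_flow h v x).norm_sub_sq_le (isFlowLine_flow h v₀ x₀) (by positivity)
    (by positivity) (by positivity) (by positivity) (by positivity) (by positivity)
    (by positivity) (by positivity)
    (h.norm_drift_sub_le v) (h.norm_drift_sub_drift_le v v₀) h.diam t
  rw [flow_zero, flow_zero] at h1
  have h2 := norm_flow_sub_flow_le h v₀ x₀ t₀ t
  rw [Subtype.dist_eq, dist_eq_norm, ← sub_add_sub_cancel _ (flow h v₀ x₀ t : E d)]
  exact (norm_add_le _ _).trans (add_le_add (Real.le_sqrt_of_sq_le h1) h2)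

/-- The accumulated reflection along the flow. -/
noncomputable def push (h : IsControlled O σ b A) (v : E r) (x : closure O) (t : ℝ≥0) : E d :=
  flow h v x t - x - ∫ s in (0 : ℝ)..t, drift σ b v (flow h v x s.toNNReal)

theorem push_zero (h : IsControlled O σ b A) (v : E r) (x : closure O) : push h v x 0 = 0 := by
  simp [push, flow_zero]

theorem continuous_drift_flow (h : IsControlled O σ b A) :
    Continuous fun p : (E r × closure O) × ℝ =>
      drift σ b p.1.1 (flow h p.1.1 p.1.2 p.2.toNNReal) :=
  h.continuous_drift.comp ((continuous_fst.comp continuous_fst).prodMk ((continuous_flow h).comp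
    ((continuous_fst.comp continuous_fst).prodMk ((continuous_snd.comp continuous_fst).prodMk
      (continuous_real_toNNReal.comp continuous_snd)))))

theorem continuous_drift_flow_right (h : IsControlled O σ b A) (v : E r) (x : closure O) :
    Continuous fun s : ℝ => drift σ b v (flow h v x s.toNNReal) :=
  (continuous_drift_flow h).comp (Continuous.prodMk_right (v, x))

theorem continuous_push (h : IsControlled O σ b A) :
    Continuous fun p : E r × closure O × ℝ≥0 => push h p.1 p.2.1 p.2.2 := by
  have h1 : Continuous fun p : (E r × closure O) × ℝ =>
      ∫ s in (0 : ℝ)..p.2, drift σ b p.1.1 (flow h p.1.1 p.1.2 s.toNNReal) :=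
    intervalIntegral.continuous_parametric_primitive_of_continuous
      (f := fun (p : E r × closure O) s => drift σ b p.1 (flow h p.1 p.2 s.toNNReal))
      (continuous_drift_flow h)
  have h2 : Continuous fun p : E r × closure O × ℝ≥0 => (((p.1, p.2.1), (p.2.2 : ℝ)) :
      (E r × closure O) × ℝ) := by
    have : Continuous fun p : E r × closure O × ℝ≥0 => (p.2.2 : ℝ) :=
      NNReal.continuous_coe.comp (continuous_snd.comp continuous_snd)
    fun_prop
  unfold push
  exact ((continuous_subtype_val.comp (continuous_flow h)).sub
    (continuous_subtype_val.comp (continuous_fst.comp continuous_snd))).sub (h1.comp h2)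

theorem norm_push_sub_push_le (h : IsControlled O σ b A) (v : E r) (x : closure O) {s t : ℝ≥0}
    (hst : s ≤ t) : ‖push h v x t - push h v x s‖ ≤ 3 * (A * (‖v‖ + 1)) * ((t : ℝ) - s) := by
  have hc := continuous_drift_flow_right h v x
  have hst' : (s : ℝ) ≤ t := by exact_mod_cast hst
  have h1 : push h v x t - push h v x s = ((flow h v x t : E d) - flow h v x s)
      - ∫ u in (s : ℝ)..t, drift σ b v (flow h v x u.toNNReal) := by
    rw [push, push, ← intervalIntegral.integral_interval_sub_left
      (hc.intervalIntegrable 0 t) (hc.intervalIntegrable 0 s)]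
    abel
  have h2 := intervalIntegral.norm_integral_le_of_norm_le_const (a := (s : ℝ)) (b := t)
    (f := fun u => drift σ b v (flow h v x u.toNNReal)) fun u _ => h.norm_drift_le v _
  rw [abs_of_nonneg (sub_nonneg.2 hst')] at h2
  have h3 := (isFlowLine_flow h v x).lipschitz s t hst
  rw [h1]
  refine (norm_sub_le _ _).trans ?_
  linarith

/-- Where the accumulated reflection is differentiable, it points inwards, and it is constant
while the flow is in the interior. -/
theorem push_deriv_mem (h : IsControlled O σ b A) {v : E r} {x : closure O} {t : ℝ≥0} {l : E d}
    (hl : HasDerivAt (fun u : ℝ => push h v x u.toNNReal) l t) (ht : 0 < t) (hl0 : l ≠ 0) :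
    (flow h v x t : E d) ∈ frontier O ∧ ‖l‖⁻¹ • l ∈ inwardNormals O (flow h v x t) := by
  have hA := h.nonneg
  have hc := continuous_drift_flow_right h v x
  set F := drift σ b v (flow h v x t) with hF
  have h1 : HasDerivAt (fun u : ℝ => ∫ s in (0 : ℝ)..u, drift σ b v (flow h v x s.toNNReal)) F t := by
    simpa [hF] using (hc.integral_hasStrictDerivAt 0 t).hasDerivAt
  have h2 : HasDerivAt (fun u : ℝ => (flow h v x u.toNNReal : E d)) (l + F) t := by
    have h3 := (hl.add h1).add_const (x : E d)
    refine h3.congr_of_eventuallyEq ?_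
    filter_upwards [lt_mem_nhds (show (0 : ℝ) < t from ht)] with u hu
    simp only [push, Pi.add_apply, Real.coe_toNNReal u hu.le]
    abel
  set X : E d := (flow h v x t : E d) with hX
  set c := 2 * A * (A * (‖v‖ + 1)) with hcdef
  have hc0 : 0 ≤ c := by positivity
  have hvi : ∀ z ∈ closure O, 0 ≤ 2 * inner ℝ (z - X) l + c * ‖z - X‖ ^ 2 := by
    intro z hz
    have h4 : HasDerivAt (fun u : ℝ => ‖(flow h v x u.toNNReal : E d) - z‖ ^ 2)
        (2 * inner ℝ (X - z) (l + F)) t := by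
      have := (h2.sub_const z).norm_sq
      simpa [hX] using this
    have h5 := (hasDerivAt_iff_tendsto_slope.1 h4).mono_left (nhdsGT_le_nhdsNE (t : ℝ))
    set K := ((2 * (A * (‖v‖ + 1)) + 2 * A * (A * (‖v‖ + 1))
        + 2 * (2 * A * (A * (‖v‖ + 1))) * A) * (2 * (A * (‖v‖ + 1)))) with hK
    have h6 : Tendsto (fun u : ℝ => growthRate (drift σ b v) c z (flow h v x t) + K * (u - t))
        (𝓝[>] (t : ℝ)) (𝓝 (growthRate (drift σ b v) c z (flow h v x t) + K * (t - t))) := by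
      have : Continuous fun u : ℝ => growthRate (drift σ b v) c z (flow h v x t) + K * (u - t) := by
        fun_prop
      exact (this.tendsto _).mono_left nhdsWithin_le_nhds
    have h7 := le_of_tendsto_of_tendsto h5 h6 ?_
    · rw [sub_self, mul_zero, add_zero, growthRate, inner_add_right] at h7
      rw [← neg_sub X z, inner_neg_left, norm_neg]
      linarith
    · filter_upwards [self_mem_nhdsWithin] with u (hu : (t : ℝ) < u)
      have h8 := (isFlowLine_flow h v x).evi z hz t u.toNNReal
        (NNReal.le_toNNReal_of_coe_le hu.le)
      rw [Real.coe_toNNReal u (t.2.trans hu.le)] at h8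
      rw [slope_def_field, div_le_iff₀ (sub_pos.2 hu), Real.toNNReal_coe]
      linarith
  have hlpos : 0 < ‖l‖ := norm_pos_iff.2 hl0
  refine ⟨?_, by rw [norm_smul, norm_inv, norm_norm, inv_mul_cancel₀ hlpos.ne'],
    ‖l‖⁻¹ * (c + 1), by positivity, fun z hz => ?_⟩
  · rw [h.isOpen.frontier_eq]
    refine ⟨(flow h v x t).2, fun hXO => ?_⟩
    have ht : Tendsto (fun s : ℝ => X - s • l) (𝓝[>] 0) (𝓝 X) := by
      have : Continuous fun s : ℝ => X - s • l := by fun_prop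
      simpa using (this.tendsto 0).mono_left nhdsWithin_le_nhds
    obtain ⟨s, hs, hs1, hs2⟩ := ((ht.eventually (h.isOpen.mem_nhds hXO)).and
      (Ioo_mem_nhdsGT (show (0 : ℝ) < 1 / (c + 1) by positivity))).exists
    have h3 := hvi _ (subset_closure hs)
    rw [sub_sub_cancel_left, inner_neg_left, real_inner_smul_left, real_inner_self_eq_norm_sq,
      norm_neg, norm_smul, Real.norm_of_nonneg hs1.le] at h3
    rw [lt_div_iff₀ (by positivity)] at hs2
    have h4 : 0 < s * ‖l‖ ^ 2 := by positivity
    nlinarith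
  · have h3 := hvi z hz
    rw [real_inner_smul_right, norm_sub_rev X z]
    have h4 : ‖l‖⁻¹ * inner ℝ (z - X) l + ‖l‖⁻¹ * (c + 1) * ‖z - X‖ ^ 2
        = ‖l‖⁻¹ * (inner ℝ (z - X) l + (c + 1) * ‖z - X‖ ^ 2) := by ring
    rw [h4]
    refine mul_nonneg (by positivity) ?_
    nlinarith [sq_nonneg ‖z - X‖, mul_nonneg hc0 (sq_nonneg ‖z - X‖)]

end Flow

end ReflectedSDE

namespace ReflectedSDE

open Filter Topology

section Glue

variable {V S Ω Y : Type*}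

theorem continuous_of_cells [TopologicalSpace Ω] [TopologicalSpace Y] {τ : ℝ≥0} (hτ : 0 < τ) {f : Ω × ℝ≥0 → Y} (g : ℕ → Ω × ℝ≥0 → Y)
    (hg : ∀ m, Continuous (g m))
    (hfg : ∀ (m : ℕ) p, m * τ ≤ p.2 → p.2 ≤ (m + 1 : ℕ) * τ → f p = g m p) : Continuous f := by
  have hlf : LocallyFinite fun m : ℕ =>
      {p : Ω × ℝ≥0 | m * τ ≤ p.2 ∧ p.2 ≤ (m + 1 : ℕ) * τ} := by
    intro p
    refine ⟨{q | q.2 < p.2 + 1}, (isOpen_lt continuous_snd continuous_const).mem_nhds (by simp), ?_⟩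
    refine (Set.finite_le_nat ⌈(p.2 + 1) / τ⌉₊).subset ?_
    rintro m ⟨q, hq, hq'⟩
    have h : (m : ℝ≥0) ≤ ⌈(p.2 + 1) / τ⌉₊ := by
      refine le_trans ?_ (Nat.le_ceil _)
      rw [le_div_iff₀ hτ]
      exact hq.1.trans (le_of_lt hq')
    exact_mod_cast h
  refine hlf.continuous ?_ (fun m => ?_) fun m => ?_
  · refine eq_univ_of_forall fun p => mem_iUnion.2 ⟨⌊p.2 / τ⌋₊, ?_, ?_⟩
    · rw [← le_div_iff₀ hτ]; exact Nat.floor_le zero_le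
    · rw [← div_le_iff₀ hτ]; exact_mod_cast (Nat.lt_floor_add_one _).le
  · exact (isClosed_Icc (a := m * τ) (b := (m + 1 : ℕ) * τ)).preimage continuous_snd
  · exact (hg m).continuousOn.congr fun p hp => hfg m p hp.1 hp.2

/-- The state at time `m τ` of the system which follows `Ψ (v m)` on `[m τ, (m + 1) τ]`. -/
def glueNode (Ψ : V → S → ℝ≥0 → S) (τ : ℝ≥0) (v : ℕ → V) (s : S) : ℕ → S
  | 0 => s
  | m + 1 => Ψ (v m) (glueNode Ψ τ v s m) τ

/-- The state at time `t` of the system which follows `Ψ (v m)` on `[m τ, (m + 1) τ]`. -/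
noncomputable def glue (Ψ : V → S → ℝ≥0 → S) (τ : ℝ≥0) (v : ℕ → V) (s : S) (t : ℝ≥0) : S :=
  Ψ (v ⌊t / τ⌋₊) (glueNode Ψ τ v s ⌊t / τ⌋₊) (t - ⌊t / τ⌋₊ * τ)

variable {Ψ : V → S → ℝ≥0 → S} {τ : ℝ≥0}

theorem glue_eq (hΨ0 : ∀ v s, Ψ v s 0 = s) (hτ : 0 < τ) (v : ℕ → V) (s : S) (m : ℕ) {t : ℝ≥0}
    (h₁ : m * τ ≤ t) (h₂ : t ≤ (m + 1 : ℕ) * τ) :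
    glue Ψ τ v s t = Ψ (v m) (glueNode Ψ τ v s m) (t - m * τ) := by
  rcases h₂.lt_or_eq with h | h
  · have hf : ⌊t / τ⌋₊ = m := (Nat.floor_eq_iff zero_le).2
      ⟨(le_div_iff₀ hτ).2 h₁, (div_lt_iff₀ hτ).2 (by exact_mod_cast h)⟩
    rw [glue, hf]
  · have hf : ⌊t / τ⌋₊ = m + 1 := by rw [h, mul_div_cancel_right₀ _ hτ.ne', Nat.floor_natCast]
    have h3 : t - m * τ = τ := by
      rw [h]; push_cast; rw [add_mul, one_mul, add_tsub_cancel_left]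
    rw [glue, hf, ← h, tsub_self, hΨ0, glueNode, h3]

theorem glue_mul (hΨ0 : ∀ v s, Ψ v s 0 = s) (hτ : 0 < τ) (v : ℕ → V) (s : S) (m : ℕ) :
    glue Ψ τ v s (m * τ) = glueNode Ψ τ v s m := by
  rw [glue_eq hΨ0 hτ v s m le_rfl (by gcongr; simp), tsub_self, hΨ0]

variable [TopologicalSpace V] [TopologicalSpace S] [TopologicalSpace Ω]

theorem continuous_glueNode (hΨ : Continuous fun p : V × S × ℝ≥0 => Ψ p.1 p.2.1 p.2.2)
    {v : ℕ → Ω → V} (hv : ∀ m, Continuous (v m)) {s : Ω → S} (hs : Continuous s) (m : ℕ) :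
    Continuous fun ω => glueNode Ψ τ (fun m => v m ω) (s ω) m := by
  induction m with
  | zero => exact hs
  | succ m ih => exact hΨ.comp ((hv m).prodMk (ih.prodMk continuous_const))

theorem continuous_glue (hΨ : Continuous fun p : V × S × ℝ≥0 => Ψ p.1 p.2.1 p.2.2)
    (hΨ0 : ∀ v s, Ψ v s 0 = s) (hτ : 0 < τ)
    {v : ℕ → Ω → V} (hv : ∀ m, Continuous (v m)) {s : Ω → S} (hs : Continuous s) :
    Continuous fun p : Ω × ℝ≥0 => glue Ψ τ (fun m => v m p.1) (s p.1) p.2 := by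
  refine continuous_of_cells hτ (fun m p => Ψ (v m p.1) (glueNode Ψ τ (fun m => v m p.1) (s p.1) m)
    (p.2 - m * τ)) (fun m => ?_) fun m p h₁ h₂ => glue_eq hΨ0 hτ _ _ m h₁ h₂
  exact hΨ.comp (((hv m).comp continuous_fst).prodMk
    (((continuous_glueNode hΨ hv hs m).comp continuous_fst).prodMk
      (continuous_snd.sub continuous_const)))

end Glue

section Dyadic

variable {r : ℕ}

/-- The mesh `2⁻ᴺ`. -/
noncomputable def mesh (N : ℕ) : ℝ≥0 := (2 ^ N)⁻¹

theorem mesh_pos (N : ℕ) : 0 < mesh N := by unfold mesh; positivity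

theorem coe_mesh (N : ℕ) : (mesh N : ℝ) = (2 ^ N)⁻¹ := by simp [mesh]

/-- The increment of `w` over `[m 2⁻ᴺ, (m + 1) 2⁻ᴺ]`. -/
noncomputable def dyadicIncrement (N : ℕ) (w : Path (E r)) (m : ℕ) : E r :=
  w ((m + 1 : ℕ) * mesh N) - w (m * mesh N)

/-- The velocity of the polygonalization of `w` on `[m 2⁻ᴺ, (m + 1) 2⁻ᴺ]`. -/
noncomputable def velocity (N : ℕ) (w : Path (E r)) (m : ℕ) : E r :=
  (2 ^ N : ℝ) • dyadicIncrement N w m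

theorem continuous_dyadicIncrement (N m : ℕ) :
    Continuous fun w : Path (E r) => dyadicIncrement N w m :=
  (continuous_eval_const _).sub (continuous_eval_const _)

theorem continuous_velocity (N m : ℕ) : Continuous fun w : Path (E r) => velocity N w m :=
  (continuous_dyadicIncrement N m).const_smul (2 ^ N : ℝ)

theorem dyadicInterp_eq (N : ℕ) (w : Path (E r)) (m : ℕ) {t : ℝ≥0} (h₁ : m * mesh N ≤ t)
    (h₂ : t ≤ (m + 1 : ℕ) * mesh N) : dyadicInterp N w t
      = w (m * mesh N) + ((t : ℝ) - m * mesh N) • velocity N w m := by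
  have hN : (2 ^ N : ℝ) ≠ 0 := by positivity
  have hN' : (0 : ℝ≥0) < 2 ^ N := by positivity
  rw [mesh, ← div_eq_mul_inv, div_le_iff₀ hN'] at h₁
  rw [mesh, ← div_eq_mul_inv, le_div_iff₀ hN'] at h₂
  change polygonal (fun m => w ((m : ℝ≥0) / 2 ^ N)) (2 ^ N * t) = _
  rw [polygonal_eq _ m _ (by rwa [mul_comm]) (by rwa [mul_comm]), velocity, dyadicIncrement,
    smul_smul]
  simp only [div_eq_mul_inv, mesh]
  congr 2
  push_cast
  field_simp

theorem continuous_uncurry_dyadicInterp (N : ℕ) :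
    Continuous fun p : Path (E r) × ℝ≥0 => dyadicInterp N p.1 p.2 := by
  refine continuous_of_cells (mesh_pos N) (fun m p => p.1 (m * mesh N)
    + ((p.2 : ℝ) - m * mesh N) • velocity N p.1 m) (fun m => ?_)
    fun m p h₁ h₂ => dyadicInterp_eq N p.1 m h₁ h₂
  have h1 := (continuous_eval_const (F := Path (E r)) (m * mesh N)).comp
    (continuous_fst (X := Path (E r)) (Y := ℝ≥0))
  have h2 := (continuous_velocity (r := r) N m).comp (continuous_fst (Y := ℝ≥0))
  have h3 : Continuous fun p : Path (E r) × ℝ≥0 => (p.2 : ℝ) - m * mesh N :=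
    (NNReal.continuous_coe.comp continuous_snd).sub continuous_const
  exact h1.add (h3.smul h2)

theorem continuous_dyadicInterp (N : ℕ) : Continuous (dyadicInterp (r := r) N) :=
  ContinuousMap.continuous_of_continuous_uncurry _ (continuous_uncurry_dyadicInterp N)

theorem hasDerivAt_dyadicInterp (N : ℕ) (w : Path (E r)) (m : ℕ) {u : ℝ}
    (h₁ : (m * mesh N : ℝ≥0) < u) (h₂ : u < ((m + 1 : ℕ) * mesh N : ℝ≥0)) :
    HasDerivAt (fun u : ℝ => dyadicInterp N w u.toNNReal) (velocity N w m) u := by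
  have h3 : HasDerivAt (fun u : ℝ => w (m * mesh N) + (u - m * mesh N) • velocity N w m)
      (velocity N w m) u := by
    simpa using (((hasDerivAt_id u).sub_const ((m : ℝ) * mesh N)).smul_const
      (velocity N w m)).const_add (w (m * mesh N))
  refine h3.congr_of_eventuallyEq ?_
  filter_upwards [Ioo_mem_nhds h₁ h₂] with x hx
  have hx0 : 0 ≤ x := (NNReal.coe_nonneg _).trans hx.1.le
  rw [dyadicInterp_eq N w m (NNReal.le_toNNReal_of_coe_le hx.1.le)
    (Real.toNNReal_le_iff_le_coe.2 hx.2.le), Real.coe_toNNReal x hx0]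

end Dyadic

section Solution

variable {d r : ℕ} {O : Set (E d)} {σ : closure O → E r →L[ℝ] E d} {b : closure O → E d} {A : ℝ}

/-- The flow of the pair consisting of the solution and its accumulated reflection. -/
noncomputable def pairFlow (h : IsControlled O σ b A) (v : E r) (s : closure O × E d) (t : ℝ≥0) :
    closure O × E d :=
  (flow h v s.1 t, s.2 + push h v s.1 t)

theorem pairFlow_zero (h : IsControlled O σ b A) (v : E r) (s : closure O × E d) :
    pairFlow h v s 0 = s := by
  simp [pairFlow, flow_zero, push_zero]

theorem continuous_pairFlow (h : IsControlled O σ b A) :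
    Continuous fun p : E r × (closure O × E d) × ℝ≥0 => pairFlow h p.1 p.2.1 p.2.2 := by
  have hq : Continuous fun p : E r × (closure O × E d) × ℝ≥0 => (p.1, p.2.1.1, p.2.2) := by fun_prop
  exact ((continuous_flow h).comp hq).prodMk
    ((by fun_prop : Continuous fun p : E r × (closure O × E d) × ℝ≥0 => p.2.1.2).add
      ((continuous_push h).comp hq))

/-- The state at time `t` of the pair driven by the `N`-dyadic polygonalization of `w`. -/
noncomputable def state (h : IsControlled O σ b A) (N : ℕ) (x₀ : closure O) (w : Path (E r))
    (t : ℝ≥0) : closure O × E d :=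
  glue (pairFlow h) (mesh N) (velocity N w) (x₀, 0) t

theorem continuous_uncurry_state (h : IsControlled O σ b A) (N : ℕ) (x₀ : closure O) :
    Continuous fun p : Path (E r) × ℝ≥0 => state h N x₀ p.1 p.2 :=
  continuous_glue (continuous_pairFlow h) (pairFlow_zero h) (mesh_pos N)
    (v := fun m w => velocity N w m) (continuous_velocity N) continuous_const

/-- The reflected path driven by the `N`-dyadic polygonalization of `w`. -/
noncomputable def solX (h : IsControlled O σ b A) (N : ℕ) (x₀ : closure O) (w : Path (E r)) :
    Path (closure O) where
  toFun t := (state h N x₀ w t).1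
  continuous_toFun := continuous_fst.comp
    ((continuous_uncurry_state h N x₀).comp (Continuous.prodMk_right w))

/-- The reflection term of the path driven by the `N`-dyadic polygonalization of `w`. -/
noncomputable def solL (h : IsControlled O σ b A) (N : ℕ) (x₀ : closure O) (w : Path (E r)) :
    Path (E d) where
  toFun t := (state h N x₀ w t).2
  continuous_toFun := continuous_snd.comp
    ((continuous_uncurry_state h N x₀).comp (Continuous.prodMk_right w))

theorem continuous_solX (h : IsControlled O σ b A) (N : ℕ) (x₀ : closure O) :
    Continuous (solX h N x₀) :=
  ContinuousMap.continuous_of_continuous_uncurry _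
    (continuous_fst.comp (continuous_uncurry_state h N x₀))

theorem continuous_solL (h : IsControlled O σ b A) (N : ℕ) (x₀ : closure O) :
    Continuous (solL h N x₀) :=
  ContinuousMap.continuous_of_continuous_uncurry _
    (continuous_snd.comp (continuous_uncurry_state h N x₀))

variable (h : IsControlled O σ b A) (N : ℕ) (x₀ : closure O) (w : Path (E r))

theorem state_eq (m : ℕ) {t : ℝ≥0} (h₁ : m * mesh N ≤ t) (h₂ : t ≤ (m + 1 : ℕ) * mesh N) :
    state h N x₀ w t
      = pairFlow h (velocity N w m) (state h N x₀ w (m * mesh N)) (t - m * mesh N) := by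
  rw [state, glue_eq (pairFlow_zero h) (mesh_pos N) _ _ m h₁ h₂, state,
    glue_mul (pairFlow_zero h) (mesh_pos N)]

theorem solX_zero : solX h N x₀ w 0 = x₀ := by
  have := glue_mul (pairFlow_zero h) (mesh_pos N) (velocity N w) (x₀, 0) 0
  rw [Nat.cast_zero, zero_mul] at this
  exact congrArg Prod.fst this

theorem solL_zero : solL h N x₀ w 0 = 0 := by
  have := glue_mul (pairFlow_zero h) (mesh_pos N) (velocity N w) (x₀, 0) 0
  rw [Nat.cast_zero, zero_mul] at this
  exact congrArg Prod.snd this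

theorem solX_eq (m : ℕ) {t : ℝ≥0} (h₁ : m * mesh N ≤ t) (h₂ : t ≤ (m + 1 : ℕ) * mesh N) :
    solX h N x₀ w t = flow h (velocity N w m) (solX h N x₀ w (m * mesh N)) (t - m * mesh N) :=
  congrArg Prod.fst (state_eq h N x₀ w m h₁ h₂)

theorem solL_eq (m : ℕ) {t : ℝ≥0} (h₁ : m * mesh N ≤ t) (h₂ : t ≤ (m + 1 : ℕ) * mesh N) :
    solL h N x₀ w t = solL h N x₀ w (m * mesh N)
      + push h (velocity N w m) (solX h N x₀ w (m * mesh N)) (t - m * mesh N) :=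
  congrArg Prod.snd (state_eq h N x₀ w m h₁ h₂)

end Solution

section Equation

variable {d r : ℕ} {O : Set (E d)} {σ : closure O → E r →L[ℝ] E d} {b : closure O → E d} {A : ℝ}

theorem IsControlled.intervalIntegrable_b (h : IsControlled O σ b A) (x : Path (closure O))
    (s t : ℝ) : IntervalIntegrable (fun u : ℝ => b (x u.toNNReal)) volume s t :=
  (h.continuous_b.comp (x.continuous.comp continuous_real_toNNReal)).intervalIntegrable _ _

theorem ae_deriv_dyadicInterp (N : ℕ) (w : Path (E r)) (m : ℕ) {s t : ℝ≥0}
    (h₁ : m * mesh N ≤ s) (h₂ : t ≤ (m + 1 : ℕ) * mesh N) :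
    ∀ᵐ u : ℝ, u ∈ Ioc (s : ℝ) t →
      deriv (fun u : ℝ => dyadicInterp N w u.toNNReal) u = velocity N w m := by
  have h3 : ∀ᵐ u : ℝ, u ≠ ((m + 1 : ℕ) * mesh N : ℝ≥0) := by simp [ae_iff, measure_singleton]
  filter_upwards [h3] with u hu hu'
  refine (hasDerivAt_dyadicInterp N w m (lt_of_le_of_lt (by exact_mod_cast h₁) hu'.1)
    (lt_of_le_of_ne (hu'.2.trans (by exact_mod_cast h₂)) hu)).deriv

theorem IsControlled.integral_cell (h : IsControlled O σ b A) (N : ℕ) (w : Path (E r))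
    (x : Path (closure O)) (m : ℕ) {s t : ℝ≥0} (h₁ : m * mesh N ≤ s) (hst : s ≤ t)
    (h₂ : t ≤ (m + 1 : ℕ) * mesh N) :
    IntervalIntegrable (fun u : ℝ => σ (x u.toNNReal)
      (deriv (fun u : ℝ => dyadicInterp N w u.toNNReal) u)) volume s t ∧
    (∫ u in (s : ℝ)..t, σ (x u.toNNReal) (deriv (fun u : ℝ => dyadicInterp N w u.toNNReal) u))
      = ∫ u in (s : ℝ)..t, σ (x u.toNNReal) (velocity N w m) := by
  have hst' : (s : ℝ) ≤ t := by exact_mod_cast hst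
  have hc : Continuous fun u : ℝ => σ (x u.toNNReal) (velocity N w m) :=
    (h.continuous_σ.comp (x.continuous.comp continuous_real_toNNReal)).clm_apply continuous_const
  have hae : ∀ᵐ u : ℝ, u ∈ Ioc (s : ℝ) t → σ (x u.toNNReal) (velocity N w m)
      = σ (x u.toNNReal) (deriv (fun u : ℝ => dyadicInterp N w u.toNNReal) u) := by
    filter_upwards [ae_deriv_dyadicInterp N w m h₁ h₂] with u hu hu'
    rw [hu hu']
  refine ⟨(hc.intervalIntegrable (s : ℝ) t).congr_ae ?_, ?_⟩
  · rw [uIoc_of_le hst']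
    exact (ae_restrict_iff' measurableSet_Ioc).2 hae
  · refine intervalIntegral.integral_congr_ae ?_
    rw [uIoc_of_le hst']
    filter_upwards [hae] with u hu hu'
    exact (hu hu').symm

/-- Induction along the dyadic cells. -/
theorem dyadic_induction (N : ℕ) {P : ℝ≥0 → Prop} (h0 : P 0)
    (hstep : ∀ (m : ℕ) (t : ℝ≥0), P (m * mesh N) → m * mesh N ≤ t → t ≤ (m + 1 : ℕ) * mesh N → P t)
    (t : ℝ≥0) : P t := by
  have h1 : ∀ m : ℕ, P (m * mesh N) := by
    intro m
    induction m with
    | zero => simpa using h0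
    | succ m ih => exact hstep m _ ih (by gcongr; simp) le_rfl
  refine hstep ⌊t / mesh N⌋₊ t (h1 _) ?_ ?_
  · rw [← le_div_iff₀ (mesh_pos N)]; exact Nat.floor_le zero_le
  · rw [← div_le_iff₀ (mesh_pos N)]; exact_mod_cast (Nat.lt_floor_add_one _).le

theorem IsControlled.intervalIntegrable_σ (h : IsControlled O σ b A) (N : ℕ) (w : Path (E r))
    (x : Path (closure O)) (s t : ℝ≥0) :
    IntervalIntegrable (fun u : ℝ => σ (x u.toNNReal)
      (deriv (fun u : ℝ => dyadicInterp N w u.toNNReal) u)) volume s t := by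
  have h1 : ∀ t : ℝ≥0, IntervalIntegrable (fun u : ℝ => σ (x u.toNNReal)
      (deriv (fun u : ℝ => dyadicInterp N w u.toNNReal) u)) volume (0 : ℝ≥0) t := by
    refine dyadic_induction N (by simp) fun m t ih h₁ h₂ => ?_
    exact ih.trans (h.integral_cell N w x m le_rfl h₁ h₂).1
  exact (h1 s).symm.trans (h1 t)

theorem sol_equation (h : IsControlled O σ b A) (N : ℕ) (x₀ : closure O) (w : Path (E r))
    (t : ℝ≥0) : (solX h N x₀ w t : E d) = x₀
    + (∫ s in (0 : ℝ)..t, σ (solX h N x₀ w s.toNNReal)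
        (deriv (fun u : ℝ => dyadicInterp N w u.toNNReal) s))
    + (∫ s in (0 : ℝ)..t, b (solX h N x₀ w s.toNNReal)) + solL h N x₀ w t := by
  set x := solX h N x₀ w with hx
  revert t
  refine dyadic_induction N (by simp [hx, solX_zero, solL_zero]) fun m t ih h₁ h₂ => ?_
  set s : ℝ≥0 := m * mesh N with hs
  have h3 := h.integral_cell N w x m hs.ge h₁ h₂
  have h0 := h.intervalIntegrable_σ N w x 0 s
  have hb0 := h.intervalIntegrable_b x 0 s
  have hb1 := h.intervalIntegrable_b x s t
  have hc : IntervalIntegrable (fun u : ℝ => σ (x u.toNNReal) (velocity N w m)) volume s t :=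
    ((h.continuous_σ.comp (x.continuous.comp continuous_real_toNNReal)).clm_apply
      continuous_const).intervalIntegrable _ _
  rw [NNReal.coe_zero] at h0
  rw [← intervalIntegral.integral_add_adjacent_intervals h0 h3.1,
    ← intervalIntegral.integral_add_adjacent_intervals hb0 hb1, h3.2, solL_eq h N x₀ w m h₁ h₂,
    push, ← hx, ← hs, ← solX_eq h N x₀ w m h₁ h₂, ← hx]
  have hst : (s : ℝ) ≤ t := by exact_mod_cast h₁
  have h4 : ∫ u in (0 : ℝ)..(t - s : ℝ≥0), drift σ b (velocity N w m)
      (flow h (velocity N w m) (x s) u.toNNReal)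
      = (∫ u in (s : ℝ)..t, σ (x u.toNNReal) (velocity N w m))
        + ∫ u in (s : ℝ)..t, b (x u.toNNReal) := by
    rw [← intervalIntegral.integral_add hc hb1]
    have h5 := intervalIntegral.integral_comp_sub_right (a := (s : ℝ)) (b := t)
      (fun u => drift σ b (velocity N w m) (flow h (velocity N w m) (x s) u.toNNReal)) s
    rw [NNReal.coe_sub h₁, ← sub_self (s : ℝ), ← h5]
    refine intervalIntegral.integral_congr fun u hu => ?_
    rw [uIcc_of_le hst] at hu
    have hu0 : 0 ≤ u := s.2.trans hu.1
    have h6 : (u - s).toNNReal = u.toNNReal - s := by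
      rw [NNReal.sub_def, Real.coe_toNNReal u hu0]
    have h7 := solX_eq h N x₀ w m (t := u.toNNReal) (NNReal.le_toNNReal_of_coe_le hu.1)
      ((Real.toNNReal_le_iff_le_coe.2 hu.2).trans h₂)
    rw [← hx, ← hs] at h7
    simp only [h6, ← h7, drift]
  rw [h4]
  rw [ih]
  abel

end Equation

end ReflectedSDE

namespace ReflectedSDE

open Filter Topology

section Lipschitz

variable {F : Type*} [NormedAddCommGroup F] [NormedSpace ℝ F] {f : ℝ → F} {C : ℝ≥0} {T : ℝ}

theorem norm_deriv_le_of_lipschitzOn_Icc (hf : LipschitzOnWith C f (Icc 0 T)) {u : ℝ}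
    (hu : u ∈ Ioo 0 T) : ‖deriv f u‖ ≤ C :=
  norm_deriv_le_of_lipschitzOn (Icc_mem_nhds hu.1 hu.2) hf

variable [FiniteDimensional ℝ F]

theorem ae_differentiableAt_of_lipschitzOn_Icc (hf : LipschitzOnWith C f (Icc 0 T)) :
    ∀ᵐ u : ℝ, u ∈ Ioo 0 T → DifferentiableAt ℝ f u := by
  filter_upwards [hf.ae_differentiableWithinAt_of_mem_real] with u hu hu'
  exact (hu (Ioo_subset_Icc_self hu')).differentiableAt (Icc_mem_nhds hu'.1 hu'.2)

theorem ae_mem_Ioo_of_mem_Ioc (a b : ℝ) : ∀ᵐ u : ℝ, u ∈ Ioc a b → u ∈ Ioo a b := by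
  have h3 : ∀ᵐ u : ℝ, u ≠ b := by simp [ae_iff, measure_singleton]
  filter_upwards [h3] with u hu hu'
  exact ⟨hu'.1, lt_of_le_of_ne hu'.2 hu⟩

theorem integrableOn_deriv_of_lipschitzOn_Icc [MeasurableSpace F] [BorelSpace F]
    (hf : LipschitzOnWith C f (Icc 0 T)) : IntegrableOn (deriv f) (Ioc 0 T) := by
  have : CompleteSpace F := FiniteDimensional.complete ℝ F
  refine Measure.integrableOn_of_bounded (M := C) (by simp) (aestronglyMeasurable_deriv f _) ?_
  rw [ae_restrict_iff' measurableSet_Ioc]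
  filter_upwards [ae_mem_Ioo_of_mem_Ioc 0 T] with u hu hu'
  exact norm_deriv_le_of_lipschitzOn_Icc hf (hu hu')

theorem integral_deriv_of_lipschitzOn_Icc [MeasurableSpace F] [BorelSpace F] (hT : 0 ≤ T)
    (hf : LipschitzOnWith C f (Icc 0 T)) : ∫ u in (0 : ℝ)..T, deriv f u = f T - f 0 := by
  have : CompleteSpace F := FiniteDimensional.complete ℝ F
  have hint : IntervalIntegrable (deriv f) volume 0 T :=
    (intervalIntegrable_iff_integrableOn_Ioc_of_le hT).2 (integrableOn_deriv_of_lipschitzOn_Icc hf)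
  have hlip : LipschitzOnWith C (fun t => ∫ u in (0 : ℝ)..t, deriv f u) (Icc 0 T) := by
    refine LipschitzOnWith.of_dist_le_mul fun s hs t ht => ?_
    rw [← uIcc_of_le hT] at hs ht
    rw [dist_eq_norm, intervalIntegral.integral_interval_sub_left
      (hint.mono_set (uIcc_subset_uIcc left_mem_uIcc hs))
      (hint.mono_set (uIcc_subset_uIcc left_mem_uIcc ht)), Real.dist_eq]
    refine intervalIntegral.norm_integral_le_of_norm_le_const_ae ?_
    filter_upwards [ae_mem_Ioo_of_mem_Ioc 0 T] with u hu hu'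
    rw [uIcc_of_le hT] at hs ht
    exact norm_deriv_le_of_lipschitzOn_Icc hf (hu ⟨(le_min ht.1 hs.1).trans_lt hu'.1,
      hu'.2.trans (max_le ht.2 hs.2)⟩)
  have hf' : LipschitzOnWith C f (uIcc 0 T) := by rwa [uIcc_of_le hT]
  rw [← uIcc_of_le hT] at hlip
  have hac := (hf'.absolutelyContinuousOnInterval).sub (hlip.absolutelyContinuousOnInterval)
  obtain ⟨c, hc⟩ := hac.const_of_ae_hasDerivAt_zero (by
    filter_upwards [hint.ae_hasDerivAt_integral, ae_differentiableAt_of_lipschitzOn_Icc hf,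
      ae_mem_Ioo_of_mem_Ioc 0 T, (by simp [ae_iff, measure_singleton] : ∀ᵐ u : ℝ, u ≠ 0)]
      with u h1 h2 h3 h4 hu
    have hu' := uIcc_of_le hT ▸ hu
    have := (h2 (h3 ⟨lt_of_le_of_ne hu'.1 (Ne.symm h4), hu'.2⟩)).hasDerivAt.sub
      (h1 hu 0 left_mem_uIcc)
    rwa [sub_self] at this)
  have h1 := hc 0 left_mem_uIcc
  have h2 := hc T right_mem_uIcc
  simp only [Pi.sub_apply, intervalIntegral.integral_same, sub_zero] at h1 h2
  rw [h1, ← h2]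
  abel

theorem lintegral_enorm_deriv_of_lipschitzOn_Icc [MeasurableSpace F] [BorelSpace F] (hT : 0 ≤ T)
    (hf : LipschitzOnWith C f (Icc 0 T)) :
    ∫⁻ u in Ioc 0 T, ‖deriv f u‖ₑ = eVariationOn f (Icc 0 T) := by
  apply le_antisymm
  · have hbv : LocallyBoundedVariationOn f (Icc 0 T) := hf.locallyBoundedVariationOn
    have h0 : (0 : ℝ) ∈ Icc 0 T := left_mem_Icc.2 hT
    have hT' : T ∈ Icc 0 T := right_mem_Icc.2 hT
    set V := variationOnFromTo f (Icc 0 T) 0 with hV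
    have hmono : MonotoneOn V (uIcc 0 T) := by
      rw [uIcc_of_le hT]; exact variationOnFromTo.monotoneOn hbv h0
    have hmono' : MonotoneOn V (Icc 0 T) := variationOnFromTo.monotoneOn hbv h0
    have hle : ∀ s ∈ Icc 0 T, ∀ t ∈ Icc 0 T, s ≤ t → ‖f t - f s‖ ≤ V t - V s := by
      intro s hs t ht hst
      rw [hV, variationOnFromTo.sub_right hbv h0 ht hs,
        variationOnFromTo.eq_of_le _ _ hst, ← dist_eq_norm]
      have h1 := eVariationOn.edist_le f (s := Icc 0 T ∩ Icc s t) ⟨ht, hst, le_rfl⟩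
        ⟨hs, le_rfl, hst⟩
      rw [dist_edist]
      exact ENNReal.toReal_mono (hbv s t hs ht) h1
    have hderiv : ∀ᵐ u : ℝ, u ∈ Ioc 0 T → ‖deriv f u‖ ≤ deriv V u := by
      filter_upwards [ae_differentiableAt_of_lipschitzOn_Icc hf, ae_mem_Ioo_of_mem_Ioc 0 T,
        hmono'.ae_differentiableWithinAt_of_mem] with u h1 h2 h3 hu
      have hu' := h2 hu
      have hnhds := Icc_mem_nhds hu'.1 hu'.2
      have h4 := (h1 hu').hasDerivAt
      have h5 := ((h3 (Ioo_subset_Icc_self hu')).differentiableAt hnhds).hasDerivAt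
      have h6 := ((hasDerivAt_iff_tendsto_slope.1 h4).mono_left (nhdsGT_le_nhdsNE u)).norm
      have h7 := (hasDerivAt_iff_tendsto_slope.1 h5).mono_left (nhdsGT_le_nhdsNE u)
      refine le_of_tendsto_of_tendsto h6 h7 ?_
      filter_upwards [self_mem_nhdsWithin, mem_nhdsWithin_of_mem_nhds hnhds] with t ht ht'
      have ht0 : 0 < t - u := sub_pos.2 ht
      rw [slope_def_module, slope_def_field, norm_smul, norm_inv, Real.norm_of_nonneg ht0.le,
        inv_mul_eq_div]
      gcongr
      exact hle u (Ioo_subset_Icc_self hu') t ht' (le_of_lt ht)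
    have hVint := hmono.intervalIntegrable_deriv
    have hmem := hmono.intervalIntegral_deriv_mem_uIcc
    have hV0T : V 0 ≤ V T := hmono' h0 hT' hT
    rw [uIcc_of_le (sub_nonneg.2 hV0T)] at hmem
    have hV0 : V 0 = 0 := variationOnFromTo.self _ _ _
    rw [intervalIntegral.integral_of_le hT] at hmem
    have hnn : 0 ≤ᵐ[volume.restrict (Ioc 0 T)] deriv V := by
      refine (ae_restrict_iff' measurableSet_Ioc).2 ?_
      filter_upwards [hderiv] with u hu hu'
      exact (norm_nonneg _).trans (hu hu')
    calc ∫⁻ u in Ioc 0 T, ‖deriv f u‖ₑ ≤ ∫⁻ u in Ioc 0 T, ENNReal.ofReal (deriv V u) := by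
          refine lintegral_mono_ae ((ae_restrict_iff' measurableSet_Ioc).2 ?_)
          filter_upwards [hderiv] with u hu hu'
          rw [← ofReal_norm]
          exact ENNReal.ofReal_le_ofReal (hu hu')
      _ = ENNReal.ofReal (∫ u in Ioc 0 T, deriv V u) :=
          (ofReal_integral_eq_lintegral_ofReal ((intervalIntegrable_iff_integrableOn_Ioc_of_le
            hT).1 hVint) hnn).symm
      _ ≤ ENNReal.ofReal (V T) := ENNReal.ofReal_le_ofReal (by linarith [hmem.2])
      _ = eVariationOn f (Icc 0 T) := by
          rw [hV, variationOnFromTo.eq_of_le _ _ hT, inter_self, ENNReal.ofReal_toReal]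
          exact (by simpa only [inter_self] using hbv 0 T h0 hT' : BoundedVariationOn f (Icc 0 T))
  · refine iSup_le fun ⟨n, u, hu, hus⟩ => ?_
    have hint := integrableOn_deriv_of_lipschitzOn_Icc hf
    have hstep : ∀ s ∈ Icc 0 T, ∀ t ∈ Icc 0 T, s ≤ t →
        edist (f t) (f s) ≤ ∫⁻ x in Ioc s t, ‖deriv f x‖ₑ := by
      intro s hs t ht hst
      have h1 := integral_deriv_of_lipschitzOn_Icc hs.1 (hf.mono (Icc_subset_Icc_right hs.2))
      have h2 := integral_deriv_of_lipschitzOn_Icc ht.1 (hf.mono (Icc_subset_Icc_right ht.2))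
      have hI : ∀ a ∈ Icc 0 T, IntervalIntegrable (deriv f) volume 0 a := fun a ha =>
        (intervalIntegrable_iff_integrableOn_Ioc_of_le ha.1).2
          (hint.mono_set (Ioc_subset_Ioc_right ha.2))
      have h3 : f t - f s = ∫ x in Ioc s t, deriv f x := by
        rw [← intervalIntegral.integral_of_le hst, ← intervalIntegral.integral_interval_sub_left
          (hI t ht) (hI s hs), h1, h2]
        abel
      rw [edist_eq_enorm_sub, h3]
      exact enorm_integral_le_lintegral_enorm _
    have hsum : ∀ n : ℕ, ∑ i ∈ Finset.range n, edist (f (u (i + 1))) (f (u i))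
        ≤ ∫⁻ x in Ioc (u 0) (u n), ‖deriv f x‖ₑ := by
      intro n
      induction n with
      | zero => simp
      | succ n ih =>
        rw [Finset.sum_range_succ, ← Ioc_union_Ioc_eq_Ioc (hu (Nat.zero_le n)) (hu n.le_succ),
          lintegral_union measurableSet_Ioc (Ioc_disjoint_Ioc_of_le le_rfl)]
        exact add_le_add ih (hstep _ (hus _) _ (hus _) (hu n.le_succ))
    exact (hsum n).trans (lintegral_mono_set (Ioc_subset_Ioc (hus 0).1 (hus n).2))

end Lipschitz

theorem exists_totalVariationMeasure {d : ℕ} {ℓ : Path (E d)} (h0 : ℓ 0 = 0)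
    (hLip : ∀ T : ℝ≥0, ∃ C : ℝ≥0, LipschitzOnWith C (fun u : ℝ => ℓ u.toNNReal) (Icc 0 T))
    {P : ℝ≥0 → E d → Prop}
    (hP : ∀ᵐ u : ℝ, 0 < u → deriv (fun u : ℝ => ℓ u.toNNReal) u ≠ 0 → P u.toNNReal
      (‖deriv (fun u : ℝ => ℓ u.toNNReal) u‖⁻¹ • deriv (fun u : ℝ => ℓ u.toNNReal) u)) :
    LocallyBoundedVariationOn ℓ univ ∧
    ∃ μ : Measure ℝ≥0, IsTotalVariationMeasure ℓ μ ∧ ∃ n : ℝ≥0 → E d, Measurable n ∧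
      (∀ᵐ s ∂μ, P s (n s)) ∧ ∀ t : ℝ≥0, ℓ t = ∫ s in Icc 0 t, n s ∂μ := by
  set f : ℝ → E d := fun u => ℓ u.toNNReal with hf
  set l := deriv f with hl
  have hlm : Measurable l := measurable_deriv f
  have hvar : ∀ t : ℝ≥0, eVariationOn ℓ (Icc 0 t) = ∫⁻ u in Ioc (0 : ℝ) t, ‖l u‖ₑ := by
    intro t
    obtain ⟨C, hC⟩ := hLip t
    rw [lintegral_enorm_deriv_of_lipschitzOn_Icc t.coe_nonneg hC]
    have h1 := eVariationOn.comp_eq_of_monotoneOn ℓ (t := Icc (0 : ℝ) t) Real.toNNReal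
      fun _ _ _ _ hxy => Real.toNNReal_mono hxy
    have h2 : Real.toNNReal '' Icc (0 : ℝ) t = Icc 0 t := by
      ext s
      constructor
      · rintro ⟨u, hu, rfl⟩
        exact ⟨zero_le, Real.toNNReal_le_iff_le_coe.2 hu.2⟩
      · intro hs
        exact ⟨s, ⟨s.2, by exact_mod_cast hs.2⟩, Real.toNNReal_coe⟩
    rw [h2] at h1
    exact h1.symm
  have hfin : ∀ t : ℝ≥0, eVariationOn ℓ (Icc 0 t) ≠ ∞ := by
    intro t
    obtain ⟨C, hC⟩ := hLip t
    rw [hvar]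
    exact (integrableOn_deriv_of_lipschitzOn_Icc hC).2.ne
  set ν : Measure ℝ := (volume.restrict (Ioi 0)).withDensity fun u => (‖l u‖₊ : ℝ≥0∞) with hν
  have hemb : MeasurableEmbedding ((↑) : ℝ≥0 → ℝ) := MeasurableEmbedding.subtype_coe measurableSet_Ici
  have hpre : ∀ t : ℝ≥0, ((↑) : ℝ≥0 → ℝ) ⁻¹' Iic (t : ℝ) = Icc 0 t := by
    intro t; ext u; simp
  have hν0 : ν.restrict (range ((↑) : ℝ≥0 → ℝ)) = ν := by
    have : range ((↑) : ℝ≥0 → ℝ) = Ici 0 := Subtype.range_coe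
    rw [this, hν, restrict_withDensity measurableSet_Ici,
      Measure.restrict_restrict measurableSet_Ici, inter_eq_right.2 Ioi_subset_Ici_self]
  have hmap : (ν.comap ((↑) : ℝ≥0 → ℝ)).map (↑) = ν := by rw [hemb.map_comap, hν0]
  have hinter : ∀ t : ℝ≥0, Iic (t : ℝ) ∩ Ioi 0 = Ioc 0 (t : ℝ) := by
    intro t; ext u; simp [and_comm]
  have hnm : Measurable fun u : ℝ => ‖l u‖⁻¹ • l u := (hlm.norm.inv).smul hlm
  refine ⟨fun s t _ _ => ne_top_of_le_ne_top (hfin t) (eVariationOn.mono _ ?_),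
    ν.comap (↑), fun t => ?_, fun s => ‖l s‖⁻¹ • l s,
    hnm.comp NNReal.continuous_coe.measurable, ?_, fun t => ?_⟩
  · exact fun u hu => ⟨zero_le, hu.2.2⟩
  · rw [← hpre, ← Measure.map_apply hemb.measurable measurableSet_Iic, hmap, hν,
      withDensity_apply _ measurableSet_Iic, Measure.restrict_restrict measurableSet_Iic, hinter,
      hpre, hvar]
    rfl
  · have h1 : ∀ᵐ u ∂ν, P u.toNNReal (‖l u.toNNReal‖⁻¹ • l u.toNNReal) := by
      rw [hν, ae_withDensity_iff (by fun_prop), ae_restrict_iff' measurableSet_Ioi]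
      filter_upwards [hP] with u hu hu' hne
      rw [Real.coe_toNNReal u (le_of_lt hu')]
      exact hu hu' (by simpa using hne)
    rw [← hmap] at h1
    filter_upwards [ae_of_ae_map hemb.measurable.aemeasurable h1] with s hs
    simpa using hs
  · rw [← hpre, ← hemb.setIntegral_map (fun u => ‖l u‖⁻¹ • l u), hmap, hν,
      setIntegral_withDensity_eq_setIntegral_smul (by fun_prop) _ measurableSet_Iic,
      Measure.restrict_restrict measurableSet_Iic, hinter]
    obtain ⟨C, hC⟩ := hLip t
    have h2 := integral_deriv_of_lipschitzOn_Icc t.coe_nonneg hC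
    rw [intervalIntegral.integral_of_le t.coe_nonneg] at h2
    have h3 : ℓ t = f t - f 0 := by simp [hf, h0]
    rw [h3, ← h2]
    refine setIntegral_congr_fun measurableSet_Ioc fun u hu => ?_
    change l u = ‖l u‖ • ‖l u‖⁻¹ • l u
    rcases eq_or_ne (l u) 0 with h | h
    · simp [h]
    · rw [smul_smul, mul_inv_cancel₀ (norm_ne_zero_iff.2 h), one_smul]

section Existence

variable {d r : ℕ} {O : Set (E d)} {σ : closure O → E r →L[ℝ] E d} {b : closure O → E d} {A : ℝ}

theorem exists_dist_solL_le (h : IsControlled O σ b A) (N : ℕ) (x₀ : closure O) (w : Path (E r))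
    (m : ℕ) : ∃ C : ℝ, 0 ≤ C ∧ ∀ s t : ℝ≥0, s ≤ t → t ≤ m * mesh N →
      ‖solL h N x₀ w t - solL h N x₀ w s‖ ≤ C * ((t : ℝ) - s) := by
  have hA := h.nonneg
  induction m with
  | zero =>
    refine ⟨0, le_rfl, fun s t hst ht => ?_⟩
    rw [Nat.cast_zero, zero_mul] at ht
    have ht0 : t = 0 := le_antisymm ht zero_le
    have hs0 : s = 0 := le_antisymm (hst.trans ht) zero_le
    simp [ht0, hs0]
  | succ m ih =>
    obtain ⟨C, hC0, hC⟩ := ih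
    set K := 3 * (A * (‖velocity N w m‖ + 1)) with hK
    have hK0 : 0 ≤ K := by positivity
    have hcell : ∀ s t : ℝ≥0, m * mesh N ≤ s → s ≤ t → t ≤ (m + 1 : ℕ) * mesh N →
        ‖solL h N x₀ w t - solL h N x₀ w s‖ ≤ K * ((t : ℝ) - s) := by
      intro s t hs hst ht
      rw [solL_eq h N x₀ w m (hs.trans hst) ht, solL_eq h N x₀ w m hs (hst.trans ht),
        add_sub_add_left_eq_sub]
      refine (norm_push_sub_push_le h _ _ (tsub_le_tsub_right hst _)).trans (le_of_eq ?_)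
      rw [NNReal.coe_sub (hs.trans hst), NNReal.coe_sub hs]
      ring
    refine ⟨C + K, by positivity, fun s t hst ht => ?_⟩
    have hd : (0 : ℝ) ≤ (t : ℝ) - s := sub_nonneg.2 (by exact_mod_cast hst)
    rcases le_total t (m * mesh N) with h1 | h1
    · exact (hC s t hst h1).trans (by gcongr; linarith)
    rcases le_total (m * mesh N) s with h2 | h2
    · exact (hcell s t h2 hst ht).trans (by gcongr; linarith)
    · rw [← sub_add_sub_cancel _ (solL h N x₀ w (m * mesh N))]
      refine (norm_add_le _ _).trans ?_
      have h3 := hcell (m * mesh N) t le_rfl h1 ht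
      have h4 := hC s (m * mesh N) h2 le_rfl
      have h5 : ((m * mesh N : ℝ≥0) : ℝ) ≤ t := by exact_mod_cast h1
      have h6 : (s : ℝ) ≤ ((m * mesh N : ℝ≥0) : ℝ) := by exact_mod_cast h2
      nlinarith

theorem exists_lipschitzOn_solL (h : IsControlled O σ b A) (N : ℕ) (x₀ : closure O)
    (w : Path (E r)) (T : ℝ≥0) :
    ∃ C : ℝ≥0, LipschitzOnWith C (fun u : ℝ => solL h N x₀ w u.toNNReal) (Icc 0 T) := by
  obtain ⟨C, hC0, hC⟩ := exists_dist_solL_le h N x₀ w ⌈T / mesh N⌉₊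
  have hT : T ≤ ⌈T / mesh N⌉₊ * mesh N := by
    rw [← div_le_iff₀ (mesh_pos N)]; exact Nat.le_ceil _
  have hle : ∀ s ∈ Icc (0 : ℝ) T, ∀ t ∈ Icc (0 : ℝ) T, s ≤ t →
      ‖solL h N x₀ w t.toNNReal - solL h N x₀ w s.toNNReal‖ ≤ C * (t - s) := by
    intro s hs t ht hst
    have h1 := hC s.toNNReal t.toNNReal (Real.toNNReal_mono hst)
      ((Real.toNNReal_le_iff_le_coe.2 ht.2).trans hT)
    rwa [Real.coe_toNNReal t ht.1, Real.coe_toNNReal s hs.1] at h1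
  refine ⟨⟨C, hC0⟩, LipschitzOnWith.of_dist_le_mul fun s hs t ht => ?_⟩
  rcases le_total s t with hst | hst
  · rw [dist_comm, dist_comm s, dist_eq_norm, Real.dist_eq, abs_of_nonneg (sub_nonneg.2 hst)]
    exact hle s hs t ht hst
  · rw [dist_eq_norm, Real.dist_eq, abs_of_nonneg (sub_nonneg.2 hst)]
    exact hle t ht s hs hst

theorem isReflectedSolution_sol (h : IsControlled O σ b A) (N : ℕ) (x₀ : closure O)
    (w : Path (E r)) :
    IsReflectedSolution O σ b x₀ (dyadicInterp N w) (solX h N x₀ w) (solL h N x₀ w) := by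
  have hdiff : ∀ᵐ u : ℝ, 0 < u →
      DifferentiableAt ℝ (fun u : ℝ => solL h N x₀ w u.toNNReal) u := by
    have h1 : ∀ T : ℕ, ∀ᵐ u : ℝ, u ∈ Ioo (0 : ℝ) (T : ℝ≥0) →
        DifferentiableAt ℝ (fun u : ℝ => solL h N x₀ w u.toNNReal) u := fun T => by
      obtain ⟨C, hC⟩ := exists_lipschitzOn_solL h N x₀ w T
      exact ae_differentiableAt_of_lipschitzOn_Icc hC
    filter_upwards [ae_all_iff.2 h1] with u hu hu0
    obtain ⟨T, hT⟩ := exists_nat_gt u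
    exact hu T ⟨hu0, by exact_mod_cast hT⟩
  have hgrid : ∀ᵐ u : ℝ, ∀ m : ℕ, u ≠ (m * mesh N : ℝ≥0) :=
    ae_all_iff.2 fun m => by simp [ae_iff, measure_singleton]
  obtain ⟨hbv, μ, hμ, n, hn, hn', hint⟩ := exists_totalVariationMeasure (ℓ := solL h N x₀ w)
    (P := fun s v => (solX h N x₀ w s : E d) ∈ frontier O ∧ v ∈ inwardNormals O (solX h N x₀ w s))
    (solL_zero h N x₀ w) (exists_lipschitzOn_solL h N x₀ w) (by
      filter_upwards [hdiff, hgrid] with u h1 h2 hu hne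
      obtain ⟨t, rfl⟩ : ∃ t : ℝ≥0, u = t := ⟨u.toNNReal, (Real.coe_toNNReal u hu.le).symm⟩
      have ht0 : 0 < t := hu
      set m := ⌊t / mesh N⌋₊ with hm
      have h3 : m * mesh N ≤ t := by
        rw [← le_div_iff₀ (mesh_pos N)]; exact Nat.floor_le zero_le
      have h4 : t < (m + 1 : ℕ) * mesh N := by
        rw [← div_lt_iff₀ (mesh_pos N)]; exact_mod_cast Nat.lt_floor_add_one _
      have h3' : m * mesh N < t := lt_of_le_of_ne h3 fun h5 => h2 m (by rw [h5])
      have h5 := (h1 hu).hasDerivAt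
      set l := deriv (fun u : ℝ => solL h N x₀ w u.toNNReal) t with hl
      have h6 : HasDerivAt (fun u : ℝ => push h (velocity N w m) (solX h N x₀ w (m * mesh N))
          u.toNNReal) l ((t - m * mesh N : ℝ≥0) : ℝ) := by
        have h7 : HasDerivAt (fun u : ℝ => u + (m * mesh N : ℝ≥0)) 1
            ((t - m * mesh N : ℝ≥0) : ℝ) := (hasDerivAt_id _).add_const _
        have h8 : ((t - m * mesh N : ℝ≥0) : ℝ) + (m * mesh N : ℝ≥0) = t := by
          rw [NNReal.coe_sub h3]; ring
        rw [← h8] at h5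
        have h9 := (h5.scomp (h := fun u : ℝ => u + (m * mesh N : ℝ≥0)) _ h7).sub_const (solL h N x₀ w (m * mesh N))
        rw [one_smul] at h9
        refine h9.congr_of_eventuallyEq ?_
        have h10 : ((t - m * mesh N : ℝ≥0) : ℝ) ∈ Ioo (0 : ℝ) (mesh N) := by
          rw [NNReal.coe_sub h3]
          constructor
          · exact sub_pos.2 (by exact_mod_cast h3')
          · have : (t : ℝ) < ((m + 1 : ℕ) * mesh N : ℝ≥0) := by exact_mod_cast h4
            push_cast at this ⊢
            linarith
        filter_upwards [Ioo_mem_nhds h10.1 h10.2] with v hv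
        have h11 : (v + (m * mesh N : ℝ≥0)).toNNReal = v.toNNReal + m * mesh N := by
          rw [Real.toNNReal_add hv.1.le (NNReal.coe_nonneg _), Real.toNNReal_coe]
        have h12 := solL_eq h N x₀ w m (t := v.toNNReal + m * mesh N) (by simp) (by
          push_cast
          rw [add_mul, one_mul, add_comm]
          gcongr
          exact Real.toNNReal_le_iff_le_coe.2 hv.2.le)
        simp only [Function.comp, h11, h12, add_tsub_cancel_right, add_sub_cancel_left]
      have h7 := push_deriv_mem h h6 (tsub_pos_of_lt h3') hne
      rw [← solX_eq h N x₀ w m h3 h4.le] at h7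
      rw [Real.toNNReal_coe]
      exact h7)
  exact ⟨hbv, sol_equation h N x₀ w, μ, hμ, hn'.mono fun s hs => hs.1, n, hn,
    hn'.mono fun s hs => hs.2, hint⟩

end Existence

end ReflectedSDE

namespace ReflectedSDE

open Filter Topology

theorem le_of_forall_increment_le {g a : ℝ≥0 → ℝ} {s t : ℝ≥0} (hst : s ≤ t)
    (h : ∀ ε > 0, ∃ δ > 0, ∀ u v : ℝ≥0, s ≤ u → u ≤ v → v ≤ t → (v : ℝ) - u < δ →
      g v - g u ≤ ε * (a v - a u)) : g t ≤ g s := by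
  have key : ∀ ε > 0, g t - g s ≤ ε * (a t - a s) := by
    intro ε hε
    obtain ⟨δ, hδ, hstep⟩ := h ε hε
    obtain ⟨n, hn⟩ := exists_nat_gt (((t : ℝ) - s) / δ)
    have hd : (0 : ℝ) ≤ (t : ℝ) - s := sub_nonneg.2 (by exact_mod_cast hst)
    have hn0 : (0 : ℝ) < n := (by positivity : 0 ≤ ((t : ℝ) - s) / δ).trans_lt hn
    have hn0' : (n : ℝ≥0) ≠ 0 := by exact_mod_cast hn0.ne'
    let p : ℕ → ℝ≥0 := fun k => s + k * ((t - s) / n)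
    have hpn : p n = t := by
      simp only [p]; rw [mul_div_cancel₀ _ hn0', add_tsub_cancel_of_le hst]
    have hp0 : p 0 = s := by simp [p]
    have hmono : Monotone p := fun i j hij => by simp only [p]; gcongr
    have hsum : ∀ k : ℕ, k ≤ n → g (p k) - g (p 0) ≤ ε * (a (p k) - a (p 0)) := by
      intro k hk
      induction k with
      | zero => simp
      | succ k ih =>
        have h1 := hstep (p k) (p (k + 1)) (hp0 ▸ hmono (Nat.zero_le k)) (hmono k.le_succ)
          (hpn ▸ hmono hk) (by
            have : ((p (k + 1) : ℝ≥0) : ℝ) - p k = ((t : ℝ) - s) / n := by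
              simp only [p]
              push_cast [NNReal.coe_sub hst]
              ring
            rw [this, div_lt_iff₀ hn0]
            rwa [div_lt_iff₀ hδ, mul_comm] at hn)
        have h2 := ih (Nat.le_of_succ_le hk)
        linarith
    simpa [hpn, hp0] using hsum n le_rfl
  by_contra! hlt
  rcases le_or_gt (a t - a s) 0 with hc | hc
  · have := key 1 one_pos; linarith
  · have := key ((g t - g s) / (2 * (a t - a s))) (div_pos (by linarith) (by linarith))
    have h2 : (g t - g s) / (2 * (a t - a s)) * (a t - a s) = (g t - g s) / 2 := by field_simp
    linarith

theorem norm_sq_sub_norm_sq_le {F : Type*} [NormedAddCommGroup F] [InnerProductSpace ℝ F]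
    (x y : F) : ‖x‖ ^ 2 - ‖y‖ ^ 2 ≤ 2 * inner ℝ x (x - y) := by
  have h1 := norm_sub_sq_real x y
  rw [inner_sub_right, real_inner_self_eq_norm_sq]
  nlinarith [sq_nonneg ‖x - y‖]

variable {d r : ℕ} {O : Set (E d)}

/-- `ℓ` is a reflection term for the path `x` with the total variation measure `μ` and the
direction `n`. -/
structure IsReflection (O : Set (E d)) (x : Path (closure O)) (ℓ : Path (E d)) (μ : Measure ℝ≥0)
    (n : ℝ≥0 → E d) : Prop where
  finite : ∀ t, μ (Icc 0 t) ≠ ∞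
  measurable : Measurable n
  mem_frontier : ∀ᵐ s ∂μ, (x s : E d) ∈ frontier O
  mem_normals : ∀ᵐ s ∂μ, n s ∈ inwardNormals O (x s)
  measure_zero : μ {0} = 0
  eq_integral : ∀ t : ℝ≥0, ℓ t = ∫ s in Icc 0 t, n s ∂μ

theorem IsReflectedSolution.exists_isReflection {σ : closure O → E r →L[ℝ] E d}
    {b : closure O → E d} {x₀ : closure O} {w : Path (E r)} {x : Path (closure O)} {ℓ : Path (E d)}
    (hx : IsReflectedSolution O σ b x₀ w x ℓ) : ∃ μ n, IsReflection O x ℓ μ n := by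
  obtain ⟨μ, hμ, hfr, n, hn, hnor, heq⟩ := hx.reflection
  refine ⟨μ, n, fun t => ?_, hn, hfr, hnor, ?_, heq⟩
  · have h1 : BoundedVariationOn ℓ (univ ∩ Icc 0 t) :=
      hx.locallyBoundedVariation 0 t (mem_univ _) (mem_univ _)
    rw [univ_inter] at h1
    rw [hμ t]
    exact h1
  · have := hμ 0
    rwa [Icc_self, eVariationOn.subsingleton _ subsingleton_singleton] at this

namespace IsReflection

variable {x : Path (closure O)} {ℓ : Path (E d)} {μ : Measure ℝ≥0} {n : ℝ≥0 → E d}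

theorem zero (h : IsReflection O x ℓ μ n) : ℓ 0 = 0 := by
  rw [h.eq_integral, Icc_self, Measure.restrict_zero_set h.measure_zero, integral_zero_measure]

theorem integrableOn (h : IsReflection O x ℓ μ n) (t : ℝ≥0) : IntegrableOn n (Icc 0 t) μ := by
  refine Measure.integrableOn_of_bounded (M := 1) (h.finite t)
    h.measurable.aestronglyMeasurable ?_
  filter_upwards [ae_restrict_of_ae h.mem_normals] with s hs
  exact hs.1.le

theorem sub_eq (h : IsReflection O x ℓ μ n) {s t : ℝ≥0} (hst : s ≤ t) :
    ℓ t - ℓ s = ∫ u in Ioc s t, n u ∂μ := by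
  have h1 := h.integrableOn t
  rw [h.eq_integral, h.eq_integral, ← Icc_union_Ioc_eq_Icc (zero_le (a := s)) hst,
    setIntegral_union ((Iic_disjoint_Ioc le_rfl).mono_left Icc_subset_Iic_self) measurableSet_Ioc
      (h1.mono_set (Icc_subset_Icc_right hst))
      (h1.mono_set fun u hu => ⟨zero_le, hu.2⟩), add_sub_cancel_left]

theorem finite_Ioc (h : IsReflection O x ℓ μ n) (s t : ℝ≥0) : μ (Ioc s t) ≠ ∞ :=
  ne_top_of_le_ne_top (h.finite t) (measure_mono fun _ hu => ⟨zero_le, hu.2⟩)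

theorem measureReal_add (h : IsReflection O x ℓ μ n) {s u t : ℝ≥0} (hsu : s ≤ u) (hut : u ≤ t) :
    μ.real (Ioc s t) = μ.real (Ioc s u) + μ.real (Ioc u t) := by
  rw [← Ioc_union_Ioc_eq_Ioc hsu hut, measureReal_union (Ioc_disjoint_Ioc_of_le le_rfl)
    measurableSet_Ioc (h.finite_Ioc s u) (h.finite_Ioc u t)]

theorem inner_sub_le (h : IsReflection O x ℓ μ n) {s t : ℝ≥0} (hst : s ≤ t) {c : E d} {κ : ℝ}
    (hκ : ∀ᵐ u ∂μ, u ∈ Ioc s t → inner ℝ c (n u) ≤ κ) :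
    inner ℝ c (ℓ t - ℓ s) ≤ κ * μ.real (Ioc s t) := by
  have hint : IntegrableOn n (Ioc s t) μ :=
    (h.integrableOn t).mono_set fun u hu => ⟨zero_le, hu.2⟩
  rw [h.sub_eq hst, ← integral_inner hint]
  have h2 : ∫ u in Ioc s t, κ ∂μ = κ * μ.real (Ioc s t) := by
    rw [setIntegral_const, smul_eq_mul, mul_comm]
  rw [← h2]
  exact setIntegral_mono_on_ae (hint.const_inner c)
    (integrableOn_const (h.finite_Ioc s t)) measurableSet_Ioc hκ

variable {σ : closure O → E r →L[ℝ] E d} {b : closure O → E d} {A : ℝ}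

theorem norm_sub_sq_le (h : IsReflection O x ℓ μ n) (hA : IsControlled O σ b A) {s t : ℝ≥0}
    (hst : s ≤ t) {D ω : ℝ} (hD : ∀ u ∈ Icc s t, ‖(x u : E d) - x s‖ ≤ D)
    (hω : ∀ u ∈ Icc s t, ‖((x u : E d) - ℓ u) - (x s - ℓ s)‖ ≤ ω) :
    ‖ℓ t - ℓ s‖ ^ 2 ≤ 2 * (A * D ^ 2 + ω) * μ.real (Ioc s t) := by
  have hA0 := hA.nonneg
  have hpt : ∀ᵐ u ∂μ, u ∈ Ioc s t → inner ℝ (ℓ u - ℓ s) (n u) ≤ A * D ^ 2 + ω := by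
    filter_upwards [h.mem_frontier, h.mem_normals] with u hu hn hus
    have hus' := Ioc_subset_Icc_self hus
    have h1 := hA.normal _ hu _ hn (x s) (x s).2
    have h2 : A * ‖(x s : E d) - x u‖ ^ 2 ≤ A * D ^ 2 := by
      rw [norm_sub_rev]; gcongr; exact hD u hus'
    have h3 : ℓ u - ℓ s = -((x s : E d) - x u) - (((x u : E d) - ℓ u) - (x s - ℓ s)) := by abel
    have h4 := (neg_le_abs _).trans
      (abs_real_inner_le_norm (((x u : E d) - ℓ u) - (x s - ℓ s)) (n u))
    rw [hn.1, mul_one] at h4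
    have h5 := hω u hus'
    rw [h3, inner_sub_left, inner_neg_left]
    linarith
  have key := le_of_forall_increment_le
    (g := fun u => ‖ℓ u - ℓ s‖ ^ 2 - 2 * (A * D ^ 2 + ω) * μ.real (Ioc s u))
    (a := fun u => 2 * μ.real (Ioc s u)) hst fun ε hε => ?_
  · simp only [sub_self, norm_zero, Ioc_self, measureReal_empty, mul_zero] at key
    linarith
  · have huc := isCompact_Icc.uniformContinuousOn_of_continuous (s := Icc s t)
      ℓ.continuous.continuousOn
    obtain ⟨δ, hδ, hδ'⟩ := Metric.uniformContinuousOn_iff.1 huc ε hε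
    refine ⟨δ, hδ, fun u v hsu huv hvt huvδ => ?_⟩
    have h1 := norm_sq_sub_norm_sq_le (ℓ v - ℓ s) (ℓ u - ℓ s)
    rw [sub_sub_sub_cancel_right] at h1
    have h2 : inner ℝ (ℓ v - ℓ s) (ℓ v - ℓ u) ≤ (A * D ^ 2 + ω + ε) * μ.real (Ioc u v) := by
      refine h.inner_sub_le huv ?_
      filter_upwards [hpt, h.mem_normals] with y hy hn hyu
      have h3 := hy ⟨hsu.trans_lt hyu.1, hyu.2.trans hvt⟩
      have h4 : ℓ v - ℓ s = (ℓ y - ℓ s) + (ℓ v - ℓ y) := by abel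
      have h5 := real_inner_le_norm (ℓ v - ℓ y) (n y)
      have h6 := hδ' v ⟨hsu.trans huv, hvt⟩ y ⟨hsu.trans hyu.1.le, hyu.2.trans hvt⟩ (by
        rw [NNReal.dist_eq, abs_of_nonneg (sub_nonneg.2 (by exact_mod_cast hyu.2))]
        have : (u : ℝ) ≤ y := by exact_mod_cast hyu.1.le
        linarith)
      rw [dist_eq_norm] at h6
      rw [hn.1, mul_one] at h5
      rw [h4, inner_add_left]
      linarith
    have h3 := h.measureReal_add hsu huv
    simp only [h3]
    linarith

theorem mul_measureReal_le (h : IsReflection O x ℓ μ n) {lam ρ : ℝ} {k : ℕ}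
    {a c : Fin k → E d} (ha : ∀ i, ‖a i‖ = 1) (hcov : frontier O ⊆ ⋃ i, Metric.ball (c i) ρ)
    (hlam : ∀ i, ∀ x ∈ frontier O ∩ Metric.ball (c i) (2 * ρ),
      ∀ n ∈ inwardNormals O x, lam ≤ inner ℝ n (a i)) {s t : ℝ≥0} (hst : s ≤ t) {D : ℝ}
    (hDρ : D ≤ ρ / 2) (hD : ∀ u ∈ Icc s t, ‖(x u : E d) - x s‖ ≤ D) :
    lam * μ.real (Ioc s t) ≤ ‖ℓ t - ℓ s‖ := by
  by_cases hex : ∃ u ∈ Icc s t, (x u : E d) ∈ frontier O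
  · obtain ⟨u₀, hu₀, hu₀O⟩ := hex
    obtain ⟨i, hi⟩ := mem_iUnion.1 (hcov hu₀O)
    have h1 : inner ℝ (-a i) (ℓ t - ℓ s) ≤ -lam * μ.real (Ioc s t) := by
      refine h.inner_sub_le hst ?_
      filter_upwards [h.mem_frontier, h.mem_normals] with u hu hn hus
      have h2 := hlam i (x u) ⟨hu, ?_⟩ _ hn
      · rw [inner_neg_left, real_inner_comm]; linarith
      · rw [Metric.mem_ball] at hi ⊢
        have h3 := hD u (Ioc_subset_Icc_self hus)
        have h4 := hD u₀ hu₀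
        rw [← dist_eq_norm] at h3 h4
        rw [dist_comm] at h4
        linarith [dist_triangle (x u : E d) (x s) (x u₀), dist_triangle (x u : E d) (x u₀) (c i)]
    rw [inner_neg_left] at h1
    have h2 := real_inner_le_norm (a i) (ℓ t - ℓ s)
    rw [ha i, one_mul] at h2
    linarith
  · have h1 : μ (Ioc s t) = 0 := by
      refine measure_mono_null (fun u hu => ?_) (ae_iff.1 h.mem_frontier)
      exact fun hu' => hex ⟨u, Ioc_subset_Icc_self hu, hu'⟩
    rw [measureReal_def, h1]
    simp

end IsReflection

/-- The oscillation of a reflected path is controlled by the oscillation of its free part. -/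
theorem exists_norm_sub_le_of_driver {σ : closure O → E r →L[ℝ] E d} {b : closure O → E d} {A : ℝ}
    (hA : IsControlled O σ b A) (hadm : IsAdmissible O) :
    ∃ C : ℝ, 0 < C ∧ ∀ (x : Path (closure O)) (ℓ : Path (E d)) (μ : Measure ℝ≥0) (n : ℝ≥0 → E d),
      IsReflection O x ℓ μ n → ∀ (s t : ℝ≥0) (ω : ℝ), s ≤ t →
        (∀ u ∈ Icc s t, ‖((x u : E d) - ℓ u) - (x s - ℓ s)‖ ≤ ω) →
        ‖(x t : E d) - x s‖ ≤ C * ω := by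
  obtain ⟨k, -, lam, hlam0, ρ, hρ, a, c, ha, -, hcov, hlam⟩ := hadm.exists_cover
  have hA1 : 0 < A := zero_lt_one.trans_le hA.one_le
  set D₀ := min (ρ / 2) (lam / (4 * A)) with hD₀
  have hD₀0 : 0 < D₀ := by positivity
  set c₁ := 2 * (1 + 2 / lam) with hc₁
  have hc₁0 : 0 < c₁ := by positivity
  refine ⟨c₁ + A * c₁ / D₀, by positivity, fun x ℓ μ n h s t ω hst hω => ?_⟩
  have hω0 : 0 ≤ ω := (norm_nonneg _).trans (hω s ⟨le_rfl, hst⟩)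
  set φ : ℝ≥0 → ℝ := fun u => ‖(x u : E d) - x s‖ with hφ
  have hφc : Continuous φ := by
    have : Continuous fun u => (x u : E d) := continuous_subtype_val.comp x.continuous
    fun_prop
  have hφs : φ s = 0 := by simp [hφ]
  have hclaim : ∀ τ ∈ Icc s t, (∀ u ∈ Icc s τ, φ u ≤ D₀) → ∀ u ∈ Icc s τ, φ u ≤ c₁ * ω := by
    intro τ hτ hle
    obtain ⟨u₁, hu₁, hmax⟩ := isCompact_Icc.exists_isMaxOn ⟨s, left_mem_Icc.2 hτ.1⟩
      (hφc.continuousOn (s := Icc s τ))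
    set D := φ u₁ with hD
    have hD0 : 0 ≤ D := norm_nonneg _
    have hDD₀ : D ≤ D₀ := hle u₁ hu₁
    have hsub : ∀ u ∈ Icc s u₁, φ u ≤ D := fun u hu => hmax ⟨hu.1, hu.2.trans hu₁.2⟩
    have hω' : ∀ u ∈ Icc s u₁, ‖((x u : E d) - ℓ u) - (x s - ℓ s)‖ ≤ ω :=
      fun u hu => hω u ⟨hu.1, hu.2.trans (hu₁.2.trans hτ.2)⟩
    have h1 := h.norm_sub_sq_le hA hu₁.1 hsub hω'
    have h2 := h.mul_measureReal_le ha hcov hlam hu₁.1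
      (hDD₀.trans (min_le_left _ _)) hsub
    have h3 : lam * ‖ℓ u₁ - ℓ s‖ ≤ 2 * (A * D ^ 2 + ω) := by
      rcases (norm_nonneg (ℓ u₁ - ℓ s)).eq_or_lt with h0 | h0
      · rw [← h0, mul_zero]; positivity
      · have h4 : lam * ‖ℓ u₁ - ℓ s‖ ^ 2 ≤ 2 * (A * D ^ 2 + ω) * ‖ℓ u₁ - ℓ s‖ :=
          calc lam * ‖ℓ u₁ - ℓ s‖ ^ 2 ≤ lam * (2 * (A * D ^ 2 + ω) * μ.real (Ioc s u₁)) := by gcongr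
            _ = 2 * (A * D ^ 2 + ω) * (lam * μ.real (Ioc s u₁)) := by ring
            _ ≤ _ := by gcongr
        rw [sq, ← mul_assoc] at h4
        exact le_of_mul_le_mul_right h4 h0
    have h4 : A * D ^ 2 ≤ lam / 4 * D := by
      have h5 : D ≤ lam / (4 * A) := hDD₀.trans (min_le_right _ _)
      rw [le_div_iff₀ (by positivity)] at h5
      nlinarith
    have h5 : D ≤ ω + ‖ℓ u₁ - ℓ s‖ := by
      have h6 := hω' u₁ ⟨hu₁.1, le_rfl⟩
      have h7 : (x u₁ : E d) - x s = (((x u₁ : E d) - ℓ u₁) - (x s - ℓ s)) + (ℓ u₁ - ℓ s) := by abel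
      have h8 := norm_add_le (((x u₁ : E d) - ℓ u₁) - (x s - ℓ s)) (ℓ u₁ - ℓ s)
      rw [← h7] at h8
      exact h8.trans (by gcongr)
    have h6 : lam * D ≤ (lam + 2) * ω + lam / 2 * D := by nlinarith
    have h7 : D ≤ c₁ * ω := by
      have : c₁ * ω = (2 * (lam + 2) * ω) / lam := by rw [hc₁]; field_simp
      rw [this, le_div_iff₀ hlam0]
      linarith
    exact fun u hu => (hmax hu).trans h7
  rcases lt_or_ge (c₁ * ω) D₀ with hlt | hge
  · have hsmall : ∀ u ∈ Icc s t, φ u ≤ D₀ := by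
      by_contra! hcon
      obtain ⟨u, hu, huD⟩ := hcon
      have hivt : ∀ v, s ≤ v → D₀ ≤ φ v → ∃ v' ∈ Icc s v, φ v' = D₀ := fun v hsv hv =>
        intermediate_value_Icc hsv hφc.continuousOn ⟨hφs ▸ hD₀0.le, hv⟩
      have hcomp : IsCompact (Icc s t ∩ φ ⁻¹' {D₀}) :=
        isCompact_Icc.inter_right (isClosed_singleton.preimage hφc)
      obtain ⟨v, hv, hvD⟩ := hivt u hu.1 huD.le
      obtain ⟨u₁, hu₁, hleast⟩ := hcomp.exists_isLeast ⟨v, ⟨hv.1, hv.2.trans hu.2⟩, hvD⟩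
      have h1 := hclaim u₁ hu₁.1 (fun v hv => ?_) u₁ ⟨hu₁.1.1, le_rfl⟩
      · rw [show φ u₁ = D₀ from hu₁.2] at h1
        linarith
      · by_contra! hgt
        obtain ⟨v', hv', hv'D⟩ := hivt v hv.1 hgt.le
        have h2 : u₁ ≤ v' := hleast ⟨⟨hv'.1, hv'.2.trans (hv.2.trans hu₁.1.2)⟩, hv'D⟩
        have h3 : v = v' := le_antisymm (hv.2.trans h2) hv'.2
        rw [h3, hv'D] at hgt
        exact lt_irrefl _ hgt
    have h1 := hclaim t ⟨hst, le_rfl⟩ hsmall t ⟨hst, le_rfl⟩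
    have h2 : 0 ≤ A * c₁ / D₀ * ω := by positivity
    rw [add_mul]
    linarith
  · have h1 : ‖(x t : E d) - x s‖ ≤ A := hA.diam _ (x t).2 _ (x s).2
    have h2 : A ≤ A * c₁ / D₀ * ω := by
      rw [div_mul_eq_mul_div, le_div_iff₀ hD₀0, mul_assoc]
      gcongr
    have h3 : 0 ≤ c₁ * ω := by positivity
    rw [add_mul]
    linarith

section Uniqueness

variable {σ : closure O → E r →L[ℝ] E d} {b : closure O → E d} {A : ℝ}

theorem IsReflectedSolution.driver_sub_eq (hA : IsControlled O σ b A) {x₀ : closure O} {N : ℕ}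
    {w : Path (E r)} {x : Path (closure O)} {ℓ : Path (E d)}
    (hx : IsReflectedSolution O σ b x₀ (dyadicInterp N w) x ℓ) (m : ℕ) {s t : ℝ≥0}
    (h₁ : m * mesh N ≤ s) (hst : s ≤ t) (h₂ : t ≤ (m + 1 : ℕ) * mesh N) :
    ((x t : E d) - ℓ t) - (x s - ℓ s)
      = ∫ u in (s : ℝ)..t, drift σ b (velocity N w m) (x u.toNNReal) := by
  have h3 := hA.integral_cell N w x m h₁ hst h₂
  have h4 := hA.intervalIntegrable_σ N w x 0 s
  have h5 := hA.intervalIntegrable_σ N w x 0 t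
  rw [NNReal.coe_zero] at h4 h5
  have hc : IntervalIntegrable (fun u : ℝ => σ (x u.toNNReal) (velocity N w m)) volume s t :=
    ((hA.continuous_σ.comp (x.continuous.comp continuous_real_toNNReal)).clm_apply
      continuous_const).intervalIntegrable _ _
  have h6 : ∫ u in (s : ℝ)..t, drift σ b (velocity N w m) (x u.toNNReal)
      = (∫ u in (s : ℝ)..t, σ (x u.toNNReal) (velocity N w m))
        + ∫ u in (s : ℝ)..t, b (x u.toNNReal) :=
    intervalIntegral.integral_add hc (hA.intervalIntegrable_b x s t)
  rw [h6, ← h3.2, ← intervalIntegral.integral_interval_sub_left h5 h4,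
    ← intervalIntegral.integral_interval_sub_left (hA.intervalIntegrable_b x 0 t)
      (hA.intervalIntegrable_b x 0 s), hx.equation t, hx.equation s]
  abel

/-- The difference of two solutions over a short time. -/
theorem IsReflectedSolution.norm_sub_sq_le (hA : IsControlled O σ b A) {x₀ : closure O} {N : ℕ}
    {w : Path (E r)} {x x' : Path (closure O)} {ℓ ℓ' : Path (E d)}
    (hx : IsReflectedSolution O σ b x₀ (dyadicInterp N w) x ℓ)
    (hx' : IsReflectedSolution O σ b x₀ (dyadicInterp N w) x' ℓ')
    {μ μ' : Measure ℝ≥0} {n n' : ℝ≥0 → E d} (h : IsReflection O x ℓ μ n)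
    (h' : IsReflection O x' ℓ' μ' n') (m : ℕ) {s t : ℝ≥0}
    (h₁ : m * mesh N ≤ s) (hst : s ≤ t) (h₂ : t ≤ (m + 1 : ℕ) * mesh N) {S : ℝ}
    (hS : ∀ u ∈ Icc s t, ‖(x u : E d) - x' u‖ ≤ S) :
    ‖(x t : E d) - x' t‖ ^ 2 ≤ ‖(x s : E d) - x' s‖ ^ 2
      + 2 * S ^ 2 * (A * (‖velocity N w m‖ + 1) * ((t : ℝ) - s)
        + A * (μ.real (Ioc s t) + μ'.real (Ioc s t))) := by
  have hA0 := hA.nonneg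
  have hS0 : 0 ≤ S := (norm_nonneg _).trans (hS s ⟨le_rfl, hst⟩)
  set B := A * (‖velocity N w m‖ + 1) with hB
  set Z : ℝ≥0 → E d := fun u => (x u : E d) - x' u with hZ
  have hZc : Continuous Z := (continuous_subtype_val.comp x.continuous).sub
    (continuous_subtype_val.comp x'.continuous)
  have hpt : ∀ᵐ u ∂μ, u ∈ Ioc s t → inner ℝ (Z u) (n u) ≤ A * S ^ 2 := by
    filter_upwards [h.mem_frontier, h.mem_normals] with u hu hn hus
    have h3 := hA.normal _ hu _ hn (x' u) (x' u).2
    have h4 : A * ‖(x' u : E d) - x u‖ ^ 2 ≤ A * S ^ 2 := by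
      rw [norm_sub_rev]; gcongr; exact hS u (Ioc_subset_Icc_self hus)
    rw [← neg_sub (x u : E d), inner_neg_left, norm_neg] at h3
    rw [norm_sub_rev] at h4
    simp only [hZ]
    linarith
  have hpt' : ∀ᵐ u ∂μ', u ∈ Ioc s t → inner ℝ (-Z u) (n' u) ≤ A * S ^ 2 := by
    filter_upwards [h'.mem_frontier, h'.mem_normals] with u hu hn hus
    have h3 := hA.normal _ hu _ hn (x u) (x u).2
    have h4 : A * ‖(x u : E d) - x' u‖ ^ 2 ≤ A * S ^ 2 := by
      gcongr; exact hS u (Ioc_subset_Icc_self hus)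
    simp only [hZ, inner_neg_left]
    linarith
  have key := le_of_forall_increment_le
    (g := fun u => ‖Z u‖ ^ 2 - 2 * S ^ 2 * (B * u + A * (μ.real (Ioc s u) + μ'.real (Ioc s u))))
    (a := fun u => 2 * (μ.real (Ioc s u) + μ'.real (Ioc s u))) hst fun ε hε => ?_
  · simp only [Ioc_self, measureReal_empty] at key
    simp only [hZ] at key
    linarith
  · have huc := isCompact_Icc.uniformContinuousOn_of_continuous (s := Icc s t) hZc.continuousOn
    obtain ⟨δ, hδ, hδ'⟩ := Metric.uniformContinuousOn_iff.1 huc ε hε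
    refine ⟨δ, hδ, fun u v hsu huv hvt huvδ => ?_⟩
    have h3 := norm_sq_sub_norm_sq_le (Z v) (Z u)
    have hnear : ∀ y ∈ Ioc u v, ‖Z v - Z y‖ ≤ ε := fun y hy => by
      rw [← dist_eq_norm]
      refine (hδ' v ⟨hsu.trans huv, hvt⟩ y ⟨hsu.trans hy.1.le, hy.2.trans hvt⟩ ?_).le
      rw [NNReal.dist_eq, abs_of_nonneg (sub_nonneg.2 (by exact_mod_cast hy.2))]
      have : (u : ℝ) ≤ y := by exact_mod_cast hy.1.le
      linarith
    have h4 : inner ℝ (Z v) (ℓ v - ℓ u) ≤ (A * S ^ 2 + ε) * μ.real (Ioc u v) := by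
      refine h.inner_sub_le huv ?_
      filter_upwards [hpt, h.mem_normals] with y hy hn hyu
      have h5 := hy ⟨hsu.trans_lt hyu.1, hyu.2.trans hvt⟩
      have h6 := real_inner_le_norm (Z v - Z y) (n y)
      rw [hn.1, mul_one, inner_sub_left] at h6
      linarith [hnear y hyu]
    have h4' : inner ℝ (-Z v) (ℓ' v - ℓ' u) ≤ (A * S ^ 2 + ε) * μ'.real (Ioc u v) := by
      refine h'.inner_sub_le huv ?_
      filter_upwards [hpt', h'.mem_normals] with y hy hn hyu
      have h5 := hy ⟨hsu.trans_lt hyu.1, hyu.2.trans hvt⟩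
      have h6 := (neg_le_abs _).trans (abs_real_inner_le_norm (Z v - Z y) (n' y))
      rw [hn.1, mul_one, inner_sub_left] at h6
      rw [inner_neg_left] at h5 ⊢
      linarith [hnear y hyu]
    have huv' : (u : ℝ) ≤ v := by exact_mod_cast huv
    have h7 := hx.driver_sub_eq hA m (h₁.trans hsu) huv (hvt.trans h₂)
    have h7' := hx'.driver_sub_eq hA m (h₁.trans hsu) huv (hvt.trans h₂)
    have hc : ∀ x : Path (closure O), IntervalIntegrable (fun y : ℝ =>
        drift σ b (velocity N w m) (x y.toNNReal)) volume u v := fun x =>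
      (hA.continuous_drift.comp (continuous_const.prodMk
        (x.continuous.comp continuous_real_toNNReal))).intervalIntegrable _ _
    have h8 : ‖(∫ y in (u : ℝ)..v, drift σ b (velocity N w m) (x y.toNNReal))
        - ∫ y in (u : ℝ)..v, drift σ b (velocity N w m) (x' y.toNNReal)‖ ≤ B * S * (v - u) := by
      rw [← intervalIntegral.integral_sub (hc x) (hc x')]
      refine (intervalIntegral.norm_integral_le_of_norm_le_const (C := B * S)
        fun y hy => ?_).trans_eq (by rw [abs_of_nonneg (sub_nonneg.2 huv')])
      rw [uIoc_of_le huv'] at hy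
      refine (hA.norm_drift_sub_le _ _ _).trans ?_
      rw [← hB]
      gcongr
      exact hS _ ⟨hsu.trans (NNReal.le_toNNReal_of_coe_le hy.1.le),
        (Real.toNNReal_le_iff_le_coe.2 hy.2).trans hvt⟩
    rw [← h7, ← h7'] at h8
    have h9 : Z v - Z u = (((x v : E d) - ℓ v) - (x u - ℓ u) - (((x' v : E d) - ℓ' v)
        - (x' u - ℓ' u))) + (ℓ v - ℓ u) - (ℓ' v - ℓ' u) := by simp only [hZ]; abel
    have h10 := real_inner_le_norm (Z v) (((x v : E d) - ℓ v) - (x u - ℓ u)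
      - (((x' v : E d) - ℓ' v) - (x' u - ℓ' u)))
    have h11 : ‖Z v‖ * ‖((x v : E d) - ℓ v) - (x u - ℓ u)
        - (((x' v : E d) - ℓ' v) - (x' u - ℓ' u))‖ ≤ S * (B * S * (v - u)) :=
      mul_le_mul (hS v ⟨hsu.trans huv, hvt⟩) h8 (norm_nonneg _) hS0
    rw [inner_neg_left] at h4'
    rw [h9, inner_sub_right, inner_add_right] at h3
    simp only [h.measureReal_add hsu huv, h'.measureReal_add hsu huv]
    linarith

theorem IsReflection.exists_gt_measureReal_lt {x : Path (closure O)} {ℓ : Path (E d)}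
    {μ : Measure ℝ≥0} {n : ℝ≥0 → E d} (h : IsReflection O x ℓ μ n) (s : ℝ≥0) {ε : ℝ} (hε : 0 < ε) :
    ∀ᶠ t in 𝓝[>] s, μ.real (Ioc s t) < ε := by
  have h1 : Tendsto (fun k : ℕ => μ (Ioc s (s + 1 / (k + 1)))) atTop
      (𝓝 (μ (⋂ k : ℕ, Ioc s (s + 1 / (k + 1))))) := by
    refine tendsto_measure_iInter_atTop (fun k => measurableSet_Ioc.nullMeasurableSet)
      (fun i j hij => Ioc_subset_Ioc_right (by gcongr)) ⟨0, h.finite_Ioc _ _⟩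
  have h2 : ⋂ k : ℕ, Ioc s (s + 1 / ((k : ℝ≥0) + 1)) = ∅ := by
    refine eq_empty_of_forall_notMem fun u hu => ?_
    rw [mem_iInter] at hu
    have hsu := (hu 0).1
    obtain ⟨k, hk⟩ := exists_nat_one_div_lt (K := ℝ≥0) (tsub_pos_of_lt hsu)
    have h3 := (hu k).2
    have h4 : s + 1 / ((k : ℝ≥0) + 1) < u := by
      rw [← add_tsub_cancel_of_le hsu.le]
      gcongr
    exact absurd h3 (not_le.2 h4)
  rw [h2, measure_empty] at h1
  obtain ⟨k, hk⟩ := (h1.eventually (gt_mem_nhds (ENNReal.ofReal_pos.2 hε))).exists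
  filter_upwards [Ioo_mem_nhdsGT (show s < s + 1 / ((k : ℝ≥0) + 1) by simp)] with t ht
  rw [measureReal_def, ← ENNReal.toReal_ofReal hε.le]
  refine (ENNReal.toReal_lt_toReal (h.finite_Ioc _ _) ENNReal.ofReal_ne_top).2 ?_
  exact (measure_mono (Ioc_subset_Ioc_right ht.2.le)).trans_lt hk

theorem IsReflectedSolution.unique (hA : IsControlled O σ b A) {x₀ : closure O} {N : ℕ}
    {w : Path (E r)} {x x' : Path (closure O)} {ℓ ℓ' : Path (E d)}
    (hx : IsReflectedSolution O σ b x₀ (dyadicInterp N w) x ℓ)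
    (hx' : IsReflectedSolution O σ b x₀ (dyadicInterp N w) x' ℓ') : x = x' ∧ ℓ = ℓ' := by
  have hA1 : 0 < A := zero_lt_one.trans_le hA.one_le
  obtain ⟨μ, n, h⟩ := hx.exists_isReflection
  obtain ⟨μ', n', h'⟩ := hx'.exists_isReflection
  have hZc : Continuous fun u => (x u : E d) - x' u := (continuous_subtype_val.comp
    x.continuous).sub (continuous_subtype_val.comp x'.continuous)
  have hzero : ∀ {x : Path (closure O)} {ℓ : Path (E d)} {μ n},
      IsReflectedSolution O σ b x₀ (dyadicInterp N w) x ℓ → IsReflection O x ℓ μ n →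
      (x 0 : E d) = x₀ := fun hx h => by
    have := hx.equation 0
    rw [h.zero] at this
    simpa using this
  have hxx : ∀ t, (x t : E d) - x' t = 0 := by
    intro t
    have hsub : Icc 0 t ⊆ {u | (x u : E d) - x' u = 0} := by
      refine IsClosed.Icc_subset_of_forall_mem_nhdsWithin
        ((isClosed_eq hZc continuous_const).inter isClosed_Icc) ?_ ?_
      · simp only [mem_ofPred_eq]
        rw [hzero hx h, hzero hx' h', sub_self]
      · rintro s ⟨hs, -⟩
        set m := ⌊s / mesh N⌋₊
        have h₁ : m * mesh N ≤ s := by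
          rw [← le_div_iff₀ (mesh_pos N)]; exact Nat.floor_le zero_le
        have h₂ : s < (m + 1 : ℕ) * mesh N := by
          rw [← div_lt_iff₀ (mesh_pos N)]; exact_mod_cast Nat.lt_floor_add_one _
        set B := A * (‖velocity N w m‖ + 1) with hB
        have hB0 : 0 < B := by positivity
        have hev : ∀ᶠ t in 𝓝[>] s, t < (m + 1 : ℕ) * mesh N ∧ μ.real (Ioc s t) < 1 / (12 * A) ∧
            μ'.real (Ioc s t) < 1 / (12 * A) ∧ (t : ℝ) - s < 1 / (12 * B) ∧ s < t := by
          have hev1 : ∀ᶠ t : ℝ≥0 in 𝓝[>] s, (t : ℝ) - s < 1 / (12 * B) := by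
            have hc : Continuous fun t : ℝ≥0 => (t : ℝ) - s := by fun_prop
            refine ((hc.tendsto s).mono_left nhdsWithin_le_nhds).eventually (gt_mem_nhds ?_)
            rw [sub_self]; positivity
          filter_upwards [mem_nhdsWithin_of_mem_nhds (gt_mem_nhds h₂),
            h.exists_gt_measureReal_lt s (ε := 1 / (12 * A)) (by positivity),
            h'.exists_gt_measureReal_lt s (ε := 1 / (12 * A)) (by positivity),
            hev1, self_mem_nhdsWithin] with t h1 h2 h3 h4 h5 using ⟨h1, h2, h3, h4, h5⟩
        obtain ⟨T, hT1, hT2, hT3, hT4, hT5⟩ := hev.exists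
        filter_upwards [Ioo_mem_nhdsGT hT5] with t' ht'
        obtain ⟨u₁, hu₁, hmax⟩ := isCompact_Icc.exists_isMaxOn ⟨s, left_mem_Icc.2 hT5.le⟩
          (hZc.norm.continuousOn (s := Icc s T))
        have h3 := hx.norm_sub_sq_le hA hx' h h' m h₁ hu₁.1 (hu₁.2.trans hT1.le)
          (fun u hu => hmax ⟨hu.1, hu.2.trans hu₁.2⟩)
        have hs' : (x s : E d) - x' s = 0 := hs
        rw [hs', norm_zero, ← hB] at h3
        have hmono : ∀ (ν : Measure ℝ≥0), ν (Ioc s T) ≠ ∞ →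
            ν.real (Ioc s u₁) ≤ ν.real (Ioc s T) := fun ν hν =>
          measureReal_mono (Ioc_subset_Ioc_right hu₁.2) hν
        have e1 : A * μ.real (Ioc s u₁) ≤ 1 / 12 := by
          have := (hmono μ (h.finite_Ioc _ _)).trans hT2.le
          rw [le_div_iff₀ (by positivity)] at this
          linarith
        have e2 : A * μ'.real (Ioc s u₁) ≤ 1 / 12 := by
          have := (hmono μ' (h'.finite_Ioc _ _)).trans hT3.le
          rw [le_div_iff₀ (by positivity)] at this
          linarith
        have e3 : B * ((u₁ : ℝ) - s) ≤ 1 / 12 := by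
          have hu : (u₁ : ℝ) ≤ T := by exact_mod_cast hu₁.2
          rw [lt_div_iff₀ (by positivity)] at hT4
          nlinarith
        have h4 : ‖(x u₁ : E d) - x' u₁‖ ^ 2 ≤ 0 := by
          nlinarith [sq_nonneg ‖(x u₁ : E d) - x' u₁‖]
        have h5 : ‖(x u₁ : E d) - x' u₁‖ = 0 := by
          exact pow_eq_zero_iff two_ne_zero |>.1 (le_antisymm h4 (sq_nonneg _))
        have h6 := hmax ⟨ht'.1.le, ht'.2.le⟩
        simp only [mem_ofPred_eq] at h6 ⊢
        rw [h5] at h6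
        exact norm_le_zero_iff.1 h6
    exact hsub ⟨zero_le, le_rfl⟩
  have hxeq : x = x' := by
    ext t
    exact congrArg (fun v : E d => v _) (sub_eq_zero.1 (hxx t))
  subst hxeq
  refine ⟨rfl, ?_⟩
  ext1 t
  have h1 := hx.equation t
  rw [hx'.equation t] at h1
  exact (add_left_cancel h1).symm

end Uniqueness

end ReflectedSDE

namespace ReflectedSDE

open Filter Topology

section GaussianWalk

variable {r : ℕ} {Ω : Type*} {mΩ : MeasurableSpace Ω}

/-- `ξ` is a sequence of centred Gaussian vectors with covariance `h • 1`, each of which is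
independent of the past, as described by the filtration `G`. -/
structure IsGaussianWalk (P : Measure Ω) (h : ℝ) (G : ℕ → MeasurableSpace Ω)
    (ξ : ℕ → Ω → E r) : Prop where
  le : ∀ m, G m ≤ mΩ
  mono : Monotone G
  measurable : ∀ m, Measurable[G (m + 1)] (ξ m)
  indep : ∀ m, Indep (G m) (MeasurableSpace.comap (ξ m) inferInstance) P
  lintegral_exp : ∀ m (a : E r), ∫⁻ ω, ENNReal.ofReal (Real.exp (inner ℝ a (ξ m ω))) ∂P
    = ENNReal.ofReal (Real.exp (h * ‖a‖ ^ 2 / 2))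

variable {P : Measure Ω} {h : ℝ} {G : ℕ → MeasurableSpace Ω}
  {ξ : ℕ → Ω → E r}

namespace IsGaussianWalk

theorem measurable' (hξ : IsGaussianWalk P h G ξ) (m : ℕ) : Measurable (ξ m) :=
  (hξ.measurable m).mono (hξ.le _) le_rfl

theorem measurable_sum (hξ : IsGaussianWalk P h G ξ) {U : ℕ → Ω → E r}
    (hU : ∀ m, Measurable[G m] (U m)) (i n : ℕ) :
    Measurable[G (i + n)] fun ω => ∑ m ∈ Finset.range n, inner ℝ (U (i + m) ω) (ξ (i + m) ω) := by
  refine Finset.measurable_fun_sum _ fun m hm => ?_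
  have hm' : m < n := Finset.mem_range.1 hm
  exact ((hU (i + m)).mono (hξ.mono (by omega)) le_rfl).inner
    ((hξ.measurable (i + m)).mono (hξ.mono (by omega)) le_rfl)

variable [IsProbabilityMeasure P]

theorem lintegral_exp_add_le (hξ : IsGaussianWalk P h G ξ) (hh : 0 ≤ h) {m : ℕ} {S : Ω → ℝ}
    {U : Ω → E r} {c : ℝ} (hS : Measurable[G m] S) (hU : Measurable[G m] U) (hc : ∀ ω, ‖U ω‖ ≤ c) :
    ∫⁻ ω, ENNReal.ofReal (Real.exp (S ω + inner ℝ (U ω) (ξ m ω))) ∂P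
      ≤ ENNReal.ofReal (Real.exp (h * c ^ 2 / 2)) * ∫⁻ ω, ENNReal.ofReal (Real.exp (S ω)) ∂P := by
  have hV : Measurable[G m] fun ω => (S ω, U ω) := hS.prodMk hU
  have hV' : Measurable fun ω => (S ω, U ω) := hV.mono (hξ.le m) le_rfl
  have hind : IndepFun (fun ω => (S ω, U ω)) (ξ m) P := by
    rw [IndepFun_iff_Indep]
    exact indep_of_indep_of_le_left (hξ.indep m) hV.comap_le
  have hmap := (indepFun_iff_map_prod_eq_prod_map_map hV'.aemeasurable
    (hξ.measurable' m).aemeasurable).1 hind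
  have hF : Measurable fun p : (ℝ × E r) × E r =>
      ENNReal.ofReal (Real.exp (p.1.1 + inner ℝ p.1.2 p.2)) := by fun_prop
  have h1 : ∫⁻ ω, ENNReal.ofReal (Real.exp (S ω + inner ℝ (U ω) (ξ m ω))) ∂P
      = ∫⁻ p, ENNReal.ofReal (Real.exp (p.1.1 + inner ℝ p.1.2 p.2))
        ∂(P.map fun ω => ((S ω, U ω), ξ m ω)) :=
    (lintegral_map hF (hV'.prodMk (hξ.measurable' m))).symm
  have : SFinite (P.map (ξ m)) := inferInstance
  rw [h1, hmap, lintegral_prod _ hF.aemeasurable, lintegral_map hF.lintegral_prod_right' hV',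
    ← lintegral_const_mul' _ _ ENNReal.ofReal_ne_top]
  refine lintegral_mono fun ω => ?_
  dsimp only
  rw [lintegral_map (by fun_prop) (hξ.measurable' m)]
  simp_rw [Real.exp_add, ENNReal.ofReal_mul (Real.exp_pos _).le]
  rw [lintegral_const_mul' _ _ ENNReal.ofReal_ne_top, hξ.lintegral_exp, mul_comm]
  gcongr
  exact hc ω

theorem lintegral_exp_sum_le (hξ : IsGaussianWalk P h G ξ) (hh : 0 ≤ h) {U : ℕ → Ω → E r} {c : ℝ}
    (hU : ∀ m, Measurable[G m] (U m)) (hc : ∀ m ω, ‖U m ω‖ ≤ c) (i n : ℕ) :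
    ∫⁻ ω, ENNReal.ofReal (Real.exp (∑ m ∈ Finset.range n, inner ℝ (U (i + m) ω) (ξ (i + m) ω))) ∂P
      ≤ ENNReal.ofReal (Real.exp (n * h * c ^ 2 / 2)) := by
  induction n with
  | zero => simp
  | succ n ih =>
    simp_rw [Finset.sum_range_succ]
    refine (hξ.lintegral_exp_add_le hh (hξ.measurable_sum hU i n) (hU _) (hc _)).trans ?_
    refine (mul_le_mul_right ih _).trans ?_
    rw [← ENNReal.ofReal_mul (Real.exp_pos _).le, ← Real.exp_add]
    refine le_of_eq ?_
    congr 2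
    push_cast
    ring

theorem eLpNorm_sum_inner_le (hξ : IsGaussianWalk P h G ξ) (hh : 0 < h) {U : ℕ → Ω → E r} {c : ℝ}
    (hU : ∀ m, Measurable[G m] (U m)) (hc : ∀ m ω, ‖U m ω‖ ≤ c) (i n : ℕ) {q : ℕ} (hq : q ≠ 0) :
    eLpNorm (fun ω => ∑ m ∈ Finset.range n, inner ℝ (U (i + m) ω) (ξ (i + m) ω)) q P
      ≤ ENNReal.ofReal (2 * q.factorial * Real.exp (c ^ 2 / 2) * √(n * h)) := by
  rcases Nat.eq_zero_or_pos n with rfl | hn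
  · simp
  set M : Ω → ℝ := fun ω => ∑ m ∈ Finset.range n, inner ℝ (U (i + m) ω) (ξ (i + m) ω)
  set θ : ℝ := √(n * h)
  have hθ : 0 < θ := by positivity
  have hθ2 : n * h = θ ^ 2 := (Real.sq_sqrt (by positivity)).symm
  have hM : Measurable M := (hξ.measurable_sum hU i n).mono (hξ.le _) le_rfl
  have key : ∀ ε : ℝ, |ε| = 1 → ∫⁻ ω, ENNReal.ofReal (Real.exp (ε * M ω / θ)) ∂P
      ≤ ENNReal.ofReal (Real.exp (c ^ 2 / 2)) := by
    intro ε hε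
    have h1 := hξ.lintegral_exp_sum_le hh.le (U := fun m ω => (ε / θ) • U m ω) (c := c / θ)
      (fun m => (hU m).const_smul (ε / θ)) (fun m ω => by
        rw [norm_smul, norm_div, Real.norm_eq_abs, hε, Real.norm_of_nonneg hθ.le, div_mul_eq_mul_div,
          one_mul]
        exact div_le_div_of_nonneg_right (hc m ω) hθ.le) i n
    have h2 : n * h * (c / θ) ^ 2 / 2 = c ^ 2 / 2 := by rw [hθ2]; field_simp
    rw [h2] at h1
    refine le_trans (le_of_eq ?_) h1
    congr 1
    ext ω
    congr 2
    simp only [M, inner_smul_left, ← Finset.mul_sum]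
    simp
    ring
  have hpt : ∀ ω, ‖M ω‖ₑ ^ (q : ℝ) ≤ ENNReal.ofReal (θ ^ q * q.factorial)
      * (ENNReal.ofReal (Real.exp (1 * M ω / θ)) + ENNReal.ofReal (Real.exp ((-1) * M ω / θ))) := by
    intro ω
    rw [← ENNReal.ofReal_add (by positivity) (by positivity), ← ENNReal.ofReal_mul (by positivity),
      ENNReal.rpow_natCast, ← ofReal_norm, ← ENNReal.ofReal_pow (norm_nonneg _)]
    refine ENNReal.ofReal_le_ofReal ?_
    have h1 := Real.pow_div_factorial_le_exp (|M ω| / θ) (by positivity) q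
    have h2 : Real.exp (|M ω| / θ) ≤ Real.exp (1 * M ω / θ) + Real.exp ((-1) * M ω / θ) := by
      rcases abs_cases (M ω) with ⟨h3, -⟩ | ⟨h3, -⟩ <;> rw [h3]
      · rw [one_mul]; linarith [Real.exp_pos ((-1) * M ω / θ)]
      · rw [neg_one_mul]; linarith [Real.exp_pos (1 * M ω / θ)]
    have h3 := h1.trans h2
    rw [div_le_iff₀ (by positivity), div_pow, div_le_iff₀ (by positivity)] at h3
    rw [Real.norm_eq_abs]
    linarith
  have hint : ∫⁻ ω, ‖M ω‖ₑ ^ (q : ℝ) ∂P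
      ≤ ENNReal.ofReal ((2 * q.factorial * Real.exp (c ^ 2 / 2) * θ) ^ q) := by
    refine (lintegral_mono hpt).trans ?_
    rw [lintegral_const_mul' _ _ ENNReal.ofReal_ne_top, lintegral_add_left (by fun_prop)]
    refine (mul_le_mul_right (add_le_add (key 1 (by simp)) (key (-1) (by simp))) _).trans ?_
    rw [← ENNReal.ofReal_add (by positivity) (by positivity), ← ENNReal.ofReal_mul (by positivity)]
    refine ENNReal.ofReal_le_ofReal ?_
    rw [mul_pow]
    have h4 : (1 : ℝ) ≤ q.factorial := by exact_mod_cast Nat.one_le_iff_ne_zero.2 q.factorial_ne_zero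
    have h5 : (1 : ℝ) ≤ Real.exp (c ^ 2 / 2) := Real.one_le_exp (by positivity)
    have h6 : 2 * q.factorial * Real.exp (c ^ 2 / 2)
        ≤ (2 * q.factorial * Real.exp (c ^ 2 / 2)) ^ q := by
      refine le_self_pow₀ ?_ hq
      nlinarith
    have h7 : 0 ≤ θ ^ q := by positivity
    nlinarith [mul_le_mul_of_nonneg_right h6 h7]
  have hq0 : (q : ℝ≥0∞) ≠ 0 := by exact_mod_cast hq
  rw [eLpNorm_eq_lintegral_rpow_enorm_toReal hq0 (ENNReal.natCast_ne_top q), ENNReal.toReal_natCast]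
  refine (ENNReal.rpow_le_rpow hint (by positivity)).trans (le_of_eq ?_)
  rw [ENNReal.ofReal_pow (by positivity), ← ENNReal.rpow_natCast, ← ENNReal.rpow_mul,
    mul_one_div_cancel (by exact_mod_cast hq), ENNReal.rpow_one]

end IsGaussianWalk

end GaussianWalk

section Wiener

variable {r : ℕ}

/-- The `σ`-algebra of the increments of the path over the first `m` dyadic intervals. -/
@[reducible]
noncomputable def dyadicPast (r N m : ℕ) : MeasurableSpace (Path (E r)) :=
  ⨆ k < m, MeasurableSpace.comap (fun w => dyadicIncrement N w k) inferInstance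

theorem measurable_dyadicIncrement (N : ℕ) {k m : ℕ} (hk : k < m) :
    Measurable[dyadicPast r N m] fun w => dyadicIncrement N w k :=
  (comap_measurable _).mono (le_iSup₂_of_le k hk le_rfl) le_rfl

theorem IsWienerMeasure.iIndepFun_coord {𝕎 : Measure (Path (E r))} (h𝕎 : IsWienerMeasure 𝕎)
    (N : ℕ) : iIndepFun (fun (p : Fin r × ℕ) w => dyadicIncrement N w p.2 p.1) 𝕎 := by
  refine iIndepFun_uncurry' (X := fun (i : Fin r) (m : ℕ) (w : Path (E r)) =>
    dyadicIncrement N w m i) (fun i m => ?_) ?_ fun i => ?_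
  · exact (EuclideanSpace.proj (𝕜 := ℝ) i).continuous.measurable.comp
      (continuous_dyadicIncrement N m).measurable
  · refine (h𝕎.indep.comp (fun i (f : ℝ≥0 → ℝ) (m : ℕ) =>
      f ((m + 1 : ℕ) * mesh N) - f (m * mesh N)) fun i => by fun_prop)
  · refine (h𝕎.isBrownian i).toIsPreBrownianReal.hasIndepIncrements.nat
      (t := fun m : ℕ => (m : ℝ≥0) * mesh N) fun m n hmn => ?_
    dsimp only
    gcongr

theorem IsWienerMeasure.map_coord {𝕎 : Measure (Path (E r))} (h𝕎 : IsWienerMeasure 𝕎)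
    (N m : ℕ) (i : Fin r) :
    𝕎.map (fun w => dyadicIncrement N w m i) = gaussianReal 0 (mesh N) := by
  have h1 := ((h𝕎.isBrownian i).toIsPreBrownianReal.hasLaw_sub ((m + 1 : ℕ) * mesh N)
    (m * mesh N)).map_eq
  have h2 : nndist (((m + 1 : ℕ) * mesh N : ℝ≥0) : ℝ) ((m * mesh N : ℝ≥0) : ℝ) = mesh N := by
    ext
    rw [coe_nndist, Real.dist_eq]
    push_cast
    rw [add_mul, one_mul, add_sub_cancel_left, abs_of_nonneg (NNReal.coe_nonneg _)]
  rw [← h2]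
  exact h1

theorem comap_le_iSup_comap_coord {Ω : Type*} (f : Ω → E r) :
    MeasurableSpace.comap f inferInstance
      ≤ ⨆ i, MeasurableSpace.comap (fun ω => f ω i) inferInstance := by
  let _ : MeasurableSpace Ω := ⨆ i, MeasurableSpace.comap (fun ω => f ω i) inferInstance
  have h1 : Measurable fun ω i => f ω i := measurable_pi_iff.2 fun i =>
    (comap_measurable _).mono (le_iSup (fun i => MeasurableSpace.comap (fun ω => f ω i) _) i) le_rfl
  exact ((WithLp.measurable_toLp 2 (Fin r → ℝ)).comp h1).comap_le

theorem measurable_dyadicIncrement_coord (N m : ℕ) (i : Fin r) :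
    Measurable fun w : Path (E r) => dyadicIncrement N w m i :=
  (EuclideanSpace.proj (𝕜 := ℝ) i).continuous.measurable.comp
    (continuous_dyadicIncrement N m).measurable

theorem indep_iSup_lt_of_iIndep_prod {Ω ι : Type*} {mΩ : MeasurableSpace Ω} {P : Measure Ω}
    {𝓜 : ι × ℕ → MeasurableSpace Ω} (hle : ∀ p, 𝓜 p ≤ mΩ) (hind : iIndep 𝓜 P)
    {𝓗 : ℕ → MeasurableSpace Ω} (hN : ∀ k, 𝓗 k ≤ ⨆ i, 𝓜 (i, k)) (m : ℕ) :
    Indep (⨆ k < m, 𝓗 k) (𝓗 m) P := by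
  have h1 := indep_iSup_of_disjoint hle hind (S := {p : ι × ℕ | p.2 < m})
    (T := {p : ι × ℕ | p.2 = m}) (Set.disjoint_left.2 fun p hp hp' => (ne_of_lt hp) hp')
  have h2 : 𝓗 m ≤ ⨆ p ∈ {p : ι × ℕ | p.2 = m}, 𝓜 p := (hN m).trans (iSup_le fun i =>
    le_iSup₂ (f := fun p (_ : p ∈ {p : ι × ℕ | p.2 = m}) => 𝓜 p) (i, m) rfl)
  have h3 : ⨆ k < m, 𝓗 k ≤ ⨆ p ∈ {p : ι × ℕ | p.2 < m}, 𝓜 p :=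
    iSup₂_le fun k hk => (hN k).trans (iSup_le fun i =>
      le_iSup₂ (f := fun p (_ : p ∈ {p : ι × ℕ | p.2 < m}) => 𝓜 p) (i, k) hk)
  exact indep_of_indep_of_le_left (indep_of_indep_of_le_right h1 h2) h3

theorem IsWienerMeasure.lintegral_exp_inner {𝕎 : Measure (Path (E r))} (h𝕎 : IsWienerMeasure 𝕎)
    (N m : ℕ) (a : E r) :
    ∫⁻ w, ENNReal.ofReal (Real.exp (inner ℝ a (dyadicIncrement N w m))) ∂𝕎
      = ENNReal.ofReal (Real.exp (mesh N * ‖a‖ ^ 2 / 2)) := by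
  have hprob := h𝕎.isProbabilityMeasure
  have hind : iIndepFun (fun (i : Fin r) w => a i * dyadicIncrement N w m i) 𝕎 :=
    ((h𝕎.iIndepFun_coord N).precomp (g := fun i : Fin r => (i, m))
      (fun i j hij => congrArg Prod.fst hij)).comp (fun i x => a i * x) fun i => by fun_prop
  have hm : ∀ i : Fin r, Measurable fun w : Path (E r) => a i * dyadicIncrement N w m i :=
    fun i => (measurable_dyadicIncrement_coord N m i).const_mul _
  have hint : ∀ i : Fin r, Integrable
      (fun w : Path (E r) => Real.exp (1 * (a i * dyadicIncrement N w m i))) 𝕎 := by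
    intro i
    have := integrable_exp_mul_gaussianReal (μ := 0) (v := mesh N) (a i)
    rw [← h𝕎.map_coord N m i, integrable_map_measure (by fun_prop) (measurable_dyadicIncrement_coord N m i).aemeasurable] at this
    simpa [Function.comp_def] using this
  have hinner : ∀ w : Path (E r), inner ℝ a (dyadicIncrement N w m)
      = 1 * (∑ i, fun w : Path (E r) => a i * dyadicIncrement N w m i) w := by
    intro w
    simp [PiLp.inner_apply, mul_comm]
  simp_rw [hinner]
  rw [← ofReal_integral_eq_lintegral_ofReal (hind.integrable_exp_mul_sum hm fun i _ => hint i)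
    (ae_of_all _ fun w => (Real.exp_pos _).le)]
  congr 1
  have h1 := hind.mgf_sum hm Finset.univ (t := 1)
  rw [mgf] at h1
  rw [h1]
  have h2 : ∀ i : Fin r, mgf (fun w : Path (E r) => a i * dyadicIncrement N w m i) 𝕎 1
      = Real.exp (mesh N * a i ^ 2 / 2) := by
    intro i
    have := mgf_gaussianReal (h𝕎.map_coord N m i) (a i)
    rw [zero_mul, zero_add] at this
    rw [← this, mgf, mgf]
    simp
  simp_rw [h2]
  rw [← Real.exp_sum, EuclideanSpace.norm_sq_eq, Finset.mul_sum, Finset.sum_div]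
  simp

theorem IsWienerMeasure.isGaussianWalk {𝕎 : Measure (Path (E r))} (h𝕎 : IsWienerMeasure 𝕎)
    (N : ℕ) : IsGaussianWalk 𝕎 (mesh N) (dyadicPast r N) fun m w => dyadicIncrement N w m :=
  ⟨fun _ => iSup₂_le fun k _ => (continuous_dyadicIncrement N k).measurable.comap_le,
    fun _ _ hmn => iSup₂_le fun k hk => le_iSup₂_of_le k (hk.trans_le hmn) le_rfl,
    fun m => measurable_dyadicIncrement N m.lt_succ_self, 
    indep_iSup_lt_of_iIndep_prod (fun p => (measurable_dyadicIncrement_coord N p.2 p.1).comap_le)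
      (h𝕎.iIndepFun_coord N).iIndep fun _ => comap_le_iSup_comap_coord _,
    h𝕎.lintegral_exp_inner N⟩

end Wiener

end ReflectedSDE

namespace ReflectedSDE

open Filter Topology

section Moments

variable {r n : ℕ} {Ω : Type*} {mΩ : MeasurableSpace Ω}

theorem norm_le_sum_abs_coord (x : E n) : ‖x‖ ≤ ∑ i, |x i| := by
  rw [EuclideanSpace.norm_eq]
  refine Real.sqrt_le_iff.2 ⟨by positivity, ?_⟩
  simp only [Real.norm_eq_abs]
  exact Finset.sum_sq_le_sq_sum_of_nonneg fun i _ => abs_nonneg _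

/-- A bound for the `q`-th moments of sums of bounded multiples of standard Gaussian variables. -/
noncomputable def gaussianMoment (q : ℕ) (c : ℝ) : ℝ := 2 * q.factorial * Real.exp (c ^ 2 / 2)

theorem gaussianMoment_nonneg (q : ℕ) (c : ℝ) : 0 ≤ gaussianMoment q c := by
  unfold gaussianMoment; positivity

namespace IsGaussianWalk

variable {P : Measure Ω} [IsProbabilityMeasure P] {h : ℝ} {G : ℕ → MeasurableSpace Ω}
  {ξ : ℕ → Ω → E r}

theorem eLpNorm_step_le (hξ : IsGaussianWalk P h G ξ) (hh : 0 < h) (m : ℕ) {q : ℕ} (hq : q ≠ 0) :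
    eLpNorm (ξ m) q P ≤ ENNReal.ofReal (r * gaussianMoment q 1 * √h) := by
  have h1 : ∀ i : Fin r, eLpNorm (fun ω => |ξ m ω i|) q P
      ≤ ENNReal.ofReal (gaussianMoment q 1 * √h) := by
    intro i
    have := hξ.eLpNorm_sum_inner_le hh (U := fun _ _ => EuclideanSpace.single i (1 : ℝ)) (c := 1)
      (fun _ => measurable_const) (fun _ _ => by simp) m 1 hq
    simp only [Finset.range_one, Finset.sum_singleton, add_zero, EuclideanSpace.inner_single_left,
      map_one, one_mul, Nat.cast_one] at this
    refine le_trans (le_of_eq ?_) this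
    exact eLpNorm_norm (fun ω => ξ m ω i)
  refine (eLpNorm_mono_real fun ω => norm_le_sum_abs_coord (ξ m ω)).trans ?_
  have h2 := eLpNorm_sum_le (μ := P) (p := q) (s := Finset.univ)
    (f := fun (i : Fin r) ω => |ξ m ω i|) (fun i _ => by
      have := hξ.measurable' m
      exact (by fun_prop : Measurable fun ω => |ξ m ω i|).aestronglyMeasurable)
    (by exact_mod_cast Nat.one_le_iff_ne_zero.2 hq)
  rw [Finset.sum_fn] at h2
  refine h2.trans ((Finset.sum_le_sum fun i _ => h1 i).trans (le_of_eq ?_))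
  rw [Finset.sum_const, Finset.card_univ, Fintype.card_fin, nsmul_eq_mul, mul_assoc,
    ENNReal.ofReal_mul (Nat.cast_nonneg r), ENNReal.ofReal_natCast]

theorem eLpNorm_step_sq_add_le (hξ : IsGaussianWalk P h G ξ) (hh : 0 < h) (m : ℕ) {q : ℕ}
    (hq : q ≠ 0) : eLpNorm (fun ω => ‖ξ m ω‖ ^ 2 + h) q P
      ≤ ENNReal.ofReal (((r * gaussianMoment (q * 2) 1) ^ 2 + 1) * h) := by
  have hm := hξ.measurable' m
  have hq' : (1 : ℝ≥0∞) ≤ q := by exact_mod_cast Nat.one_le_iff_ne_zero.2 hq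
  have h1 := eLpNorm_add_le (μ := P) (p := q) (f := fun ω => ‖ξ m ω‖ ^ 2) (g := fun _ => h)
    (by fun_prop) (by fun_prop) hq'
  refine h1.trans ?_
  have h2 := eLpNorm_norm_rpow (p := q) (μ := P) (ξ m) (q := 2) (by norm_num)
  have h3 := hξ.eLpNorm_step_le hh m (q := q * 2) (by omega)
  simp only [Real.rpow_ofNat, ENNReal.ofReal_ofNat] at h2
  have hG := gaussianMoment_nonneg (q * 2) 1
  rw [h2, eLpNorm_const _ (by exact_mod_cast hq) (NeZero.ne P), measure_univ, ENNReal.one_rpow,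
    mul_one, Real.enorm_of_nonneg hh.le, add_mul, one_mul, ENNReal.ofReal_add (by positivity) hh.le]
  gcongr
  rw [Nat.cast_mul, Nat.cast_ofNat] at h3
  refine (ENNReal.rpow_le_rpow h3 (by norm_num)).trans (le_of_eq ?_)
  rw [ENNReal.ofReal_rpow_of_nonneg (by positivity) (by norm_num), Real.rpow_ofNat, mul_pow,
    Real.sq_sqrt hh.le]

/-- Sums of semimartingale increments driven by a Gaussian walk have moments of Brownian order. -/
theorem exists_eLpNorm_sum_le (C : ℝ) (hC : 0 ≤ C) (r n : ℕ) {q : ℕ} (hq : q ≠ 0) :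
    ∃ K : ℝ, 0 ≤ K ∧ ∀ {Ω : Type} [MeasurableSpace Ω] {P : Measure Ω} [IsProbabilityMeasure P]
      {h : ℝ} {G : ℕ → MeasurableSpace Ω} {ξ : ℕ → Ω → E r} (_ : IsGaussianWalk P h G ξ) (_ : 0 < h)
      {D : ℕ → Ω → E n} {U : Fin n → ℕ → Ω → E r} (_ : ∀ j m, Measurable[G m] (U j m))
      (_ : ∀ j m ω, ‖U j m ω‖ ≤ C)
      (_ : ∀ j m ω, |D m ω j - inner ℝ (U j m ω) (ξ m ω)| ≤ C * (‖ξ m ω‖ ^ 2 + h))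
      (i k : ℕ) (_ : k * h ≤ 1), eLpNorm (fun ω => ∑ m ∈ Finset.range k, D (i + m) ω) q P
        ≤ ENNReal.ofReal (K * √(k * h)) := by
  set K₁ := gaussianMoment q C
  set K₂ := (r * gaussianMoment (q * 2) 1) ^ 2 + 1
  have hK₁ : 0 ≤ K₁ := gaussianMoment_nonneg q C
  refine ⟨n * (K₁ + C * K₂), by positivity, ?_⟩
  intro Ω _ P _ h G ξ hξ hh D U hU hUC hD i k hk
  have hq' : (1 : ℝ≥0∞) ≤ q := by exact_mod_cast Nat.one_le_iff_ne_zero.2 hq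
  set M : Fin n → Ω → ℝ := fun j ω => ∑ m ∈ Finset.range k, inner ℝ (U j (i + m) ω) (ξ (i + m) ω)
  set Q : Ω → ℝ := fun ω => ∑ m ∈ Finset.range k, (‖ξ (i + m) ω‖ ^ 2 + h)
  have hm : ∀ m, Measurable (ξ m) := hξ.measurable'
  have hM : ∀ j, Measurable (M j) := fun j =>
    (hξ.measurable_sum (hU j) i k).mono (hξ.le _) le_rfl
  have hQ : Measurable Q := by fun_prop
  have h1 : ∀ j, eLpNorm (M j) q P ≤ ENNReal.ofReal (K₁ * √(k * h)) := fun j =>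
    hξ.eLpNorm_sum_inner_le hh (hU j) (hUC j) i k hq
  have h2 : eLpNorm Q q P ≤ ENNReal.ofReal (K₂ * √(k * h)) := by
    have h3 := eLpNorm_sum_le (μ := P) (p := q) (s := Finset.range k)
      (f := fun m ω => ‖ξ (i + m) ω‖ ^ 2 + h) (fun m _ => by fun_prop) hq'
    rw [Finset.sum_fn] at h3
    refine h3.trans ((Finset.sum_le_sum fun m _ => hξ.eLpNorm_step_sq_add_le hh _ hq).trans ?_)
    rw [Finset.sum_const, Finset.card_range, nsmul_eq_mul, ← ENNReal.ofReal_natCast,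
      ← ENNReal.ofReal_mul (Nat.cast_nonneg k)]
    refine ENNReal.ofReal_le_ofReal ?_
    have h4 : k * h ≤ √(k * h) := by
      refine Real.le_sqrt_of_sq_le ?_
      nlinarith [show 0 ≤ k * h by positivity]
    calc (k : ℝ) * (K₂ * h) = K₂ * (k * h) := by ring
      _ ≤ _ := by gcongr
  have hpt : ∀ ω, ‖∑ m ∈ Finset.range k, D (i + m) ω‖ ≤ (∑ j : Fin n, fun ω => ‖M j ω‖ + C * Q ω) ω := by
    intro ω
    refine (norm_le_sum_abs_coord _).trans ?_
    rw [Finset.sum_apply]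
    refine Finset.sum_le_sum fun j _ => ?_
    have h5 : |(∑ m ∈ Finset.range k, D (i + m) ω) j - M j ω| ≤ C * Q ω := by
      rw [WithLp.ofLp_sum, Finset.sum_apply, ← Finset.sum_sub_distrib, Finset.mul_sum]
      exact (Finset.abs_sum_le_sum_abs _ _).trans (Finset.sum_le_sum fun m _ => hD j (i + m) ω)
    have h6 := abs_sub_abs_le_abs_sub ((∑ m ∈ Finset.range k, D (i + m) ω) j) (M j ω)
    rw [Real.norm_eq_abs]
    linarith
  refine (eLpNorm_mono_real hpt).trans ((eLpNorm_sum_le (fun j _ => ?_) hq').trans ?_)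
  · exact (by fun_prop : Measurable fun ω => ‖M j ω‖ + C * Q ω).aestronglyMeasurable
  have h7 : ∀ j, eLpNorm (fun ω => ‖M j ω‖ + C * Q ω) q P
      ≤ ENNReal.ofReal ((K₁ + C * K₂) * √(k * h)) := by
    intro j
    refine (eLpNorm_add_le (f := fun ω => ‖M j ω‖) (g := C • Q) (by fun_prop) (by fun_prop)
      hq').trans ?_
    rw [eLpNorm_norm, eLpNorm_const_smul, Real.enorm_of_nonneg hC, add_mul,
      ENNReal.ofReal_add (by positivity) (by positivity), mul_assoc C, ENNReal.ofReal_mul hC]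
    gcongr
    exact h1 j
  refine (Finset.sum_le_sum fun j _ => h7 j).trans (le_of_eq ?_)
  rw [Finset.sum_const, Finset.card_univ, Fintype.card_fin, nsmul_eq_mul, mul_assoc (n : ℝ),
    ENNReal.ofReal_mul (Nat.cast_nonneg n), ENNReal.ofReal_natCast]

end IsGaussianWalk

end Moments

end ReflectedSDE

namespace ReflectedSDE

open Filter Topology

section Chaining

variable {F : Type*} [PseudoMetricSpace F]

/-- The largest multiple of `2⁻ⁿ` which is at most `u`. -/
noncomputable def dyadicFloor (n : ℕ) (u : ℝ≥0) : ℝ≥0 := ⌊u * 2 ^ n⌋₊ * mesh n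

theorem dyadicFloor_le (n : ℕ) (u : ℝ≥0) : dyadicFloor n u ≤ u := by
  rw [dyadicFloor, mesh, ← div_eq_mul_inv, div_le_iff₀ (by positivity)]
  exact Nat.floor_le zero_le

theorem le_dyadicFloor_add (n : ℕ) (u : ℝ≥0) : u ≤ dyadicFloor n u + mesh n := by
  have h : u ≤ (⌊u * 2 ^ n⌋₊ + 1) * mesh n := by
    rw [mesh, ← div_eq_mul_inv, le_div_iff₀ (by positivity)]
    exact (Nat.lt_floor_add_one _).le
  rwa [add_mul, one_mul] at h

theorem tendsto_mesh : Tendsto (fun n => (mesh n : ℝ)) atTop (𝓝 0) := by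
  simp_rw [coe_mesh, ← inv_pow]
  exact tendsto_pow_atTop_nhds_zero_of_lt_one (by norm_num) (by norm_num)

theorem tendsto_dyadicFloor (u : ℝ≥0) : Tendsto (fun n => dyadicFloor n u) atTop (𝓝 u) := by
  rw [← NNReal.tendsto_coe]
  refine tendsto_of_tendsto_of_tendsto_of_le_of_le (g := fun n => (u : ℝ) - mesh n)
    (h := fun _ => (u : ℝ)) ?_ tendsto_const_nhds (fun n => ?_) fun n => ?_
  · simpa using tendsto_const_nhds.sub tendsto_mesh
  · have : (u : ℝ) ≤ dyadicFloor n u + mesh n := by exact_mod_cast le_dyadicFloor_add n u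
    dsimp only
    linarith
  · exact_mod_cast dyadicFloor_le n u

variable {f : ℝ≥0 → F} {a R : ℝ} {T : ℕ}

theorem dist_dyadicFloor_succ_le (ha : 0 < a) (ha1 : a < 1) (hR : 0 ≤ R)
    (hf : ∀ ℓ k : ℕ, ((k + 1 : ℕ) : ℝ≥0) * mesh ℓ ≤ T →
      dist (f (k * mesh ℓ)) (f ((k + 1 : ℕ) * mesh ℓ)) ≤ R * a ^ ℓ) {u : ℝ≥0} (hu : u ≤ T) (n : ℕ) :
    dist (f (dyadicFloor n u)) (f (dyadicFloor (n + 1) u)) ≤ R * a ^ n := by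
  set k := ⌊u * 2 ^ n⌋₊
  have h1 : (k : ℝ≥0) ≤ u * 2 ^ n := Nat.floor_le zero_le
  have h2 : u * 2 ^ n < k + 1 := Nat.lt_floor_add_one _
  have h3 : dyadicFloor n u = (2 * k : ℕ) * mesh (n + 1) := by
    rw [dyadicFloor, mesh, mesh, pow_succ]
    push_cast
    field_simp
    rfl
  have h4 : 2 * k ≤ ⌊u * 2 ^ (n + 1)⌋₊ := Nat.le_floor (by
    push_cast
    calc (2 : ℝ≥0) * k ≤ 2 * (u * 2 ^ n) := by gcongr
      _ = _ := by ring)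
  have h5 : ⌊u * 2 ^ (n + 1)⌋₊ < 2 * k + 2 := (Nat.floor_lt' (by omega)).2 (by
    push_cast
    calc u * 2 ^ (n + 1) = 2 * (u * 2 ^ n) := by ring
      _ < 2 * (k + 1) := by gcongr
      _ = _ := by ring)
  have h6 : R * a ^ (n + 1) ≤ R * a ^ n :=
    mul_le_mul_of_nonneg_left (pow_le_pow_of_le_one ha.le ha1.le n.le_succ) hR
  rcases (show ⌊u * 2 ^ (n + 1)⌋₊ = 2 * k ∨ ⌊u * 2 ^ (n + 1)⌋₊ = 2 * k + 1 by omega) with h | h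
  · rw [h3, dyadicFloor, h, dist_self]
    positivity
  · have h7 := dyadicFloor_le (n + 1) u
    rw [dyadicFloor, h] at h7
    rw [h3, dyadicFloor, h]
    exact (hf (n + 1) (2 * k) (h7.trans hu)).trans h6

theorem dist_dyadicFloor_le (hcont : Continuous f) (ha : 0 < a) (ha1 : a < 1) (hR : 0 ≤ R)
    (hf : ∀ ℓ k : ℕ, ((k + 1 : ℕ) : ℝ≥0) * mesh ℓ ≤ T →
      dist (f (k * mesh ℓ)) (f ((k + 1 : ℕ) * mesh ℓ)) ≤ R * a ^ ℓ) {u : ℝ≥0} (hu : u ≤ T) (n : ℕ) :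
    dist (f (dyadicFloor n u)) (f u) ≤ R * a ^ n / (1 - a) :=
  dist_le_of_le_geometric_of_tendsto a R ha1 (dist_dyadicFloor_succ_le ha ha1 hR hf hu)
    ((hcont.tendsto u).comp (tendsto_dyadicFloor u)) n

theorem dist_dyadicFloor_dyadicFloor_le
    (hR : 0 ≤ R) (ha : 0 < a) (hf : ∀ ℓ k : ℕ, ((k + 1 : ℕ) : ℝ≥0) * mesh ℓ ≤ T →
      dist (f (k * mesh ℓ)) (f ((k + 1 : ℕ) * mesh ℓ)) ≤ R * a ^ ℓ) {s t : ℝ≥0} (hst : s ≤ t)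
    (ht : t ≤ T) (n : ℕ) : dist (f (dyadicFloor n s)) (f (dyadicFloor n t))
      ≤ ((t - s) * 2 ^ n + 1) * (R * a ^ n) := by
  have h1 : ⌊s * 2 ^ n⌋₊ ≤ ⌊t * 2 ^ n⌋₊ := Nat.floor_mono (by gcongr)
  have h2 := dist_le_Ico_sum_of_dist_le (f := fun k : ℕ => f (k * mesh n)) h1
    (d := fun _ => R * a ^ n) fun {k} _ hk => hf n k (by
      refine le_trans ?_ ((dyadicFloor_le n t).trans ht)
      rw [dyadicFloor]
      gcongr
      omega)
  refine h2.trans ?_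
  rw [Finset.sum_const, Nat.card_Ico, nsmul_eq_mul, Nat.cast_sub h1]
  refine mul_le_mul_of_nonneg_right ?_ (by positivity)
  have h3 : (⌊t * 2 ^ n⌋₊ : ℝ) ≤ t * 2 ^ n := by
    exact_mod_cast Nat.floor_le (zero_le (a := t * 2 ^ n))
  have h4 : (s * 2 ^ n : ℝ) < ⌊s * 2 ^ n⌋₊ + 1 := by exact_mod_cast Nat.lt_floor_add_one (s * 2 ^ n)
  linarith

theorem exists_mesh_le {δ : ℝ} (hδ : 0 < δ) {T : ℕ} (hT : δ ≤ T) :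
    ∃ n, (mesh n : ℝ) ≤ 2 * δ ∧ δ * 2 ^ n ≤ T + 1 := by
  rcases le_or_gt δ 1 with h | h
  · obtain ⟨n, hn, hn'⟩ := exists_nat_pow_near_of_lt_one hδ h (y := (1 / 2 : ℝ)) (by norm_num)
      (by norm_num)
    refine ⟨n, ?_, ?_⟩
    · rw [coe_mesh, ← inv_pow]
      rw [pow_succ, one_div] at hn
      linarith
    · rw [one_div, inv_pow, ← one_div, le_div_iff₀ (by positivity)] at hn'
      linarith [(Nat.cast_nonneg T : (0 : ℝ) ≤ T)]
  · refine ⟨0, ?_, ?_⟩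
    · rw [coe_mesh, pow_zero, inv_one]; linarith
    · rw [pow_zero]; linarith

theorem dist_le_of_dyadic_le (hcont : Continuous f) {β : ℝ} (hβ : 0 < β) (hβ1 : β ≤ 1) (hR : 0 ≤ R)
    (hf : ∀ ℓ k : ℕ, ((k + 1 : ℕ) : ℝ≥0) * mesh ℓ ≤ T →
      dist (f (k * mesh ℓ)) (f ((k + 1 : ℕ) * mesh ℓ)) ≤ R * ((2 : ℝ) ^ (-β)) ^ ℓ)
    {s t : ℝ≥0} (hst : s < t) (ht : t ≤ T) :
    dist (f s) (f t) ≤ 2 * (T + 2 + 2 / (1 - (2 : ℝ) ^ (-β))) * R * ((t : ℝ) - s) ^ β := by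
  set a : ℝ := (2 : ℝ) ^ (-β)
  have ha : 0 < a := by positivity
  have ha1 : a < 1 := Real.rpow_lt_one_of_one_lt_of_neg (by norm_num) (by linarith)
  have hδ : (0 : ℝ) < t - s := sub_pos.2 (by exact_mod_cast hst)
  have hδT : (t : ℝ) - s ≤ T := by
    have : (t : ℝ) ≤ T := by exact_mod_cast ht
    linarith [s.coe_nonneg]
  obtain ⟨n, hn, hn'⟩ := exists_mesh_le hδ hδT
  have h1 := dist_dyadicFloor_le hcont ha ha1 hR hf (hst.le.trans ht) n
  have h2 := dist_dyadicFloor_le hcont ha ha1 hR hf ht n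
  have h3 := dist_dyadicFloor_dyadicFloor_le hR ha hf hst.le ht n
  have h4 : ((t - s : ℝ) * 2 ^ n + 1) * (R * a ^ n) ≤ (T + 2) * (R * a ^ n) := by
    refine mul_le_mul_of_nonneg_right ?_ (by positivity)
    linarith
  have h5 : a ^ n ≤ 2 * ((t : ℝ) - s) ^ β := by
    have e : a ^ n = (mesh n : ℝ) ^ β := by
      rw [coe_mesh, ← inv_pow, ← Real.rpow_natCast, ← Real.rpow_natCast, ← Real.rpow_mul (by norm_num),
        Real.inv_rpow (by norm_num), ← Real.rpow_neg (by norm_num), ← Real.rpow_mul (by norm_num)]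
      congr 1
      ring
    rw [e]
    calc (mesh n : ℝ) ^ β ≤ (2 * (t - s)) ^ β := Real.rpow_le_rpow (by positivity) hn hβ.le
      _ = 2 ^ β * ((t : ℝ) - s) ^ β := Real.mul_rpow (by norm_num) hδ.le
      _ ≤ 2 ^ (1 : ℝ) * ((t : ℝ) - s) ^ β := by gcongr; norm_num
      _ = _ := by rw [Real.rpow_one]
  have h6 : dist (f s) (f t) ≤ (T + 2 + 2 / (1 - a)) * R * a ^ n := by
    have h7 := dist_triangle4 (f s) (f (dyadicFloor n s)) (f (dyadicFloor n t)) (f t)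
    rw [dist_comm (f s) (f (dyadicFloor n s))] at h7
    have h8 : (T + 2 + 2 / (1 - a)) * R * a ^ n
      = (T + 2) * (R * a ^ n) + R * a ^ n / (1 - a) + R * a ^ n / (1 - a) := by ring
    linarith
  have h9 : 0 < 1 - a := by linarith
  calc dist (f s) (f t) ≤ (T + 2 + 2 / (1 - a)) * R * a ^ n := h6
    _ ≤ (T + 2 + 2 / (1 - a)) * R * (2 * ((t : ℝ) - s) ^ β) := by gcongr
    _ = _ := by ring

end Chaining

section Tail

variable {n : ℕ}

theorem holderNorm_le {β : ℝ} {s t : ℝ≥0} {ψ : ℝ≥0 → E n} {C : ℝ}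
    (h : ∀ u₁ u₂, s ≤ u₁ → u₁ < u₂ → u₂ ≤ t → ‖ψ u₂ - ψ u₁‖ ≤ C * ((u₂ : ℝ) - u₁) ^ β) :
    holderNorm β s t ψ ≤ ENNReal.ofReal C := by
  refine iSup_le fun u₁ => iSup_le fun u₂ => iSup_le fun hu => ENNReal.ofReal_le_ofReal ?_
  have : (0 : ℝ) < u₂ - u₁ := sub_pos.2 (by exact_mod_cast hu.2.1)
  rw [div_le_iff₀ (by positivity)]
  exact h u₁ u₂ hu.1 hu.2.1 hu.2.2

theorem norm_sub_le_of_holderNorm_le {β : ℝ} {s t : ℝ≥0} {ψ : ℝ≥0 → E n} {C : ℝ} (hC : 0 ≤ C)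
    (h : holderNorm β s t ψ ≤ ENNReal.ofReal C) {u₁ u₂ : ℝ≥0} (h₁ : s ≤ u₁) (h₁₂ : u₁ < u₂)
    (h₂ : u₂ ≤ t) : ‖ψ u₂ - ψ u₁‖ ≤ C * ((u₂ : ℝ) - u₁) ^ β := by
  have hpos : (0 : ℝ) < u₂ - u₁ := sub_pos.2 (by exact_mod_cast h₁₂)
  rw [← div_le_iff₀ (by positivity), ← ENNReal.ofReal_le_ofReal_iff hC]
  refine le_trans ?_ h
  exact le_iSup_of_le u₁ (le_iSup_of_le u₂ (le_iSup_of_le ⟨h₁, h₁₂, h₂⟩ le_rfl))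

theorem holderNorm_mono {β : ℝ} {s t t' : ℝ≥0} (ht : t ≤ t') (ψ : ℝ≥0 → E n) :
    holderNorm β s t ψ ≤ holderNorm β s t' ψ :=
  iSup_mono fun _ => iSup_mono fun _ => iSup_mono' fun h => ⟨⟨h.1, h.2.1, h.2.2.trans ht⟩, le_rfl⟩

theorem exists_measure_holderNorm_ge_le (n : ℕ) {β : ℝ} (hβ : 0 < β) (hβ1 : β < 1 / 2) {q : ℕ}
    (hq : 1 < q * (1 / 2 - β)) (T : ℕ) (K : ℝ) (hK : 0 ≤ K) :
    ∃ K' : ℝ, 0 ≤ K' ∧ ∀ {Ω : Type} [MeasurableSpace Ω] {P : Measure Ω} {Z : Ω → ℝ≥0 → E n}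
      (_ : ∀ ω, Continuous (Z ω)) (_ : ∀ t, AEStronglyMeasurable (fun ω => Z ω t) P)
      (_ : ∀ ℓ k : ℕ, ((k + 1 : ℕ) : ℝ≥0) * mesh ℓ ≤ T →
        eLpNorm (fun ω => Z ω ((k + 1 : ℕ) * mesh ℓ) - Z ω (k * mesh ℓ)) q P
          ≤ ENNReal.ofReal (K * √(mesh ℓ)))
      (R : ℝ) (_ : 0 < R),
      P {ω | ENNReal.ofReal R ≤ holderNorm β 0 T (Z ω)} ≤ ENNReal.ofReal (K' * (R⁻¹) ^ q) := by
  have hq0 : q ≠ 0 := by rintro rfl; norm_num at hq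
  set a : ℝ := (2 : ℝ) ^ (-β)
  have ha : 0 < a := by positivity
  have ha1 : a < 1 := Real.rpow_lt_one_of_one_lt_of_neg (by norm_num) (by linarith)
  have h1a : 0 < 1 - a := by linarith
  set C : ℝ := 2 * (2 * (T + 2 + 2 / (1 - a))) with hC
  have hC0 : 0 < C := by positivity
  set ρ : ℝ := 2 * (√2⁻¹ / a) ^ q with hρ
  have hρ0 : 0 ≤ ρ := by positivity
  have hρ1 : ρ < 1 := by
    have e1 : √(2⁻¹ : ℝ) = (2 : ℝ) ^ (-(1 / 2) : ℝ) := by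
      rw [Real.sqrt_eq_rpow, Real.inv_rpow (by norm_num), Real.rpow_neg (by norm_num)]
    have e2 : ρ = (2 : ℝ) ^ (1 - q * (1 / 2 - β)) := by
      rw [hρ, e1, ← Real.rpow_sub (by norm_num), ← Real.rpow_natCast, ← Real.rpow_mul (by norm_num)]
      nth_rw 1 [← Real.rpow_one 2]
      rw [← Real.rpow_add (by norm_num)]
      congr 1
      ring
    rw [e2]
    exact Real.rpow_lt_one_of_one_lt_of_neg (by norm_num) (by linarith)
  refine ⟨T * (K * C) ^ q * (1 - ρ)⁻¹, by have : 0 < 1 - ρ := by linarith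
                                          positivity, ?_⟩
  intro Ω _ P Z hZ hZm hinc R hR
  set B : ℕ → ℕ → Set Ω := fun ℓ k => {ω | ENNReal.ofReal (R / C * a ^ ℓ)
    ≤ ‖Z ω ((k + 1 : ℕ) * mesh ℓ) - Z ω (k * mesh ℓ)‖ₑ}
  have hsub : {ω | ENNReal.ofReal R ≤ holderNorm β 0 T (Z ω)}
      ⊆ ⋃ ℓ, ⋃ k ∈ Finset.range (T * 2 ^ ℓ), B ℓ k := by
    intro ω hω
    by_contra hcon
    simp only [mem_iUnion, not_exists, Finset.mem_range] at hcon
    have h1 : holderNorm β 0 T (Z ω) ≤ ENNReal.ofReal (R / 2) := by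
      refine holderNorm_le fun u₁ u₂ _ h12 h2 => ?_
      have h3 := dist_le_of_dyadic_le (hZ ω) hβ (by linarith) (R := R / C) (by positivity)
        (fun ℓ k hk => ?_) h12 h2
      · rw [dist_comm, dist_eq_norm] at h3
        refine h3.trans (le_of_eq ?_)
        change 2 * (T + 2 + 2 / (1 - a)) * (R / C) * _ = _
        rw [show 2 * (T + 2 + 2 / (1 - a)) = C / 2 by rw [hC]; ring]
        field_simp
      · have hk' : k < T * 2 ^ ℓ := by
          rw [mesh, ← div_eq_mul_inv, div_le_iff₀ (by positivity)] at hk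
          have : k + 1 ≤ T * 2 ^ ℓ := by exact_mod_cast hk
          omega
        have h4 := hcon ℓ k hk'
        rw [mem_ofPred_eq, not_le, ← ofReal_norm] at h4
        rw [dist_comm, dist_eq_norm]
        exact (ENNReal.ofReal_lt_ofReal_iff'.1 h4).1.le
    have h2 : ENNReal.ofReal R ≤ ENNReal.ofReal (R / 2) := le_trans hω h1
    rw [ENNReal.ofReal_le_ofReal_iff (by positivity)] at h2
    linarith
  have hB : ∀ ℓ, ∀ k ∈ Finset.range (T * 2 ^ ℓ),
      P (B ℓ k) ≤ ENNReal.ofReal ((K * C * R⁻¹ * (√2⁻¹ / a) ^ ℓ) ^ q) := by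
    intro ℓ k hk
    have hk' : ((k + 1 : ℕ) : ℝ≥0) * mesh ℓ ≤ T := by
      rw [mesh, ← div_eq_mul_inv, div_le_iff₀ (by positivity)]
      have : k + 1 ≤ T * 2 ^ ℓ := by have := Finset.mem_range.1 hk; omega
      exact_mod_cast this
    have hpos : 0 < R / C * a ^ ℓ := by positivity
    have h1 := meas_ge_le_mul_pow_eLpNorm_enorm P (p := q) (by exact_mod_cast hq0)
      (ENNReal.natCast_ne_top q) ((hZm ((k + 1 : ℕ) * mesh ℓ)).sub (hZm (k * mesh ℓ)))
      (ε := ENNReal.ofReal (R / C * a ^ ℓ)) (by simpa using hpos) (by simp)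
    refine h1.trans ?_
    rw [ENNReal.toReal_natCast, ENNReal.rpow_natCast, ENNReal.rpow_natCast, ← mul_pow,
      ENNReal.ofReal_pow (by positivity)]
    gcongr
    refine (mul_le_mul_right (hinc ℓ k hk') _).trans (le_of_eq ?_)
    rw [← ENNReal.ofReal_inv_of_pos hpos, ← ENNReal.ofReal_mul (by positivity)]
    congr 1
    have h2 : √((2⁻¹ : ℝ) ^ ℓ) = √(2⁻¹ : ℝ) ^ ℓ := by
      refine (Real.sqrt_eq_iff_mul_self_eq (by positivity) (by positivity)).2 ?_
      rw [← mul_pow, Real.mul_self_sqrt (by norm_num)]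
    rw [coe_mesh, ← inv_pow, h2, div_pow]
    field_simp
  refine (measure_mono hsub).trans ((measure_iUnion_le _).trans ?_)
  have h1 : ∀ ℓ, P (⋃ k ∈ Finset.range (T * 2 ^ ℓ), B ℓ k)
      ≤ ENNReal.ofReal (T * (K * C * R⁻¹) ^ q * ρ ^ ℓ) := by
    intro ℓ
    refine (measure_biUnion_finset_le _ _).trans ((Finset.sum_le_sum (hB ℓ)).trans (le_of_eq ?_))
    rw [Finset.sum_const, Finset.card_range, nsmul_eq_mul, ← ENNReal.ofReal_natCast,
      ← ENNReal.ofReal_mul (by positivity)]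
    congr 1
    rw [hρ, mul_pow (K * C * R⁻¹), mul_pow (2 : ℝ), pow_right_comm (√2⁻¹ / a)]
    generalize ((√2⁻¹ / a) ^ q) ^ ℓ = u
    generalize (K * C * R⁻¹) ^ q = v
    push_cast
    ring
  refine (ENNReal.tsum_le_tsum h1).trans (le_of_eq ?_)
  rw [← ENNReal.ofReal_tsum_of_nonneg (fun ℓ => by positivity)
    ((summable_geometric_of_lt_one hρ0 hρ1).mul_left _), tsum_mul_left,
    tsum_geometric_of_lt_one hρ0 hρ1, mul_pow (K * C)]
  congr 1
  ac_rfl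

end Tail

end ReflectedSDE

namespace ReflectedSDE

open Filter Topology

section Semimartingale

variable {r n : ℕ}

/-- A process which moves regularly inside each dyadic interval of length `2⁻ᴺ`, and whose
increments over these intervals are, up to second order terms, bounded predictable linear functions
of the increments of the path. -/
structure IsDyadicSemimartingale (N : ℕ) (C : ℝ) (Z : Path (E r) → ℝ≥0 → E n) : Prop where
  continuous_path : ∀ w, Continuous (Z w)
  measurable : ∀ t, Measurable fun w => Z w t
  norm_sub_le : ∀ (w : Path (E r)) (m : ℕ) (s t : ℝ≥0), m * mesh N ≤ s → s ≤ t →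
    t ≤ (m + 1 : ℕ) * mesh N →
      ‖Z w t - Z w s‖ ≤ C * (((t : ℝ) - s) / mesh N) * (‖dyadicIncrement N w m‖ + mesh N)
  exists_integrand : ∃ U : Fin n → ℕ → Path (E r) → E r,
    (∀ j m, Measurable[dyadicPast r N m] (U j m)) ∧ (∀ j m w, ‖U j m w‖ ≤ C) ∧
    ∀ j m w, |(Z w ((m + 1 : ℕ) * mesh N) - Z w (m * mesh N)) j
      - inner ℝ (U j m w) (dyadicIncrement N w m)| ≤ C * (‖dyadicIncrement N w m‖ ^ 2 + mesh N)

theorem mesh_le_one (N : ℕ) : (mesh N : ℝ) ≤ 1 := by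
  rw [coe_mesh]
  exact inv_le_one_of_one_le₀ (one_le_pow₀ (by norm_num))

theorem mesh_eq_mul_mesh_add (ℓ j : ℕ) : mesh ℓ = 2 ^ j * mesh (ℓ + j) := by
  rw [mesh, mesh, pow_add]
  field_simp

theorem IsDyadicSemimartingale.exists_eLpNorm_sub_le (C : ℝ) (hC : 0 ≤ C) (r n : ℕ) {q : ℕ}
    (hq : q ≠ 0) : ∃ K : ℝ, 0 ≤ K ∧ ∀ {𝕎 : Measure (Path (E r))} (_ : IsWienerMeasure 𝕎) (N : ℕ)
      {Z : Path (E r) → ℝ≥0 → E n} (_ : IsDyadicSemimartingale N C Z) (ℓ k : ℕ),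
      eLpNorm (fun w => Z w ((k + 1 : ℕ) * mesh ℓ) - Z w (k * mesh ℓ)) q 𝕎
        ≤ ENNReal.ofReal (K * √(mesh ℓ)) := by
  obtain ⟨K, hK, hsum⟩ := IsGaussianWalk.exists_eLpNorm_sum_le C hC r n hq
  set K₁ := r * gaussianMoment q 1
  have hK₁ : 0 ≤ K₁ := mul_nonneg (Nat.cast_nonneg r) (gaussianMoment_nonneg q 1)
  refine ⟨max K (C * (K₁ + 1)), hK.trans (le_max_left _ _), fun {𝕎} h𝕎 N {Z} hZ ℓ k => ?_⟩
  have hprob := h𝕎.isProbabilityMeasure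
  have hwalk := h𝕎.isGaussianWalk N
  have hN : (0 : ℝ) < mesh N := by exact_mod_cast mesh_pos N
  rcases le_total ℓ N with hℓ | hℓ
  · obtain ⟨j, rfl⟩ := Nat.exists_eq_add_of_le hℓ
    obtain ⟨U, hU, hUC, hUZ⟩ := hZ.exists_integrand
    have h1 := hsum hwalk hN hU hUC (D := fun m w => Z w ((m + 1 : ℕ) * mesh (ℓ + j))
      - Z w (m * mesh (ℓ + j))) hUZ (k * 2 ^ j) (2 ^ j)
    have h2 : ((2 ^ j : ℕ) : ℝ) * mesh (ℓ + j) = mesh ℓ := by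
      rw [mesh_eq_mul_mesh_add ℓ j]; push_cast; rfl
    rw [h2] at h1
    refine le_trans (le_of_eq ?_) ((h1 (mesh_le_one ℓ)).trans (ENNReal.ofReal_le_ofReal ?_))
    · congr 1
      ext1 w
      have h3 := Finset.sum_range_sub (fun m => Z w ((k * 2 ^ j + m : ℕ) * mesh (ℓ + j))) (2 ^ j)
      refine Eq.trans ?_ h3.symm
      rw [mesh_eq_mul_mesh_add ℓ j]
      congr 2
      · push_cast; ring
      · push_cast; ring
    · gcongr
      exact le_max_left _ _
  · obtain ⟨j, rfl⟩ := Nat.exists_eq_add_of_le hℓ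
    set m := k / 2 ^ j
    have h1 : m * mesh N ≤ k * mesh (N + j) := by
      rw [mesh_eq_mul_mesh_add N j, ← mul_assoc]
      gcongr
      exact_mod_cast Nat.div_mul_le_self k (2 ^ j)
    have h2 : ((k + 1 : ℕ) : ℝ≥0) * mesh (N + j) ≤ (m + 1 : ℕ) * mesh N := by
      rw [mesh_eq_mul_mesh_add N j, ← mul_assoc]
      gcongr
      exact_mod_cast Nat.lt_div_mul_add (a := k) (b := 2 ^ j) (by positivity) |>.trans_eq (by ring)
    have h3 : (k : ℝ≥0) * mesh (N + j) ≤ (k + 1 : ℕ) * mesh (N + j) := by gcongr; simp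
    have h4 : ((((k + 1 : ℕ) * mesh (N + j) : ℝ≥0) : ℝ) - ((k * mesh (N + j) : ℝ≥0) : ℝ))
        = mesh (N + j) := by push_cast; ring
    set θ : ℝ := mesh (N + j) / mesh N with hθ
    have hθ0 : 0 ≤ θ := by positivity
    have hθ1 : θ ≤ 1 := by
      rw [hθ, div_le_one hN, mesh_eq_mul_mesh_add N j]
      push_cast
      exact le_mul_of_one_le_left (NNReal.coe_nonneg _) (one_le_pow₀ (by norm_num))
    have hq' : (1 : ℝ≥0∞) ≤ q := by exact_mod_cast Nat.one_le_iff_ne_zero.2 hq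
    have h5 : ∀ w, ‖Z w ((k + 1 : ℕ) * mesh (N + j)) - Z w (k * mesh (N + j))‖
        ≤ (C * θ) * ‖‖dyadicIncrement N w m‖ + mesh N‖ := by
      intro w
      have := hZ.norm_sub_le w m _ _ h1 h3 h2
      rwa [h4, ← hθ, ← Real.norm_of_nonneg (show 0 ≤ ‖dyadicIncrement N w m‖ + mesh N by positivity)]
        at this
    refine (eLpNorm_le_mul_eLpNorm_of_ae_le_mul (ae_of_all _ h5) _).trans ?_
    have hm := hwalk.measurable' m
    have h6 : eLpNorm (fun w : Path (E r) => ‖dyadicIncrement N w m‖ + mesh N) q 𝕎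
        ≤ ENNReal.ofReal ((K₁ + 1) * √(mesh N)) := by
      refine (eLpNorm_add_le (f := fun w : Path (E r) => ‖dyadicIncrement N w m‖)
        (g := fun _ => (mesh N : ℝ)) (by fun_prop) (by fun_prop) hq').trans ?_
      rw [eLpNorm_norm, eLpNorm_const _ (by exact_mod_cast hq) (NeZero.ne 𝕎), measure_univ,
        ENNReal.one_rpow, mul_one, Real.enorm_of_nonneg hN.le, add_mul, one_mul,
        ENNReal.ofReal_add (by positivity) (by positivity)]
      refine add_le_add (hwalk.eLpNorm_step_le hN m hq) (ENNReal.ofReal_le_ofReal ?_)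
      refine Real.le_sqrt_of_sq_le ?_
      nlinarith [mesh_le_one N]
    refine (mul_le_mul_right h6 _).trans ?_
    rw [← ENNReal.ofReal_mul (by positivity)]
    refine ENNReal.ofReal_le_ofReal ?_
    have h7 : θ * √(mesh N) ≤ √(mesh (N + j)) := by
      refine Real.le_sqrt_of_sq_le ?_
      rw [mul_pow, Real.sq_sqrt hN.le, sq, mul_assoc, hθ, div_mul_cancel₀ _ hN.ne', ← hθ]
      exact mul_le_of_le_one_left (NNReal.coe_nonneg _) hθ1
    calc C * θ * ((K₁ + 1) * √(mesh N)) = C * (K₁ + 1) * (θ * √(mesh N)) := by ring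
      _ ≤ C * (K₁ + 1) * √(mesh (N + j)) := by gcongr
      _ ≤ _ := by gcongr; exact le_max_right _ _

/-- The Hölder norms of dyadic semimartingales have tails of all polynomial orders. -/
theorem IsDyadicSemimartingale.exists_measure_holderNorm_ge_le (C : ℝ) (hC : 0 ≤ C) (r n : ℕ)
    {β : ℝ} (hβ : 0 < β) (hβ1 : β < 1 / 2) {p : ℝ} (hp : 0 ≤ p) (T : ℝ≥0) :
    ∃ K : ℝ, 0 ≤ K ∧ ∀ {𝕎 : Measure (Path (E r))} (_ : IsWienerMeasure 𝕎) (N : ℕ)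
      {Z : Path (E r) → ℝ≥0 → E n} (_ : IsDyadicSemimartingale N C Z) (R : ℝ) (_ : 0 < R),
      𝕎 {w | ENNReal.ofReal R ≤ holderNorm β 0 T (Z w)} ≤ ENNReal.ofReal (K * R ^ (-p)) := by
  obtain ⟨q, hq⟩ := exists_nat_gt (max p (1 / (1 / 2 - β)))
  have hqp : p < q := (le_max_left _ _).trans_lt hq
  have hqβ : 1 < q * (1 / 2 - β) :=
    (div_lt_iff₀ (by linarith)).1 ((le_max_right _ _).trans_lt hq)
  have hq0 : q ≠ 0 := by rintro rfl; norm_num at hqβ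
  obtain ⟨K₁, hK₁, h1⟩ := IsDyadicSemimartingale.exists_eLpNorm_sub_le C hC r n hq0
  obtain ⟨K₂, hK₂, h2⟩ := ReflectedSDE.exists_measure_holderNorm_ge_le n hβ hβ1 hqβ ⌈T⌉₊ K₁ hK₁
  refine ⟨max 1 K₂, zero_le_one.trans (le_max_left _ _), fun {𝕎} h𝕎 N {Z} hZ R hR => ?_⟩
  have hprob := h𝕎.isProbabilityMeasure
  rcases le_total R 1 with hR1 | hR1
  · refine prob_le_one.trans (ENNReal.one_le_ofReal.2 ?_)
    exact one_le_mul_of_one_le_of_one_le (le_max_left _ _)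
      (Real.one_le_rpow_of_pos_of_le_one_of_nonpos hR hR1 (by linarith))
  · have h3 : {w | ENNReal.ofReal R ≤ holderNorm β 0 T (Z w)}
        ⊆ {w | ENNReal.ofReal R ≤ holderNorm β 0 (⌈T⌉₊ : ℕ) (Z w)} :=
      fun w hw => le_trans hw (holderNorm_mono (Nat.le_ceil T) _)
    refine (measure_mono h3).trans ((h2 hZ.continuous_path
      (fun t => (hZ.measurable t).aestronglyMeasurable) (fun ℓ k _ => h1 h𝕎 N hZ ℓ k) R hR).trans
      (ENNReal.ofReal_le_ofReal ?_))
    have h4 : (R⁻¹) ^ q ≤ R ^ (-p) := by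
      rw [inv_pow, ← Real.rpow_natCast, ← Real.rpow_neg hR.le]
      exact Real.rpow_le_rpow_of_exponent_le hR1 (by linarith)
    gcongr
    exact le_max_right _ _

end Semimartingale

section Driver

variable {d r : ℕ} {O : Set (E d)} {σ : closure O → E r →L[ℝ] E d} {b : closure O → E d} {A : ℝ}

theorem measurable_solX_node (h : IsControlled O σ b A) (N : ℕ) (x₀ : closure O) (m : ℕ) :
    Measurable[dyadicPast r N m] fun w => solX h N x₀ w (m * mesh N) := by
  induction m with
  | zero =>
    simp only [Nat.cast_zero, zero_mul, solX_zero]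
    exact measurable_const
  | succ m ih =>
    have h1 : (m : ℝ≥0) * mesh N ≤ (m + 1 : ℕ) * mesh N := by gcongr; simp
    have h2 : ∀ w, solX h N x₀ w ((m + 1 : ℕ) * mesh N) = flow h (velocity N w m)
        (solX h N x₀ w (m * mesh N)) ((m + 1 : ℕ) * mesh N - m * mesh N) :=
      fun w => solX_eq h N x₀ w m h1 le_rfl
    simp_rw [h2]
    have h3 : Measurable fun p : E r × closure O =>
        flow h ((2 ^ N : ℝ) • p.1) p.2 ((m + 1 : ℕ) * mesh N - m * mesh N) :=
      ((continuous_flow h).comp (by fun_prop : Continuous fun p : E r × closure O =>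
        (((2 ^ N : ℝ) • p.1, p.2, (m + 1 : ℕ) * mesh N - m * mesh N) : E r × closure O × ℝ≥0))).measurable
    have h4 : dyadicPast r N m ≤ dyadicPast r N (m + 1) :=
      iSup₂_le fun k hk => le_iSup₂_of_le k (hk.trans m.lt_succ_self) le_rfl
    exact h3.comp ((measurable_dyadicIncrement N m.lt_succ_self).prodMk (ih.mono h4 le_rfl))

theorem norm_velocity_add_one (N : ℕ) (w : Path (E r)) (m : ℕ) :
    ‖velocity N w m‖ + 1 = (‖dyadicIncrement N w m‖ + mesh N) / mesh N := by
  rw [velocity, norm_smul, coe_mesh, Real.norm_of_nonneg (by positivity)]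
  field_simp

theorem isDyadicSemimartingale_dyadicInterp (r N : ℕ) :
    IsDyadicSemimartingale N 1 fun w : Path (E r) => dyadicInterp N w := by
  have hN : (0 : ℝ) < mesh N := by exact_mod_cast mesh_pos N
  refine ⟨fun w => (dyadicInterp N w).continuous,
    fun t => ((continuous_eval_const t).comp (continuous_dyadicInterp N)).measurable,
    fun w m s t h₁ hst h₂ => ?_,
    fun j _ _ => EuclideanSpace.single j 1, fun _ _ => measurable_const, by simp, fun j m w => ?_⟩
  · rw [dyadicInterp_eq N w m (h₁.trans hst) h₂, dyadicInterp_eq N w m h₁ (hst.trans h₂),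
      add_sub_add_left_eq_sub, ← sub_smul, norm_smul, one_mul, sub_sub_sub_cancel_right,
      Real.norm_of_nonneg (sub_nonneg.2 (by exact_mod_cast hst)), div_mul_eq_mul_div, mul_div_assoc,
      ← norm_velocity_add_one]
    have : (0 : ℝ) ≤ t - s := sub_nonneg.2 (by exact_mod_cast hst)
    nlinarith
  · have h1 : (m : ℝ≥0) * mesh N ≤ (m + 1 : ℕ) * mesh N := by gcongr; simp
    have h2 : dyadicInterp N w ((m + 1 : ℕ) * mesh N) - dyadicInterp N w (m * mesh N)
        = dyadicIncrement N w m := by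
      rw [dyadicInterp_eq N w m h1 le_rfl, dyadicInterp_eq N w m le_rfl h1, velocity,
        add_sub_add_left_eq_sub, ← sub_smul, smul_smul]
      convert one_smul ℝ _
      push_cast
      rw [coe_mesh]
      field_simp
      ring
    rw [h2, EuclideanSpace.inner_single_left]
    simp only [map_one, one_mul, sub_self, abs_zero]
    positivity

theorem exists_isDyadicSemimartingale_driver (h : IsControlled O σ b A) (hadm : IsAdmissible O)
    (x₀ : closure O) : ∃ C : ℝ, 0 ≤ C ∧ ∀ N, IsDyadicSemimartingale N C
      fun (w : Path (E r)) t => (solX h N x₀ w t : E d) - solL h N x₀ w t := by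
  obtain ⟨C₁, hC₁, hosc⟩ := exists_norm_sub_le_of_driver h hadm
  have hA1 := h.one_le
  have hA := h.nonneg
  set C : ℝ := A + 2 * A ^ 2 * C₁
  have hAC : A ≤ C := le_add_of_nonneg_right (by positivity)
  refine ⟨C, by positivity, fun N => ?_⟩
  have hN : (0 : ℝ) < mesh N := by exact_mod_cast mesh_pos N
  have hcell : ∀ (w : Path (E r)) (m : ℕ) (s t : ℝ≥0), m * mesh N ≤ s → s ≤ t →
      t ≤ (m + 1 : ℕ) * mesh N →
      ‖((solX h N x₀ w t : E d) - solL h N x₀ w t) - (solX h N x₀ w s - solL h N x₀ w s)‖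
        ≤ A * (((t : ℝ) - s) / mesh N) * (‖dyadicIncrement N w m‖ + mesh N) := by
    intro w m s t h₁ hst h₂
    rw [(isReflectedSolution_sol h N x₀ w).driver_sub_eq h m h₁ hst h₂]
    refine (intervalIntegral.norm_integral_le_of_norm_le_const fun u _ =>
      h.norm_drift_le (velocity N w m) _).trans (le_of_eq ?_)
    rw [abs_of_nonneg (sub_nonneg.2 (by exact_mod_cast hst)), norm_velocity_add_one]
    ring
  refine ⟨fun w => ?_, fun t => ?_, fun w m s t h₁ hst h₂ => ?_, ?_⟩
  · exact (continuous_subtype_val.comp (solX h N x₀ w).continuous).sub (solL h N x₀ w).continuous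
  · exact ((continuous_subtype_val.comp ((continuous_eval_const t).comp (continuous_solX h N x₀))).sub
      ((continuous_eval_const t).comp (continuous_solL h N x₀))).measurable
  · refine (hcell w m s t h₁ hst h₂).trans ?_
    have : (0 : ℝ) ≤ t - s := sub_nonneg.2 (by exact_mod_cast hst)
    gcongr
  refine ⟨fun j m w => ContinuousLinearMap.adjoint (σ (solX h N x₀ w (m * mesh N)))
    (EuclideanSpace.single j 1), fun j m => ?_, fun j m w => ?_, fun j m w => ?_⟩
  · have h1 : Continuous fun x => ContinuousLinearMap.adjoint (σ x) (EuclideanSpace.single j (1 : ℝ)) :=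
      (ContinuousLinearMap.adjoint.continuous.comp h.continuous_σ).clm_apply continuous_const
    exact h1.measurable.comp (measurable_solX_node h N x₀ m)
  · refine (ContinuousLinearMap.le_opNorm _ _).trans ?_
    rw [LinearIsometryEquiv.norm_map, PiLp.norm_single, norm_one, mul_one]
    exact (h.norm_σ _).trans hAC
  have hm : (m : ℝ≥0) * mesh N ≤ (m + 1 : ℕ) * mesh N := by gcongr; simp
  set x := solX h N x₀ w with hx
  set xm := x (m * mesh N)
  set ξ := dyadicIncrement N w m
  have hlen : (((m + 1 : ℕ) * mesh N : ℝ≥0) : ℝ) - ((m * mesh N : ℝ≥0) : ℝ) = mesh N := by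
    push_cast; ring
  rw [(isReflectedSolution_sol h N x₀ w).driver_sub_eq h m le_rfl hm le_rfl]
  have hnear : ∀ u : ℝ≥0, m * mesh N ≤ u → u ≤ (m + 1 : ℕ) * mesh N →
      ‖(x u : E d) - xm‖ ≤ C₁ * (A * (‖ξ‖ + mesh N)) := by
    intro u h₁ h₂
    obtain ⟨μ, n, hn⟩ := (isReflectedSolution_sol h N x₀ w).exists_isReflection
    refine hosc _ _ μ n hn _ _ _ h₁ fun v hv => (hcell w m _ v le_rfl hv.1 (hv.2.trans h₂)).trans ?_
    gcongr
    refine mul_le_of_le_one_right hA ?_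
    rw [div_le_one hN, ← hlen]
    gcongr
    exact hv.2.trans h₂
  have hint : IntervalIntegrable (fun u : ℝ => drift σ b (velocity N w m) (x u.toNNReal)) volume
      ((m * mesh N : ℝ≥0) : ℝ) (((m + 1 : ℕ) * mesh N : ℝ≥0) : ℝ) :=
    (h.continuous_drift.comp (continuous_const.prodMk
      (x.continuous.comp continuous_real_toNNReal))).intervalIntegrable _ _
  have hξ : (mesh N : ℝ) • drift σ b (velocity N w m) xm = σ xm ξ + (mesh N : ℝ) • b xm := by
    rw [drift, velocity, map_smul, smul_add, smul_smul, coe_mesh, inv_mul_cancel₀ (by positivity),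
      one_smul]
  have herr : ‖(∫ u in ((m * mesh N : ℝ≥0) : ℝ)..(((m + 1 : ℕ) * mesh N : ℝ≥0) : ℝ),
      drift σ b (velocity N w m) (x u.toNNReal)) - (σ xm ξ + (mesh N : ℝ) • b xm)‖
      ≤ A ^ 2 * C₁ * (‖ξ‖ + mesh N) ^ 2 := by
    rw [← hξ, ← hlen, ← intervalIntegral.integral_const, ← intervalIntegral.integral_sub hint
      intervalIntegrable_const]
    refine (intervalIntegral.norm_integral_le_of_norm_le_const
      (C := A * (‖velocity N w m‖ + 1) * (C₁ * (A * (‖ξ‖ + mesh N)))) fun u hu => ?_).trans ?_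
    · rw [uIoc_of_le (by exact_mod_cast hm)] at hu
      refine (h.norm_drift_sub_le _ _ _).trans ?_
      gcongr
      exact hnear _ (NNReal.le_toNNReal_of_coe_le hu.1.le) (Real.toNNReal_le_iff_le_coe.2 hu.2)
    · rw [hlen, abs_of_pos hN, norm_velocity_add_one]
      refine le_of_eq ?_
      field_simp
      rfl
  have hinner : inner ℝ (ContinuousLinearMap.adjoint (σ xm) (EuclideanSpace.single j 1)) ξ
      = σ xm ξ j := by
    rw [ContinuousLinearMap.adjoint_inner_left, EuclideanSpace.inner_single_left]
    simp
  rw [hinner, ← PiLp.sub_apply, ← Real.norm_eq_abs]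
  refine (PiLp.norm_apply_le _ j).trans ?_
  have hb := h.norm_b xm
  have h3 := norm_add_le ((∫ u in ((m * mesh N : ℝ≥0) : ℝ)..(((m + 1 : ℕ) * mesh N : ℝ≥0) : ℝ),
      drift σ b (velocity N w m) (x u.toNNReal)) - (σ xm ξ + (mesh N : ℝ) • b xm))
      ((mesh N : ℝ) • b xm)
  rw [sub_add, add_sub_cancel_right, norm_smul, Real.norm_of_nonneg hN.le] at h3
  refine h3.trans ((add_le_add herr (mul_le_mul_of_nonneg_left hb hN.le)).trans ?_)
  have h4 : (‖ξ‖ + mesh N) ^ 2 ≤ 2 * (‖ξ‖ ^ 2 + mesh N) := by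
    nlinarith [sq_nonneg (‖ξ‖ - mesh N), mesh_le_one N]
  calc A ^ 2 * C₁ * (‖ξ‖ + mesh N) ^ 2 + mesh N * A
      ≤ A ^ 2 * C₁ * (2 * (‖ξ‖ ^ 2 + mesh N)) + (‖ξ‖ ^ 2 + mesh N) * A := by
        gcongr; exact le_add_of_nonneg_left (by positivity)
    _ = _ := by ring

end Driver

end ReflectedSDE

namespace ReflectedSDE

open Filter Topology

section Tail

variable {d r : ℕ} {O : Set (E d)} {σ : closure O → E r →L[ℝ] E d} {b : closure O → E d} {A : ℝ}

/-- The Hölder norms of a reflected path and of its reflection term are controlled by that of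
their difference. -/
theorem exists_holderNorm_le_driver (h : IsControlled O σ b A) (hadm : IsAdmissible O) :
    ∃ C : ℝ, 0 < C ∧ ∀ (x : Path (closure O)) (ℓ : Path (E d)) (μ : Measure ℝ≥0) (n : ℝ≥0 → E d),
      IsReflection O x ℓ μ n → ∀ (β : ℝ) (T : ℝ≥0) (y : ℝ), 0 < β → 0 ≤ y →
        holderNorm β 0 T (fun t => (x t : E d) - ℓ t) ≤ ENNReal.ofReal y →
          holderNorm β 0 T (fun t => (x t : E d)) ≤ ENNReal.ofReal (C * y) ∧
            holderNorm β 0 T ℓ ≤ ENNReal.ofReal (C * y) := by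
  obtain ⟨C, hC, hosc⟩ := exists_norm_sub_le_of_driver h hadm
  refine ⟨C + 1, by positivity, fun x ℓ μ n hn β T y hβ hy hY => ?_⟩
  have hX : ∀ u₁ u₂ : ℝ≥0, u₁ < u₂ → u₂ ≤ T →
      ‖(x u₂ : E d) - x u₁‖ ≤ C * (y * ((u₂ : ℝ) - u₁) ^ β) := by
    intro u₁ u₂ h12 h2
    have hpos : (0 : ℝ) < u₂ - u₁ := sub_pos.2 (by exact_mod_cast h12)
    refine hosc x ℓ μ n hn u₁ u₂ _ h12.le fun u hu => ?_
    rcases hu.1.eq_or_lt with rfl | h1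
    · rw [sub_self, norm_zero]; positivity
    · refine (norm_sub_le_of_holderNorm_le hy hY zero_le h1 (hu.2.trans h2)).trans ?_
      have h3 : (0 : ℝ) ≤ u - u₁ := sub_nonneg.2 (by exact_mod_cast hu.1)
      gcongr
      exact hu.2
  refine ⟨holderNorm_le fun u₁ u₂ _ h12 h2 => ?_, holderNorm_le fun u₁ u₂ _ h12 h2 => ?_⟩
  · have hpos : (0 : ℝ) < u₂ - u₁ := sub_pos.2 (by exact_mod_cast h12)
    refine (hX u₁ u₂ h12 h2).trans ?_
    rw [← mul_assoc]
    gcongr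
    linarith
  · have h3 := norm_sub_le_of_holderNorm_le hy hY zero_le h12 h2
    have h4 := norm_sub_le ((x u₂ : E d) - x u₁) (((x u₂ : E d) - ℓ u₂) - (x u₁ - ℓ u₁))
    rw [show (x u₂ : E d) - x u₁ - (((x u₂ : E d) - ℓ u₂) - (x u₁ - ℓ u₁)) = ℓ u₂ - ℓ u₁ by abel]
      at h4
    have h5 := hX u₁ u₂ h12 h2
    calc ‖ℓ u₂ - ℓ u₁‖ ≤ C * (y * ((u₂ : ℝ) - u₁) ^ β) + y * ((u₂ : ℝ) - u₁) ^ β :=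
          h4.trans (add_le_add h5 h3)
      _ = _ := by ring

theorem exists_measure_max_holderNorm_ge_le (h : IsControlled O σ b A) (hadm : IsAdmissible O)
    (x₀ : closure O) {𝕎 : Measure (Path (E r))} (h𝕎 : IsWienerMeasure 𝕎) {β : ℝ} (hβ : 0 < β)
    (hβ1 : β < 1 / 2) {p : ℝ} (hp : 0 ≤ p) (T : ℝ≥0) :
    ∃ K : ℝ, ∀ (N : ℕ) (R : ℝ), 0 < R →
      𝕎 {w | ENNReal.ofReal R ≤ max (holderNorm β 0 T (dyadicInterp N w))
        (max (holderNorm β 0 T (fun t => (solX h N x₀ w t : E d)))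
          (holderNorm β 0 T (solL h N x₀ w)))} ≤ ENNReal.ofReal (K * R ^ (-p)) := by
  obtain ⟨C, hC, hY⟩ := exists_holderNorm_le_driver h hadm
  obtain ⟨C', hC', hsemi⟩ := exists_isDyadicSemimartingale_driver h hadm x₀
  obtain ⟨K₁, hK₁, h1⟩ := IsDyadicSemimartingale.exists_measure_holderNorm_ge_le 1 zero_le_one r r
    hβ hβ1 hp T
  obtain ⟨K₂, hK₂, h2⟩ := IsDyadicSemimartingale.exists_measure_holderNorm_ge_le C' hC' r d
    hβ hβ1 hp T
  refine ⟨K₁ + K₂ * C⁻¹ ^ (-p), fun N R hR => ?_⟩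
  have hsub : {w | ENNReal.ofReal R ≤ max (holderNorm β 0 T (dyadicInterp N w))
        (max (holderNorm β 0 T (fun t => (solX h N x₀ w t : E d)))
          (holderNorm β 0 T (solL h N x₀ w)))}
      ⊆ {w | ENNReal.ofReal R ≤ holderNorm β 0 T (dyadicInterp N w)}
        ∪ {w | ENNReal.ofReal (C⁻¹ * R)
          ≤ holderNorm β 0 T (fun t => (solX h N x₀ w t : E d) - solL h N x₀ w t)} := by
    intro w hw
    by_contra hcon
    simp only [mem_union, mem_ofPred_eq, not_or, not_le] at hcon
    obtain ⟨μ, n, hn⟩ := (isReflectedSolution_sol h N x₀ w).exists_isReflection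
    set y := (holderNorm β 0 T (fun t => (solX h N x₀ w t : E d) - solL h N x₀ w t)).toReal
    have htop := ne_top_of_lt hcon.2
    have hy : y < C⁻¹ * R := by
      rw [← ENNReal.ofReal_lt_ofReal_iff (by positivity), ENNReal.ofReal_toReal htop]
      exact hcon.2
    have hCy : C * y < R := by
      rwa [inv_mul_eq_div, lt_div_iff₀ hC, mul_comm] at hy
    obtain ⟨h3, h4⟩ := hY _ _ μ n hn β T y hβ ENNReal.toReal_nonneg (ENNReal.ofReal_toReal htop).ge
    have h5 : ENNReal.ofReal (C * y) < ENNReal.ofReal R := (ENNReal.ofReal_lt_ofReal_iff hR).2 hCy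
    exact absurd hw (not_le.2 (max_lt hcon.1 (max_lt (h3.trans_lt h5) (h4.trans_lt h5))))
  refine (measure_mono hsub).trans ((measure_union_le _ _).trans ?_)
  refine (add_le_add (h1 h𝕎 N (isDyadicSemimartingale_dyadicInterp r N) R hR)
    (h2 h𝕎 N (hsemi N) (C⁻¹ * R) (by positivity))).trans (le_of_eq ?_)
  rw [← ENNReal.ofReal_add (by positivity) (by positivity), Real.mul_rpow (by positivity) hR.le]
  congr 1
  ring

end Tail

section Tightness

variable {Y : Type} [MetricSpace Y] [ProperSpace Y]

/-- `f` has Hölder constant `R` with exponent `β` up to time `T`. -/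
def HolderUpTo (β R : ℝ) (T : ℝ≥0) (f : ℝ≥0 → Y) : Prop :=
  ∀ s t, s ≤ T → t ≤ T → dist (f s) (f t) ≤ R * dist s t ^ β

theorem isCompact_setOf_holderUpTo {β : ℝ} (hβ : 0 < β) (y₀ : Y) (R : ℕ → ℝ) :
    IsCompact {f : Path Y | f 0 = y₀ ∧ ∀ j : ℕ, HolderUpTo β (R j) j f} := by
  set S : Set (Path Y) := {f : Path Y | f 0 = y₀ ∧ ∀ j : ℕ, HolderUpTo β (R j) j f}
  have hequi : Equicontinuous fun f : {g : ℝ≥0 → Y | ∀ j : ℕ, HolderUpTo β (R j) j g} => (f : ℝ≥0 → Y) := by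
    intro t
    obtain ⟨j, hj⟩ := exists_nat_gt t
    refine Metric.equicontinuousAt_of_continuity_modulus (fun s => R j * dist t s ^ β) ?_ _ ?_
    · have hc : Continuous fun s => R j * dist t s ^ β :=
        continuous_const.mul ((continuous_const.dist continuous_id).rpow_const fun _ => Or.inr hβ.le)
      simpa [hβ.ne'] using hc.tendsto t
    · filter_upwards [Iio_mem_nhds hj] with s hs f
      exact f.2 j t s hj.le (le_of_lt hs)
  refine ArzelaAscoli.isCompact_of_equicontinuous S ?_ ?_
  · have himage : ContinuousMap.toFun '' S
        = {g : ℝ≥0 → Y | g 0 = y₀ ∧ ∀ j : ℕ, HolderUpTo β (R j) j g} := by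
      ext g
      refine ⟨?_, fun hg => ⟨⟨g, ?_⟩, hg, rfl⟩⟩
      · rintro ⟨f, hf, rfl⟩; exact hf
      · exact hequi.continuous ⟨g, hg.2⟩
    rw [himage]
    refine (isCompact_univ_pi fun t : ℝ≥0 =>
      isCompact_closedBall y₀ (R ⌈t⌉₊ * dist t 0 ^ β)).of_isClosed_subset ?_ fun g hg t _ => ?_
    · simp only [HolderUpTo, ofPred_and, ofPred_forall]
      refine (isClosed_eq (continuous_apply 0) continuous_const).inter (isClosed_iInter fun j =>
        isClosed_iInter fun s => isClosed_iInter fun t => isClosed_iInter fun _ =>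
        isClosed_iInter fun _ => isClosed_le ((continuous_apply s).dist (continuous_apply t))
          continuous_const)
    · have := hg.2 ⌈t⌉₊ t 0 (Nat.le_ceil t) zero_le
      rwa [hg.1] at this
  · exact hequi.comp fun f : S => ⟨f, f.2.2⟩

theorem isTightMeasureSet_map_path {Ω : Type*} [MeasurableSpace Ω] {P : Measure Ω}
    {f : ℕ → Ω → Path Y} (hf : ∀ N, Measurable (f N)) (y₀ : Y) (h0 : ∀ N, ∀ᵐ ω ∂P, f N ω 0 = y₀)
    {β : ℝ} (hβ : 0 < β) (htail : ∀ (T : ℕ) (ε : ℝ≥0∞), 0 < ε →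
      ∃ R, ∀ N, P {ω | ¬ HolderUpTo β R T (f N ω)} ≤ ε) :
    IsTightMeasureSet (range fun N => P.map (f N)) := by
  rw [isTightMeasureSet_iff_exists_isCompact_measure_compl_le]
  intro ε hε
  obtain ⟨δ, hδ, hδε⟩ := ENNReal.exists_pos_sum_of_countable' hε.ne' ℕ
  choose R hR using fun j => htail j (δ j) (hδ j)
  have hK := isCompact_setOf_holderUpTo hβ y₀ R
  refine ⟨_, hK, ?_⟩
  rintro _ ⟨N, rfl⟩
  rw [Measure.map_apply (hf N) hK.isClosed.measurableSet.compl]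
  have hsub : f N ⁻¹' {f : Path Y | f 0 = y₀ ∧ ∀ j : ℕ, HolderUpTo β (R j) j f}ᶜ
      ⊆ {ω | ¬ f N ω 0 = y₀} ∪ ⋃ j : ℕ, {ω | ¬ HolderUpTo β (R j) j (f N ω)} := by
    intro ω hω
    by_contra hcon
    simp only [mem_union, mem_iUnion, mem_ofPred_eq, not_or, not_exists, not_not] at hcon
    exact hω hcon
  refine (measure_mono hsub).trans ((measure_union_le _ _).trans ?_)
  rw [show P {ω | ¬ f N ω 0 = y₀} = 0 from h0 N, zero_add]
  exact (measure_iUnion_le _).trans ((ENNReal.tsum_le_tsum fun j => hR j N).trans hδε.le)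

theorem holderUpTo_of_holderNorm_le {n : ℕ} {β : ℝ} (hβ : 0 < β) {T : ℝ≥0} {ψ : ℝ≥0 → E n} {R : ℝ} (hR : 0 ≤ R)
    (h : holderNorm β 0 T ψ ≤ ENNReal.ofReal R) : HolderUpTo β R T ψ := by
  intro s t hs ht
  rcases lt_trichotomy s t with hst | rfl | hst
  · have := norm_sub_le_of_holderNorm_le hR h zero_le hst ht
    rwa [dist_comm, dist_eq_norm, dist_comm, NNReal.dist_eq,
      abs_of_pos (sub_pos.2 (by exact_mod_cast hst))]
  · simp [hβ.ne']
  · have := norm_sub_le_of_holderNorm_le hR h zero_le hst hs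
    rwa [dist_eq_norm, NNReal.dist_eq, abs_of_pos (sub_pos.2 (by exact_mod_cast hst))]

theorem exists_forall_measure_not_holderUpTo_le {Ω : Type*} [MeasurableSpace Ω] {P : Measure Ω}
    {n : ℕ} {f : ℕ → Ω → ℝ≥0 → E n} {β : ℝ} (hβ : 0 < β) {T : ℝ≥0} {K : ℝ}
    (h : ∀ (N : ℕ) (R : ℝ), 0 < R →
      P {ω | ENNReal.ofReal R ≤ holderNorm β 0 T (f N ω)} ≤ ENNReal.ofReal (K * R ^ (-2 : ℝ)))
    {ε : ℝ≥0∞} (hε : 0 < ε) : ∃ R, ∀ N, P {ω | ¬ HolderUpTo β R T (f N ω)} ≤ ε := by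
  have h1 : Tendsto (fun R : ℝ => ENNReal.ofReal (K * R ^ (-2 : ℝ))) atTop (𝓝 0) := by
    rw [← ENNReal.ofReal_zero]
    refine ENNReal.tendsto_ofReal ?_
    simpa using (tendsto_rpow_neg_atTop (y := 2) (by norm_num)).const_mul K
  obtain ⟨R, hR, hR0⟩ := ((h1.eventually (ge_mem_nhds hε)).and (eventually_gt_atTop 0)).exists
  refine ⟨R, fun N => (measure_mono fun ω hω => ?_).trans ((h N R hR0).trans hR)⟩
  by_contra hcon
  exact hω (holderUpTo_of_holderNorm_le hβ hR0.le (le_of_lt (not_le.1 hcon)))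

end Tightness

section Laws

variable {d r : ℕ} {O : Set (E d)} {σ : closure O → E r →L[ℝ] E d} {b : closure O → E d} {A : ℝ}

theorem IsWienerMeasure.ae_dyadicInterp_zero {𝕎 : Measure (Path (E r))} (h𝕎 : IsWienerMeasure 𝕎)
    (N : ℕ) : ∀ᵐ w ∂𝕎, dyadicInterp N w 0 = 0 := by
  have h1 : ∀ i : Fin r, ∀ᵐ w : Path (E r) ∂𝕎, w 0 i = 0 := fun i =>
    (h𝕎.isBrownian i).toIsPreBrownianReal.eval_zero_ae_eq_zero
  filter_upwards [ae_all_iff.2 h1] with w hw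
  rw [dyadicInterp_eq N w 0 (by simp) zero_le]
  ext i
  simp [hw i]

theorem measurable_pathTriple_sol (h : IsControlled O σ b A) (x₀ : closure O) (N : ℕ) :
    Measurable (pathTriple (fun N => solX h N x₀) (fun N => solL h N x₀) N :
      Path (E r) → Path (closure O) × Path (E d) × Path (E r)) :=
  (continuous_solX h N x₀).measurable.prodMk
    ((continuous_solL h N x₀).measurable.prodMk (continuous_dyadicInterp N).measurable)

theorem isTightMeasureSet_approxLaw_sol (h : IsControlled O σ b A) (hadm : IsAdmissible O)
    (x₀ : closure O) {𝕎 : Measure (Path (E r))} (h𝕎 : IsWienerMeasure 𝕎) :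
    IsTightMeasureSet (range fun N : ℕ =>
      approxLaw 𝕎 (fun N => solX h N x₀) (fun N => solL h N x₀) N) := by
  have : CompactSpace (closure O) := isCompact_iff_compactSpace.1 h.isCompact
  have hβ : (0 : ℝ) < 1 / 4 := by norm_num
  have hX := isTightMeasureSet_map_path (P := 𝕎) (fun N => (continuous_solX h N x₀).measurable) x₀
    (fun N => ae_of_all _ fun w => solX_zero h N x₀ w) hβ fun T ε hε => by
      obtain ⟨K, hK⟩ := exists_measure_max_holderNorm_ge_le h hadm x₀ h𝕎 hβ (by norm_num)
        (p := 2) (by norm_num) T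
      exact exists_forall_measure_not_holderUpTo_le (f := fun N w t => (solX h N x₀ w t : E d)) hβ
        (fun N R hR => (hK N R hR).trans' (measure_mono fun w hw => by
          rw [mem_ofPred_eq] at hw ⊢
          exact le_max_of_le_right (le_max_of_le_left hw))) hε
  have hL := isTightMeasureSet_map_path (P := 𝕎) (fun N => (continuous_solL h N x₀).measurable) 0
    (fun N => ae_of_all _ fun w => solL_zero h N x₀ w) hβ fun T ε hε => by
      obtain ⟨K, hK⟩ := exists_measure_max_holderNorm_ge_le h hadm x₀ h𝕎 hβ (by norm_num)
        (p := 2) (by norm_num) T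
      exact exists_forall_measure_not_holderUpTo_le (f := fun N w => solL h N x₀ w) hβ
        (fun N R hR => (hK N R hR).trans' (measure_mono fun w hw => by
          rw [mem_ofPred_eq] at hw ⊢
          exact le_max_of_le_right (le_max_of_le_right hw))) hε
  have hW := isTightMeasureSet_map_path (P := 𝕎)
    (fun N => (continuous_dyadicInterp (r := r) N).measurable) 0
    (fun N => h𝕎.ae_dyadicInterp_zero N) hβ fun T ε hε => by
      obtain ⟨K, hK⟩ := exists_measure_max_holderNorm_ge_le h hadm x₀ h𝕎 hβ (by norm_num)
        (p := 2) (by norm_num) T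
      exact exists_forall_measure_not_holderUpTo_le (f := fun N w => dyadicInterp N w) hβ
        (fun N R hR => (hK N R hR).trans' (measure_mono fun w hw => by
          rw [mem_ofPred_eq] at hw ⊢
          exact le_max_of_le_left hw)) hε
  have hm := measurable_pathTriple_sol (r := r) h x₀
  refine IsTightMeasureSet.prodMk ?_ (IsTightMeasureSet.prodMk ?_ ?_)
  · convert hX using 1
    rw [← range_comp]
    congr 1
    ext1 N
    exact Measure.map_map measurable_fst (hm N)
  · convert hL using 1
    rw [← range_comp, ← range_comp]
    congr 1
    ext1 N
    dsimp only [Function.comp_apply]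
    rw [Measure.fst, Measure.snd, Measure.map_map measurable_fst measurable_snd, approxLaw,
      Measure.map_map (measurable_fst.comp measurable_snd) (hm N)]
    rfl
  · convert hW using 1
    rw [← range_comp, ← range_comp]
    congr 1
    ext1 N
    dsimp only [Function.comp_apply]
    rw [Measure.snd, Measure.snd, Measure.map_map measurable_snd measurable_snd, approxLaw,
      Measure.map_map (measurable_snd.comp measurable_snd) (hm N)]
    rfl

end Laws

end ReflectedSDE

theorem mainTheorem5 {d r : ℕ} (O : Set (ReflectedSDE.E d))
    (hO_open : IsOpen O) (hO_conn : IsConnected O) (hO_bdd : Bornology.IsBounded O)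
    (hO_adm : ReflectedSDE.IsAdmissible O)
    (σ : closure O → ReflectedSDE.E r →L[ℝ] ReflectedSDE.E d) (hσ : ∃ K : ℝ≥0, LipschitzWith K σ)
    (b : closure O → ReflectedSDE.E d) (hb : ∃ K : ℝ≥0, LipschitzWith K b)
    (x₀ : closure O)
    (𝕎 : Measure (ReflectedSDE.Path (ReflectedSDE.E r)))
    (h𝕎 : ReflectedSDE.IsWienerMeasure 𝕎) :
    -- for every path the reflected equation driven by its polygonalization is uniquely solvable
    (∀ (N : ℕ) (w : ReflectedSDE.Path (ReflectedSDE.E r)),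
      ∃! xl : ReflectedSDE.Path (closure O) × ReflectedSDE.Path (ReflectedSDE.E d),
        ReflectedSDE.IsReflectedSolution O σ b x₀ (ReflectedSDE.dyadicInterp N w) xl.1 xl.2) ∧
    -- and the solutions `(X^N, L^N)` have the following properties
    ∀ (X : ℕ → ReflectedSDE.Path (ReflectedSDE.E r) → ReflectedSDE.Path (closure O))
      (L : ℕ → ReflectedSDE.Path (ReflectedSDE.E r) → ReflectedSDE.Path (ReflectedSDE.E d)),
      (∀ N w, ReflectedSDE.IsReflectedSolution O σ b x₀ (ReflectedSDE.dyadicInterp N w)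
        (X N w) (L N w)) →
      -- the tail bound, with a constant which does not depend on `N`
      (∀ β : ℝ, 0 < β → β < 1 / 2 → ∀ p : ℝ, 1 < p → ∀ T : ℝ≥0, 0 < T →
        ∃ K : ℝ, ∀ (N : ℕ) (R : ℝ), 0 < R →
          𝕎 {w | ENNReal.ofReal R ≤
              max (ReflectedSDE.holderNorm β 0 T (ReflectedSDE.dyadicInterp N w))
                (max (ReflectedSDE.holderNorm β 0 T (fun t => (X N w t : ReflectedSDE.E d)))
                  (ReflectedSDE.holderNorm β 0 T (L N w)))}
            ≤ ENNReal.ofReal (K * R ^ (-p))) ∧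
      -- the laws `ℙ^N` are well defined and form a tight family
      (∀ N : ℕ, Measurable (ReflectedSDE.pathTriple X L N)) ∧
      IsTightMeasureSet (range fun N : ℕ => ReflectedSDE.approxLaw 𝕎 X L N) := by
  obtain ⟨A, hA⟩ := ReflectedSDE.exists_isControlled hO_open hO_conn.nonempty hO_bdd hO_adm hσ hb
  have hsol := ReflectedSDE.isReflectedSolution_sol hA
  refine ⟨fun N w => ⟨(ReflectedSDE.solX hA N x₀ w, ReflectedSDE.solL hA N x₀ w), hsol N x₀ w,
    fun xl hxl => Prod.ext_iff.2 (hxl.unique hA (hsol N x₀ w))⟩, fun X L hXL => ?_⟩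
  have hX : X = fun N => ReflectedSDE.solX hA N x₀ :=
    funext fun N => funext fun w => ((hXL N w).unique hA (hsol N x₀ w)).1
  have hL : L = fun N => ReflectedSDE.solL hA N x₀ :=
    funext fun N => funext fun w => ((hXL N w).unique hA (hsol N x₀ w)).2
  subst hX hL
  exact ⟨fun β hβ hβ1 p hp T _ => ReflectedSDE.exists_measure_max_holderNorm_ge_le hA hO_adm x₀ h𝕎
      hβ hβ1 (zero_le_one.trans hp.le) T,
    ReflectedSDE.measurable_pathTriple_sol hA x₀,
    ReflectedSDE.isTightMeasureSet_approxLaw_sol hA hO_adm x₀ h𝕎⟩
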